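/- Let $G$ be a real, finite-dimensional (Hausdorff, smooth, boundaryless) Lie group with Lie algebra $\mathfrak g=T_1G$ (bracket of left-invariant vector fields), let $\nu\in\mathfrak g^*$, and let $\alpha_\nu(g)=\nu\circ T_gL_{g^{-1}}$ be the left-invariant $1$-form on $G$ with value $\nu$ at the identity. Let $\mathrm{Ad}^*_g\mu=\mu\circ \mathrm{Ad}_{g^{-1}}$ be the coadjoint action, $\mathrm{ad}^*_\xi\mu=-\langle\mu,[\xi,\cdot\,]\rangle$ its infinitesimal version, $G_\nu=\{g\in G\mid \mathrm{Ad}^*_g\nu=\nu\}$ the isotropy group, and $\mathcal O_\nu=\{\mathrm{Ad}^*_g\nu\mid g\in G\}$ the coadjoint orbit. Let $V:G\to\mathbb R$ be smooth and $G_\nu$-invariant, i.e. $V(gh)=V(g)$ for all $g\in G$, $h\in G_\nu$, and consider on $TG$ the Lagrangian $$L(g,\dot g)=\langle\alpha_\nu(g),\dot g\rangle-V(g),$$ with Poincaré–Cartan form $\theta_L=\frac{\partial L}{\partial\dot g}\,dg$, Cartan form $\omega_L=-d\theta_L$ and energy $E_L=\dot g\,\frac{\partial L}{\partial\dot g}-L$.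 Let $\tau:TG\to G$ and $\pi:G\to G/G_\nu$ be the projections. Then: 1. The $2$-form $d\alpha_\nu$ is presymplectic (smooth and closed). For every $g$ its kernel at $g$ is the left translate $T_1L_g(\mathfrak g_\nu)$ of $$\mathfrak g_\nu=\{\xi\in\mathfrak g\mid\langle\nu,[\xi,\zeta]\rangle=0\ \ \forall\,\zeta\in\mathfrak g\},$$ and $\mathfrak g_\nu$ is the Lie algebra of $G_\nu$ (the set of velocities at $1$ of smooth curves in $G$ that pass through $1$ and lie in $G_\nu$). 2. $\theta_L=\tau^*\alpha_\nu$, $\omega_L=-\tau^*d\alpha_\nu$, $E_L=V\circ\tau$, and $\ker\omega_L=\{w\mid TL_{g^{-1}}(d\tau(w))\in\mathfrak g_\nu\}$ at every point $(g,\dot g)$, i.e. $\ker\omega_L\cong\mathfrak g_\nu\oplus\mathfrak g$ under the left trivialisation. 3. The presymplectic constraint algorithm for $i_\Gamma\omega_L=dE_L$, that is, $M_0=TG$ and $M_{n+1}=\{x\in M_n\mid i_v\omega_L=dE_L \text{ at } x \text{ for some } v \text{ tangent to } M_n\}$, stops at the first step: $M_n=TG$ for all $n$. A vector $w\in T_{(g,\dot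 g)}TG$ solves $i_w\omega_L=dE_L$ if and only if $u=d\tau(w)\in T_gG$ solves $i_u\,d\alpha_\nu=-dV$ on $G$. 4. Two points $p,q\in TG$ lie on the same leaf of $\ker\omega_L$ (are joined by finitely many smooth arcs tangent to $\ker\omega_L$) if and only if $\tau(q)$ lies in the connected component of $\tau(p)$ in the coset $\tau(p)G_\nu$. In particular, if $G_\nu$ is connected, the leaves are exactly the fibres of $\pi\circ\tau:TG\to G/G_\nu$, so that $TG/\ker\omega_L$ is identified with $G/G_\nu$. 5. $G/G_\nu$, with the quotient topology, is Hausdorff and carries a structure of smooth manifold of dimension $\dim\mathfrak g-\dim\mathfrak g_\nu$ for which $\pi$ is a smooth submersion, and $gG_\nu\mapsto\mathrm{Ad}^*_g\nu$ is then a $G$-equivariant injective smooth immersion $j:G/G_\nu\to\mathfrak g^*$ with image $\mathcal O_\nu$, whose tangent spaces are $T_\mu\mathcal O_\nu=\{\mathrm{ad}^*_\xi\mu\mid\xi\in\mathfrak g\}$; thus $G/G_\nu\cong\mathcal O_\nu$. For this structure there is exactly one $2$-form $\sigma$ on $G/G_\nu$ with $\pi^*\sigma=d\alpha_\nu$. It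 is symplectic (smooth, closed, nondegenerate), and it is the pullback by $j$ of the Kirillov–Kostant–Souriau form of $\mathcal O_\nu$, in the sign convention $$\omega_\mu(\mathrm{ad}^*_\xi\mu,\mathrm{ad}^*_\zeta\mu)=-\langle\mu,[\xi,\zeta]\rangle .$$ -/

import Mathlib

open Set Function
open scoped Manifold ContDiff Topology

noncomputable section

/-! ### Differential forms on manifolds -/

section Forms

variable {E : Type*} [NormedAddCommGroup E] [NormedSpace ℝ E]
  {H : Type*} [TopologicalSpace H] (I : ModelWithCorners ℝ E H)
  {M : Type*} [TopologicalSpace M] [ChartedSpace H M]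
  {E' : Type*} [NormedAddCommGroup E'] [NormedSpace ℝ E']
  {H' : Type*} [TopologicalSpace H'] (I' : ModelWithCorners ℝ E' H')
  {M' : Type*} [TopologicalSpace M'] [ChartedSpace H' M']

variable (M) in
/-- (Not necessarily smooth) real differential `k`-forms on a manifold. -/
abbrev DiffForm (k : ℕ) : Type _ := ∀ x : M, TangentSpace I x [⋀^Fin k]→L[ℝ] ℝ

/-- The expression of a form in the chart centred at `x₀`, that is, its pullback under the inverse
of that chart. -/
def DiffForm.inChart {k : ℕ} (Ω : DiffForm I M k) (x₀ : M) : E → E [⋀^Fin k]→L[ℝ] ℝ :=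
  fun y => (Ω ((extChartAt I x₀).symm y)).compContinuousLinearMap
    (mfderivWithin 𝓘(ℝ, E) I (extChartAt I x₀).symm (range I) y)

/-- A form is smooth if all its chart expressions are. -/
def DiffForm.IsSmooth {k : ℕ} (Ω : DiffForm I M k) : Prop :=
  ∀ x₀ : M, ContDiffOn ℝ ∞ (Ω.inChart I x₀) (extChartAt I x₀).target

/-- The exterior derivative of a form, computed at `x` in the chart centred at `x`. -/
def DiffForm.d {k : ℕ} (Ω : DiffForm I M k) : DiffForm I M (k + 1) :=
  fun x => (extDerivWithin (Ω.inChart I x) (range I)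
    (extChartAt I x x)).compContinuousLinearMap (mfderiv I 𝓘(ℝ, E) (extChartAt I x) x)

/-- Pullback `f^* ω` of a form under a map `f : M → M'`. -/
def DiffForm.pullback {k : ℕ} (f : M → M') (Ω : DiffForm I' M' k) : DiffForm I M k :=
  fun x => (Ω (f x)).compContinuousLinearMap (mfderiv I I' f x)

/-- The `1`-form associated with a field of covectors. -/
def DiffForm.ofCovectors (α : ∀ x : M, TangentSpace I x →L[ℝ] ℝ) : DiffForm I M 1 :=
  fun x => ContinuousAlternatingMap.ofSubsingleton ℝ (TangentSpace I x) ℝ (0 : Fin 1) (α x)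

/-- The kernel of a `2`-form at a point: the vectors `v` with `i_v ω = 0`. -/
def DiffForm.kerAt (Ω : DiffForm I M 2) (x : M) : Set (TangentSpace I x) :=
  {v | ∀ w : TangentSpace I x, Ω x ![v, w] = 0}

/-- A presymplectic form is a smooth closed `2`-form. -/
structure DiffForm.IsPresymplectic (Ω : DiffForm I M 2) : Prop where
  smooth : Ω.IsSmooth I
  closed : ∀ x, DiffForm.d I Ω x = 0

/-- A symplectic form is a smooth, closed, nondegenerate `2`-form. -/
structure DiffForm.IsSymplectic (Ω : DiffForm I M 2) : Prop extends
    DiffForm.IsPresymplectic I Ω where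
  nondegenerate : ∀ x, ∀ v ∈ DiffForm.kerAt I Ω x, v = 0

/-- `v` solves `i_v ω = df` at the point `x`. -/
def SolvesHamiltonAt (Ω : DiffForm I M 2) (f : M → ℝ) (x : M) (v : TangentSpace I x) : Prop :=
  ∀ w : TangentSpace I x, Ω x ![v, w] = mfderiv I 𝓘(ℝ, ℝ) f x w

/-- The velocity of a curve at time `t`, as an element of the tangent bundle. -/
def curveVelocity (γ : ℝ → M) (t : ℝ) : TangentBundle I M :=
  ⟨γ t, mfderiv 𝓘(ℝ, ℝ) I γ t (1 : ℝ)⟩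

/-- The vectors at `x` tangent to a subset `S`: the velocities at time `0` of the smooth curves
through `x` that lie in `S`. If `S` is an embedded submanifold and `x ∈ S`, this is `T_x S`. -/
def tangentVectorsTo (S : Set M) (x : M) : Set (TangentSpace I x) :=
  {v | ∃ γ : ℝ → M, ContMDiff 𝓘(ℝ, ℝ) I ∞ γ ∧ (∀ t, γ t ∈ S) ∧ curveVelocity I γ 0 = ⟨x, v⟩}

/-- The presymplectic constraint algorithm for `i_Γ ω = df`: it starts from `M₀ = M`, and
`M_{k+1}` is the set of the points of `M_k` at which the equation has a solution that is
tangent to `M_k`. -/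
def constraintSet (Ω : DiffForm I M 2) (f : M → ℝ) : ℕ → Set M
  | 0 => univ
  | k + 1 => {x ∈ constraintSet Ω f k |
      ∃ v ∈ tangentVectorsTo I (constraintSet Ω f k) x, SolvesHamiltonAt I Ω f x v}

/-- `p` and `q` lie on the same leaf of the characteristic distribution `ker ω`: they are joined
by finitely many smooth arcs that are everywhere tangent to `ker ω`. -/
def SameCharacteristicLeaf (Ω : DiffForm I M 2) : M → M → Prop :=
  Relation.ReflTransGen fun p q => ∃ γ : ℝ → M, ContMDiff 𝓘(ℝ, ℝ) I ∞ γ ∧ γ 0 = p ∧ γ 1 = q ∧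
    ∀ t, mfderiv 𝓘(ℝ, ℝ) I γ t (1 : ℝ) ∈ DiffForm.kerAt I Ω (γ t)

end Forms

/-! ### Lagrangian systems -/

section Lagrangian

variable {E : Type*} [NormedAddCommGroup E] [NormedSpace ℝ E]
  {H : Type*} [TopologicalSpace H] (I : ModelWithCorners ℝ E H)
  {Q : Type*} [TopologicalSpace Q] [ChartedSpace H Q] [IsManifold I 1 Q]

/-- The fibre derivative `∂L/∂q̇` of a Lagrangian at a point of `TQ`. -/
def fiberDeriv (L : TangentBundle I Q → ℝ) (p : TangentBundle I Q) :
    TangentSpace I p.proj →L[ℝ] ℝ :=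
  fderiv ℝ (fun v : TangentSpace I p.proj => L ⟨p.proj, v⟩) p.snd

/-- The Poincaré–Cartan `1`-form `θ_L = (∂L/∂q̇) dq` on `TQ`. -/
def cartanOneForm (L : TangentBundle I Q → ℝ) : DiffForm I.tangent (TangentBundle I Q) 1 :=
  DiffForm.ofCovectors I.tangent fun p =>
    (fiberDeriv I L p).comp
      (mfderiv I.tangent I (fun x : TangentBundle I Q => x.proj) p)

/-- The Cartan `2`-form `ω_L = - d θ_L`. -/
def cartanTwoForm (L : TangentBundle I Q → ℝ) : DiffForm I.tangent (TangentBundle I Q) 2 :=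
  - DiffForm.d I.tangent (cartanOneForm I L)

/-- The energy `E_L = q̇ ∂L/∂q̇ - L`. -/
def lagrangianEnergy (L : TangentBundle I Q → ℝ) (p : TangentBundle I Q) : ℝ :=
  fiberDeriv I L p p.snd - L p

end Lagrangian

/-! ### Lie groups and the coadjoint action -/

section LieGroups

variable {E : Type*} [NormedAddCommGroup E] [NormedSpace ℝ E]
  {H : Type*} [TopologicalSpace H] (I : ModelWithCorners ℝ E H)
  {G : Type*} [TopologicalSpace G] [ChartedSpace H G] [Group G]

instance instLieGroupMinSmoothnessThree [LieGroup I ∞ G] : LieGroup I (minSmoothness ℝ 3) G := by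
  rw [minSmoothness_of_isRCLikeNormedField]; infer_instance

instance instFiniteDimensionalTangentSpace [FiniteDimensional ℝ E] (g : G) :
    FiniteDimensional ℝ (TangentSpace I g) :=
  inferInstanceAs (FiniteDimensional ℝ E)

instance instT2TangentSpace (g : G) : T2Space (TangentSpace I g) :=
  inferInstanceAs (T2Space E)

/-- The left trivialisation `T_g L_{g⁻¹} : T_g G → 𝔤`, i.e. the Maurer–Cartan form at `g`. -/
def maurerCartan (g : G) : TangentSpace I g →L[ℝ] GroupLieAlgebra I G :=
  (mfderiv I I (fun h : G => g⁻¹ * h) g : E →L[ℝ] E)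

/-- The left-invariant `1`-form `α_ν` with value `ν` at the identity, as a field of covectors. -/
def leftInvariantCovector (ν : GroupLieAlgebra I G →L[ℝ] ℝ) (g : G) : TangentSpace I g →L[ℝ] ℝ :=
  ν.comp (maurerCartan I g)

/-- The left-invariant `1`-form `α_ν`. -/
def leftInvariantForm (ν : GroupLieAlgebra I G →L[ℝ] ℝ) : DiffForm I G 1 :=
  DiffForm.ofCovectors I (leftInvariantCovector I ν)

/-- The first-order Lagrangian `L(g, ġ) = ⟨α_ν(g), ġ⟩ - V(g)`. -/
def firstOrderLagrangian (ν : GroupLieAlgebra I G →L[ℝ] ℝ) (V : G → ℝ) (p : TangentBundle I G) :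
    ℝ :=
  leftInvariantCovector I ν p.proj p.snd - V p.proj

/-- The adjoint action `Ad_g`, the derivative at the identity of `h ↦ g h g⁻¹`. -/
def lieAd (g : G) : GroupLieAlgebra I G →L[ℝ] GroupLieAlgebra I G :=
  (mfderiv I I (fun h : G => g * h * g⁻¹) 1 : E →L[ℝ] E)

/-- The (left) coadjoint action `Ad^*_g μ = μ ∘ Ad_{g⁻¹}` of `G` on `𝔤^*`. -/
def coAd (g : G) (μ : GroupLieAlgebra I G →L[ℝ] ℝ) : GroupLieAlgebra I G →L[ℝ] ℝ :=
  μ.comp (lieAd I g⁻¹)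

lemma lieAd_one : lieAd I (1 : G) = ContinuousLinearMap.id ℝ (GroupLieAlgebra I G) := by
  have : (fun h : G => 1 * h * (1 : G)⁻¹) = id := by ext; simp
  unfold lieAd
  rw [this]
  exact mfderiv_id

lemma lieAd_mul [LieGroup I ∞ G] (g h : G) : lieAd I (g * h) = (lieAd I g).comp (lieAd I h) := by
  have hd : ∀ a x : G, MDifferentiableAt I I (fun y : G => a * y * a⁻¹) x := fun a x =>
    ((contMDiff_mul_left (I := I) (n := ∞) (a := a)).mul
      (contMDiff_const (c := a⁻¹))).mdifferentiableAt (by simp)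
  have hc : (fun y : G => (g * h) * y * (g * h)⁻¹)
      = (fun y : G => g * y * g⁻¹) ∘ (fun y : G => h * y * h⁻¹) := by
    ext y; simp [mul_assoc]
  have key := mfderiv_comp (I := I) (I' := I) (I'' := I) (1 : G)
    (g := fun y : G => g * y * g⁻¹) (f := fun y : G => h * y * h⁻¹) (hd g _) (hd h _)
  rw [← hc] at key
  have h1 : h * 1 * h⁻¹ = 1 := by simp
  have key2 : (mfderiv I I (fun y : G => (g * h) * y * (g * h)⁻¹) 1 : E →L[ℝ] E)
      = (mfderiv I I (fun y : G => g * y * g⁻¹) (h * 1 * h⁻¹) : E →L[ℝ] E).comp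
        (mfderiv I I (fun y : G => h * y * h⁻¹) 1 : E →L[ℝ] E) := key
  rw [h1] at key2
  exact key2

lemma coAd_one (μ : GroupLieAlgebra I G →L[ℝ] ℝ) : coAd I (1 : G) μ = μ := by
  simp only [coAd, inv_one, lieAd_one]; rfl

lemma coAd_mul [LieGroup I ∞ G] (g h : G) (μ : GroupLieAlgebra I G →L[ℝ] ℝ) :
    coAd I (g * h) μ = coAd I g (coAd I h μ) := by
  simp only [coAd, mul_inv_rev, lieAd_mul]; rfl

/-- The isotropy group `G_ν = {g | Ad^*_g ν = ν}`. -/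
def isotropyGroup [LieGroup I ∞ G] (ν : GroupLieAlgebra I G →L[ℝ] ℝ) : Subgroup G where
  carrier := {g | coAd I g ν = ν}
  mul_mem' {a b} ha hb := by
    simp only [mem_ofPred_eq] at ha hb ⊢
    rw [coAd_mul, hb, ha]
  one_mem' := coAd_one I ν
  inv_mem' {a} ha := by
    simp only [mem_ofPred_eq] at ha ⊢
    conv_lhs => rw [← ha]
    rw [← coAd_mul, inv_mul_cancel, coAd_one]

/-- The coadjoint orbit `O_ν` through `ν`. -/
def coadjointOrbit (ν : GroupLieAlgebra I G →L[ℝ] ℝ) : Set (GroupLieAlgebra I G →L[ℝ] ℝ) :=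
  range fun g : G => coAd I g ν

/-- The map `G / G_ν → 𝔤^*`, `g G_ν ↦ Ad^*_g ν`. -/
def orbitMap [LieGroup I ∞ G] (ν : GroupLieAlgebra I G →L[ℝ] ℝ) :
    G ⧸ isotropyGroup I ν → (GroupLieAlgebra I G →L[ℝ] ℝ) :=
  Quotient.lift (fun g : G => coAd I g ν) fun a b hab => by
    have hm : coAd I (a⁻¹ * b) ν = ν := QuotientGroup.leftRel_apply.mp hab
    calc coAd I a ν = coAd I a (coAd I (a⁻¹ * b) ν) := by rw [hm]
      _ = coAd I b ν := by rw [← coAd_mul, mul_inv_cancel_left]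

/-- The infinitesimal coadjoint action `ad^*_ξ μ = - ⟨μ, [ξ, ·]⟩`. -/
def coadInf [FiniteDimensional ℝ E] [LieGroup I ∞ G] (ξ : GroupLieAlgebra I G)
    (μ : GroupLieAlgebra I G →L[ℝ] ℝ) : GroupLieAlgebra I G →L[ℝ] ℝ :=
  - μ.comp (LinearMap.toContinuousLinearMap
      (LieModule.toEnd ℝ (GroupLieAlgebra I G) (GroupLieAlgebra I G) ξ))

/-- The set `{ξ | ⟨ν, [ξ, ζ]⟩ = 0 for all ζ}`, as a Lie subalgebra of `𝔤`. -/
def isotropyAlgebra [FiniteDimensional ℝ E] [LieGroup I ∞ G] (ν : GroupLieAlgebra I G →L[ℝ] ℝ) :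
    LieSubalgebra ℝ (GroupLieAlgebra I G) where
  carrier := {ξ | ∀ ζ : GroupLieAlgebra I G, ν ⁅ξ, ζ⁆ = 0}
  add_mem' {a b} ha hb ζ := by rw [add_lie, map_add, ha, hb, add_zero]
  zero_mem' ζ := by rw [zero_lie, map_zero]
  smul_mem' c a ha ζ := by rw [smul_lie, map_smul, ha, smul_zero]
  lie_mem' {a b} ha hb ζ := by
    rw [lie_lie, map_sub, ha, hb, sub_zero]

open Classical in
/-- The Kirillov–Kostant–Souriau form on `T_μ O = {ad^*_ξ μ | ξ ∈ 𝔤}`, in the sign convention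
`ω_μ(ad^*_ξ μ, ad^*_ζ μ) = - ⟨μ, [ξ, ζ]⟩` (see `kksForm_coadInf`); the value is `0` if the first
argument is not tangent to the orbit. -/
def kksForm [FiniteDimensional ℝ E] [LieGroup I ∞ G] (μ a b : GroupLieAlgebra I G →L[ℝ] ℝ) : ℝ :=
  if h : ∃ ξ : GroupLieAlgebra I G, coadInf I ξ μ = a then - b h.choose else 0

lemma kksForm_coadInf [FiniteDimensional ℝ E] [LieGroup I ∞ G] (μ : GroupLieAlgebra I G →L[ℝ] ℝ)
    (ξ ζ : GroupLieAlgebra I G) :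
    kksForm I μ (coadInf I ξ μ) (coadInf I ζ μ) = - μ ⁅ξ, ζ⁆ := by
  have h : ∃ ξ' : GroupLieAlgebra I G, coadInf I ξ' μ = coadInf I ξ μ := ⟨ξ, rfl⟩
  have h2 : - μ ⁅h.choose, ζ⁆ = - μ ⁅ξ, ζ⁆ := congrArg (fun f => f ζ) h.choose_spec
  rw [kksForm, dif_pos h, ← h2]
  change - - μ ⁅ζ, h.choose⁆ = _
  rw [← lie_skew, map_neg, neg_neg]

end LieGroups

end

noncomputable section

set_option linter.unusedSectionVars false

/-! ### Smooth families of alternating maps -/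

section AlternatingMaps

variable {X : Type*} [NormedAddCommGroup X] [NormedSpace ℝ X]
  {E : Type*} [NormedAddCommGroup E] [NormedSpace ℝ E]
  {E' : Type*} [NormedAddCommGroup E'] [NormedSpace ℝ E']

/-! Everything is read off from the orbit map `a(g) = Ad^*_g ν`, which is `orbE`. Write `θ` for the
Maurer–Cartan form. Differentiating `a` gives `da(v) = ad^*_η a(g)` with `η = Ad_g θ(v)`
(`tderiv_orbE_eq_coadE`), and the Maurer–Cartan equation gives `dα_ν(v, w) = -⟨ν, [θ v, θ w]⟩`
(`val_d_leftInvariantForm`). As `Ad_g` preserves the bracket, `dα_ν` is the pullback under `a` of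
the Kirillov–Kostant–Souriau form (`val_dLeft`). Moreover `ker dα_ν = ker da`, the left translate of
`𝔤_ν`.

Both derivatives come from the group law in the chart at the identity. With `H` its mixed second
derivative, the bracket is `H(ξ, ζ) - H(ζ, ξ)` (`lieE_eq_mulHess`). The same antisymmetrisation
computes the derivative of `Ad` (`tderiv_adE_one`) and `dα_ν` at the identity; left translation does
the rest.

By equivariance `a` has constant rank. The constant rank theorem (`nonempty_flatChart`) gives
coordinates `(u, z)` near the identity in which `a` depends on `u` alone, injectively. The slice `u
= const` through the identity parametrizes `G_ν`; it yields curves in `G_ν` with any velocity in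
`𝔤_ν`, and short arcs inside cosets. The slice `z = 0` yields the charts of `G / G_ν` and local
sections of `π`. Locally, `j : G / G_ν → 𝔤^*` is `a` after a section, and a chart is a linear map
after `j`; so smoothness and immersivity reduce to facts about `a`. The form `σ` is the pullback of
`dα_ν` under local sections. It does not depend on the section, being expressible through `j` alone
(`val_pullback_orbitSection`); closedness and uniqueness follow because `π` is a surjective
submersion.

On `TG`, the Lagrangian is affine in the velocity, so `θ_L` and `E_L` are pulled back along the
submersion `τ`, and all questions descend to `G`. Invariance of `V` makes `dV` vanish on `ker dα_ν`;
a skew form represents every covector that kills its kernel, so the Hamilton equation is solvable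
everywhere and the algorithm never shrinks `TG`. A curve is tangent to `ker ω_L` exactly when `a` is
constant along its projection (`velocity_mem_kerAt_iff`); hence leaves project into components of
cosets, and local arcs together with connectedness fill these components. -/

lemma contDiffAt_alternating_of_apply [FiniteDimensional ℝ E] {k : ℕ} {n : WithTop ℕ∞}
    {f : X → E [⋀^Fin k]→L[ℝ] ℝ} {x : X} (h : ∀ v, ContDiffAt ℝ n (fun y => f y v) x) :
    ContDiffAt ℝ n f x := by
  let b := Module.finBasis ℝ E
  let T : (E [⋀^Fin k]→L[ℝ] ℝ) →ₗ[ℝ] ((Fin k → Fin (Module.finrank ℝ E)) → ℝ) :=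
    { toFun := fun η i => η fun j => b (i j)
      map_add' := fun _ _ => rfl
      map_smul' := fun _ _ => rfl }
  have hT : LinearMap.ker T = ⊥ := by
    rw [LinearMap.ker_eq_bot]
    intro η η' hη
    have : η.toAlternatingMap = η'.toAlternatingMap :=
      Module.Basis.ext_alternating b fun v _ => congrFun hη v
    exact ContinuousAlternatingMap.ext fun v => congrArg (fun g => g v) this
  -- A left inverse of the coordinate map writes `f` as a fixed linear map of finitely many scalar
  -- functions.
  obtain ⟨S, hS⟩ := T.exists_leftInverse_of_injective hT
  have hf : f = fun y => LinearMap.toContinuousLinearMap S (T (f y)) := by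
    ext1 y
    exact (congrArg (fun g => g (f y)) hS).symm
  rw [hf]
  exact (LinearMap.toContinuousLinearMap S).contDiff.contDiffAt.comp x
    (contDiffAt_pi.2 fun i => h _)

lemma ContDiffAt.alternating_comp [FiniteDimensional ℝ E] {k : ℕ} {n : WithTop ℕ∞}
    {η : X → E' [⋀^Fin k]→L[ℝ] ℝ} {f : X → E →L[ℝ] E'} {x : X}
    (hη : ContDiffAt ℝ n η x) (hf : ContDiffAt ℝ n f x) :
    ContDiffAt ℝ n (fun y => (η y).compContinuousLinearMap (f y)) x := by
  refine contDiffAt_alternating_of_apply fun v => ?_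
  -- On a fixed vector, the pullback is linear in `η` and multilinear in the `k` copies of `f`,
  -- hence smooth in both.
  have h1 : ContDiffAt ℝ n (fun y =>
      ContinuousMultilinearMap.compContinuousLinearMapContinuousMultilinear ℝ
        (fun _ : Fin k => E) (fun _ : Fin k => E') ℝ (fun _ => f y)) x :=
    (ContinuousMultilinearMap.contDiff _).contDiffAt.comp x (contDiffAt_pi.2 fun _ => hf)
  have h2 : ContDiffAt ℝ n (fun y =>
      ContinuousAlternatingMap.toContinuousMultilinearMapCLM ℝ (η y)) x :=
    (ContinuousLinearMap.contDiff _).contDiffAt.comp x hη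
  exact (ContinuousMultilinearMap.apply ℝ (fun _ : Fin k => E) ℝ v).contDiff.contDiffAt.comp x
    (h1.clm_apply h2)

end AlternatingMaps

/-! ### Derivatives of maps between manifolds, with values in the model spaces -/

section ModelDerivative

variable {E : Type*} [NormedAddCommGroup E] [NormedSpace ℝ E]
  {H : Type*} [TopologicalSpace H] (I : ModelWithCorners ℝ E H)
  {M : Type*} [TopologicalSpace M] [ChartedSpace H M]
  {E' : Type*} [NormedAddCommGroup E'] [NormedSpace ℝ E']
  {H' : Type*} [TopologicalSpace H'] (I' : ModelWithCorners ℝ E' H')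
  {M' : Type*} [TopologicalSpace M'] [ChartedSpace H' M']
  {E'' : Type*} [NormedAddCommGroup E''] [NormedSpace ℝ E'']
  {H'' : Type*} [TopologicalSpace H''] (I'' : ModelWithCorners ℝ E'' H'')
  {M'' : Type*} [TopologicalSpace M''] [ChartedSpace H'' M'']

/-- The manifold derivative, as a continuous linear map between the model spaces. -/
def tderiv (f : M → M') (x : M) : E →L[ℝ] E' := mfderiv I I' f x

lemma tderiv_comp {g : M' → M''} {f : M → M'} (x : M) (hg : MDifferentiableAt I' I'' g (f x))
    (hf : MDifferentiableAt I I' f x) :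
    tderiv I I'' (fun y => g (f y)) x = (tderiv I' I'' g (f x)).comp (tderiv I I' f x) :=
  mfderiv_comp x hg hf

lemma tderiv_id (x : M) : tderiv I I (fun y : M => y) x = ContinuousLinearMap.id ℝ E :=
  mfderiv_id

lemma tderiv_const (c : M') (x : M) : tderiv I I' (fun _ : M => c) x = 0 :=
  mfderiv_const

variable {I I'} in
lemma Filter.EventuallyEq.tderiv_eq {f g : M → M'} {x : M} (h : f =ᶠ[𝓝 x] g) :
    tderiv I I' f x = tderiv I I' g x := h.mfderiv_eq

lemma tderiv_eq_fderiv (f : E → E') (x : E) : tderiv 𝓘(ℝ, E) 𝓘(ℝ, E') f x = fderiv ℝ f x :=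
  mfderiv_eq_fderiv

variable {I I'} in
lemma ContMDiffAt.mdiff {f : M → M'} {x : M} (h : ContMDiffAt I I' ∞ f x) :
    MDifferentiableAt I I' f x := h.mdifferentiableAt (by simp)

variable {I I'} in
lemma ContMDiff.mdiff {f : M → M'} (h : ContMDiff I I' ∞ f) (x : M) :
    MDifferentiableAt I I' f x := h.mdifferentiable (by simp) x

variable [IsManifold I ∞ M]

lemma contMDiffAt_extChartAt_of_mem {x₀ x : M} (h : x ∈ (extChartAt I x₀).source) :
    ContMDiffAt I 𝓘(ℝ, E) ∞ (extChartAt I x₀) x :=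
  contMDiffAt_extChartAt' (by rwa [extChartAt_source] at h)

lemma contMDiffAt_extChartAt_symm_of_mem [I.Boundaryless] {x₀ : M} {y : E}
    (h : y ∈ (extChartAt I x₀).target) :
    ContMDiffAt 𝓘(ℝ, E) I ∞ (extChartAt I x₀).symm y :=
  (contMDiffOn_extChartAt_symm x₀).contMDiffAt ((isOpen_extChartAt_target x₀).mem_nhds h)

lemma tderiv_extChartAt_symm_comp [I.Boundaryless] {x₀ x : M}
    (h : x ∈ (extChartAt I x₀).source) :
    (tderiv 𝓘(ℝ, E) I (extChartAt I x₀).symm (extChartAt I x₀ x)).comp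
      (tderiv I 𝓘(ℝ, E) (extChartAt I x₀) x) = ContinuousLinearMap.id ℝ E := by
  rw [← tderiv_comp I 𝓘(ℝ, E) I x
    (contMDiffAt_extChartAt_symm_of_mem I ((extChartAt I x₀).map_source h)).mdiff
    (contMDiffAt_extChartAt_of_mem I h).mdiff, ← tderiv_id I x]
  refine Filter.EventuallyEq.tderiv_eq ?_
  filter_upwards [(isOpen_extChartAt_source (I := I) x₀).mem_nhds h] with z hz
  exact (extChartAt I x₀).left_inv hz

/-- The tangent space at `x` is identified with `E` through the preferred chart at `x`, so this
chart has trivial derivative there. -/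
lemma tderiv_extChartAt_self (x : M) :
    tderiv I 𝓘(ℝ, E) (extChartAt I x) x = ContinuousLinearMap.id ℝ E := by
  have : IsManifold I 1 M := .of_le (n := ∞) (by simp)
  have h1 := (hasMFDerivAt_extChartAt (I := I) (mem_chart_source H x)).mfderiv
  have h2 := mfderiv_chartAt_eq_tangentCoordChange (I := I) (mem_chart_source H x)
  ext v
  exact (congrArg (fun g : E →L[ℝ] E => g v) (h1.trans h2)).trans
    (tangentCoordChange_self (mem_extChartAt_source x))

lemma tderiv_extChartAt_symm_self [I.Boundaryless] (x : M) :
    tderiv 𝓘(ℝ, E) I (extChartAt I x).symm (extChartAt I x x) = ContinuousLinearMap.id ℝ E := by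
  have h := tderiv_extChartAt_symm_comp I (mem_extChartAt_source (I := I) x)
  rwa [tderiv_extChartAt_self I x] at h

end ModelDerivative

/-! ### Calculus of differential forms on manifolds without boundary -/

section FormCalculus

variable {E : Type*} [NormedAddCommGroup E] [NormedSpace ℝ E]
  {H : Type*} [TopologicalSpace H] (I : ModelWithCorners ℝ E H)
  {M : Type*} [TopologicalSpace M] [ChartedSpace H M]
  {E' : Type*} [NormedAddCommGroup E'] [NormedSpace ℝ E']
  {H' : Type*} [TopologicalSpace H'] (I' : ModelWithCorners ℝ E' H')
  {M' : Type*} [TopologicalSpace M'] [ChartedSpace H' M']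

/-- The value of a form at a point, as an alternating map on the model space. -/
def DiffForm.val {k : ℕ} (Ω : DiffForm I M k) (x : M) : E [⋀^Fin k]→L[ℝ] ℝ := Ω x

lemma DiffForm.val_pullback {k : ℕ} (f : M → M') (Ω : DiffForm I' M' k) (x : M) :
    DiffForm.val I (DiffForm.pullback I I' f Ω) x
      = (DiffForm.val I' Ω (f x)).compContinuousLinearMap (tderiv I I' f x) := rfl

lemma DiffForm.pullback_id {k : ℕ} (Ω : DiffForm I M k) :
    DiffForm.pullback I I (fun x : M => x) Ω = Ω := by
  funext x
  change DiffForm.val I (DiffForm.pullback I I (fun x : M => x) Ω) x = DiffForm.val I Ω x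
  rw [DiffForm.val_pullback, tderiv_id]
  rfl

variable [I.Boundaryless] [I'.Boundaryless]

lemma DiffForm.inChart_apply {k : ℕ} (Ω : DiffForm I M k) (x₀ : M) (y : E) :
    Ω.inChart I x₀ y = (DiffForm.val I Ω ((extChartAt I x₀).symm y)).compContinuousLinearMap
      (tderiv 𝓘(ℝ, E) I (extChartAt I x₀).symm y) := by
  unfold DiffForm.inChart tderiv
  rw [I.range_eq_univ, mfderivWithin_univ]
  rfl

lemma DiffForm.val_d {k : ℕ} (Ω : DiffForm I M k) (x : M) :
    DiffForm.val I (DiffForm.d I Ω) x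
      = (extDeriv (Ω.inChart I x) (extChartAt I x x)).compContinuousLinearMap
        (tderiv I 𝓘(ℝ, E) (extChartAt I x) x) := by
  unfold DiffForm.val DiffForm.d tderiv
  rw [I.range_eq_univ, extDerivWithin_univ]
  rfl

/-- Smoothness of a form at a point. -/
def DiffForm.SmoothAt {k : ℕ} (Ω : DiffForm I M k) (x : M) : Prop :=
  ContDiffAt ℝ ∞ (Ω.inChart I x) (extChartAt I x x)

variable {I} in
lemma DiffForm.inChart_congr {k : ℕ} {Ω Ω' : DiffForm I M k} {x₀ : M} {y : E}
    (hy : y ∈ (extChartAt I x₀).target)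
    (h : ∀ᶠ z in 𝓝 ((extChartAt I x₀).symm y), Ω z = Ω' z) :
    Ω.inChart I x₀ =ᶠ[𝓝 y] Ω'.inChart I x₀ := by
  filter_upwards [(continuousAt_extChartAt_symm'' hy).eventually h] with z hz
  rw [DiffForm.inChart_apply, DiffForm.inChart_apply]
  unfold DiffForm.val
  rw [hz]

variable {I} in
lemma DiffForm.SmoothAt.congr {k : ℕ} {Ω Ω' : DiffForm I M k} {x : M}
    (h : DiffForm.SmoothAt I Ω x) (hΩ : ∀ᶠ z in 𝓝 x, Ω z = Ω' z) : DiffForm.SmoothAt I Ω' x :=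
  ContDiffAt.congr_of_eventuallyEq h (DiffForm.inChart_congr (mem_extChartAt_target x)
    (by rw [extChartAt_to_inv]; exact hΩ)).symm

variable [IsManifold I ∞ M] [IsManifold I' ∞ M']

variable {I I'} in
/-- The chart expression of a pullback is the pullback of the chart expression. -/
lemma DiffForm.inChart_pullback {k : ℕ} {f : M → M'} (Ω : DiffForm I' M' k) {x₀ : M} {y₀ : M'}
    {y : E} (hy : y ∈ (extChartAt I x₀).target)
    (hfy : f ((extChartAt I x₀).symm y) ∈ (extChartAt I' y₀).source)
    (hf : MDifferentiableAt I I' f ((extChartAt I x₀).symm y)) :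
    (DiffForm.pullback I I' f Ω).inChart I x₀ y
      = (Ω.inChart I' y₀ (extChartAt I' y₀ (f ((extChartAt I x₀).symm y)))).compContinuousLinearMap
        (fderiv ℝ (fun z => extChartAt I' y₀ (f ((extChartAt I x₀).symm z))) y) := by
  have hs := (contMDiffAt_extChartAt_symm_of_mem I hy).mdiff
  have hfs : MDifferentiableAt 𝓘(ℝ, E) I' (fun z => f ((extChartAt I x₀).symm z)) y :=
    MDifferentiableAt.comp y hf hs
  rw [DiffForm.inChart_apply, DiffForm.inChart_apply, DiffForm.val_pullback,
    (extChartAt I' y₀).left_inv hfy, ← tderiv_eq_fderiv,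
    tderiv_comp 𝓘(ℝ, E) I' 𝓘(ℝ, E') y (contMDiffAt_extChartAt_of_mem I' hfy).mdiff hfs,
    tderiv_comp 𝓘(ℝ, E) I I' y hf hs]
  ext v
  simp only [ContinuousAlternatingMap.compContinuousLinearMap_apply]
  congr 1
  ext i
  simp only [comp_apply, ContinuousLinearMap.comp_apply]
  exact (congrArg (fun g : E' →L[ℝ] E' => g _)
    (tderiv_extChartAt_symm_comp I' hfy)).symm

variable {I I'} in
lemma contDiffAt_inCharts {f : M → M'} {x₀ : M} {y₀ : M'} {y : E}
    (hy : y ∈ (extChartAt I x₀).target)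
    (hfy : f ((extChartAt I x₀).symm y) ∈ (extChartAt I' y₀).source)
    (hf : ContMDiffAt I I' ∞ f ((extChartAt I x₀).symm y)) :
    ContDiffAt ℝ ∞ (fun z => extChartAt I' y₀ (f ((extChartAt I x₀).symm z))) y :=
  ((contMDiffAt_extChartAt_of_mem I' hfy).comp y
    (hf.comp y (contMDiffAt_extChartAt_symm_of_mem I hy))).contDiffAt

variable {I I'} in
lemma DiffForm.eventually_inChart_pullback {k : ℕ} {f : M → M'} (Ω : DiffForm I' M' k) {x₀ : M}
    {y₀ : M'} {y : E} (hy : y ∈ (extChartAt I x₀).target)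
    (hfy : f ((extChartAt I x₀).symm y) ∈ (extChartAt I' y₀).source)
    (hf : ContMDiffAt I I' ∞ f ((extChartAt I x₀).symm y)) :
    (DiffForm.pullback I I' f Ω).inChart I x₀ =ᶠ[𝓝 y] fun z =>
      (Ω.inChart I' y₀ (extChartAt I' y₀ (f ((extChartAt I x₀).symm z)))).compContinuousLinearMap
        (fderiv ℝ (fun z => extChartAt I' y₀ (f ((extChartAt I x₀).symm z))) z) := by
  have hc := continuousAt_extChartAt_symm'' (I := I) hy
  -- Only finite-order smoothness at a point spreads to a neighbourhood; order `1` is enough here.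
  have h1 : ∀ᶠ z in 𝓝 ((extChartAt I x₀).symm y), MDifferentiableAt I I' f z := by
    have := (contMDiffAt_iff_contMDiffAt_nhds (by simp)).1 (hf.of_le (m := 1) (by simp))
    filter_upwards [this] with z hz using hz.mdifferentiableAt (by simp)
  filter_upwards [(isOpen_extChartAt_target x₀).mem_nhds hy, hc.eventually h1,
    (ContinuousAt.comp' hf.continuousAt hc).eventually
      ((isOpen_extChartAt_source y₀).mem_nhds hfy)] with z hz1 hz2 hz3
  exact DiffForm.inChart_pullback Ω hz1 hz3 hz2

variable [FiniteDimensional ℝ E] [FiniteDimensional ℝ E']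

variable {I I'} in
lemma DiffForm.contDiffAt_inChart_pullback {k : ℕ} {f : M → M'} {Ω : DiffForm I' M' k} {x₀ : M}
    {y : E} (hy : y ∈ (extChartAt I x₀).target)
    (hf : ContMDiffAt I I' ∞ f ((extChartAt I x₀).symm y))
    (hΩ : DiffForm.SmoothAt I' Ω (f ((extChartAt I x₀).symm y))) :
    ContDiffAt ℝ ∞ ((DiffForm.pullback I I' f Ω).inChart I x₀) y := by
  have hfy := mem_extChartAt_source (I := I') (f ((extChartAt I x₀).symm y))
  refine ContDiffAt.congr_of_eventuallyEq ?_
    (DiffForm.eventually_inChart_pullback Ω hy hfy hf)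
  have hF := contDiffAt_inCharts hy hfy hf
  have hΩ' : ContDiffAt ℝ ∞ (Ω.inChart I' (f ((extChartAt I x₀).symm y)))
    ((fun z => extChartAt I' (f ((extChartAt I x₀).symm y)) (f ((extChartAt I x₀).symm z))) y) :=
    hΩ
  have h3 := ContDiffAt.comp y hΩ' hF
  exact ContDiffAt.alternating_comp h3 (hF.fderiv_right (m := ∞) (by simp))

variable {I} in
-- A change of charts is a pullback under the identity map, read in two different charts.
lemma DiffForm.SmoothAt.contDiffAt_inChart {k : ℕ} {Ω : DiffForm I M k} {x₀ : M}
    {y : E} (hy : y ∈ (extChartAt I x₀).target)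
    (hΩ : DiffForm.SmoothAt I Ω ((extChartAt I x₀).symm y)) :
    ContDiffAt ℝ ∞ (Ω.inChart I x₀) y := by
  have := DiffForm.contDiffAt_inChart_pullback (f := fun x : M => x) hy contMDiffAt_id hΩ
  rwa [DiffForm.pullback_id] at this

lemma DiffForm.isSmooth_iff {k : ℕ} {Ω : DiffForm I M k} :
    Ω.IsSmooth I ↔ ∀ x, DiffForm.SmoothAt I Ω x := by
  constructor
  · intro h x
    exact (h x).contDiffAt (extChartAt_target_mem_nhds x)
  · intro h x₀ y hy
    exact ((h _).contDiffAt_inChart hy).contDiffWithinAt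

variable {I I'} in
lemma DiffForm.SmoothAt.pullback {k : ℕ} {f : M → M'} {Ω : DiffForm I' M' k} {x : M}
    (hΩ : DiffForm.SmoothAt I' Ω (f x)) (hf : ContMDiffAt I I' ∞ f x) :
    DiffForm.SmoothAt I (DiffForm.pullback I I' f Ω) x :=
  DiffForm.contDiffAt_inChart_pullback (mem_extChartAt_target x)
    (by rwa [extChartAt_to_inv]) (by rwa [extChartAt_to_inv])

variable {I I'} in
/-- The exterior derivative, computed in an arbitrary pair of charts. -/
lemma DiffForm.extDeriv_inChart_pullback {k : ℕ} {f : M → M'} {Ω : DiffForm I' M' k} {x₀ : M}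
    {y₀ : M'} {y : E} (hy : y ∈ (extChartAt I x₀).target)
    (hfy : f ((extChartAt I x₀).symm y) ∈ (extChartAt I' y₀).source)
    (hf : ContMDiffAt I I' ∞ f ((extChartAt I x₀).symm y))
    (hΩ : DiffForm.SmoothAt I' Ω (f ((extChartAt I x₀).symm y))) :
    extDeriv ((DiffForm.pullback I I' f Ω).inChart I x₀) y
      = (extDeriv (Ω.inChart I' y₀)
          (extChartAt I' y₀ (f ((extChartAt I x₀).symm y)))).compContinuousLinearMap
        (fderiv ℝ (fun z => extChartAt I' y₀ (f ((extChartAt I x₀).symm z))) y) := by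
  rw [(DiffForm.eventually_inChart_pullback Ω hy hfy hf).extDeriv_eq]
  refine extDeriv_pullback (f := fun z => extChartAt I' y₀ (f ((extChartAt I x₀).symm z)))
    (r := ∞) ?_ (contDiffAt_inCharts hy hfy hf) ?_
  · refine ContDiffAt.differentiableAt (n := ∞) ?_ (by simp)
    exact DiffForm.SmoothAt.contDiffAt_inChart ((extChartAt I' y₀).map_source hfy)
      (by rwa [(extChartAt I' y₀).left_inv hfy])
  · rw [minSmoothness_of_isRCLikeNormedField]
    exact ENat.LEInfty.out

variable {I} in
-- The definition of `DiffForm.d` uses a different chart at each point. Pulling back under the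
-- identity shows that one fixed chart serves for all its points, which is needed to differentiate
-- `dΩ` again.
lemma DiffForm.inChart_d {k : ℕ} {Ω : DiffForm I M k} {x₀ : M} {y : E}
    (hy : y ∈ (extChartAt I x₀).target)
    (hΩ : DiffForm.SmoothAt I Ω ((extChartAt I x₀).symm y)) :
    (DiffForm.d I Ω).inChart I x₀ y = extDeriv (Ω.inChart I x₀) y := by
  have hs := mem_extChartAt_source (I := I) ((extChartAt I x₀).symm y)
  have h := DiffForm.extDeriv_inChart_pullback (f := fun x : M => x) hy hs contMDiffAt_id hΩ
  rw [DiffForm.pullback_id] at h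
  rw [h, DiffForm.inChart_apply, DiffForm.val_d, ← tderiv_eq_fderiv,
    tderiv_comp 𝓘(ℝ, E) I 𝓘(ℝ, E) y (contMDiffAt_extChartAt_of_mem I hs).mdiff
      (contMDiffAt_extChartAt_symm_of_mem I hy).mdiff]
  rfl

variable {I I'} in
/-- The exterior derivative commutes with pullbacks. -/
lemma DiffForm.d_pullback {k : ℕ} {f : M → M'} {Ω : DiffForm I' M' k} {x : M}
    (hf : ContMDiffAt I I' ∞ f x) (hΩ : DiffForm.SmoothAt I' Ω (f x)) :
    DiffForm.d I (DiffForm.pullback I I' f Ω) x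
      = DiffForm.pullback I I' f (DiffForm.d I' Ω) x := by
  change DiffForm.val I (DiffForm.d I (DiffForm.pullback I I' f Ω)) x
      = DiffForm.val I (DiffForm.pullback I I' f (DiffForm.d I' Ω)) x
  have hx := extChartAt_to_inv (I := I) x
  have hs := mem_extChartAt_source (I := I') (f x)
  rw [DiffForm.val_d, DiffForm.extDeriv_inChart_pullback (y₀ := f x) (mem_extChartAt_target x)
    (by rwa [hx]) (by rwa [hx]) (by rwa [hx]), DiffForm.val_pullback, DiffForm.val_d, hx,
    ← tderiv_eq_fderiv]
  have h1 : tderiv I 𝓘(ℝ, E') (fun z => extChartAt I' (f x) (f z)) x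
      = (tderiv 𝓘(ℝ, E) 𝓘(ℝ, E')
          (fun z => extChartAt I' (f x) (f ((extChartAt I x).symm z))) (extChartAt I x x)).comp
        (tderiv I 𝓘(ℝ, E) (extChartAt I x) x) := by
    rw [← tderiv_comp I 𝓘(ℝ, E) 𝓘(ℝ, E') x
      (g := fun z => extChartAt I' (f x) (f ((extChartAt I x).symm z)))
      (contDiffAt_inCharts (mem_extChartAt_target x) (by rwa [hx]) (by rwa [hx])).contMDiffAt.mdiff
      contMDiffAt_extChartAt.mdiff]
    refine Filter.EventuallyEq.tderiv_eq ?_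
    filter_upwards [extChartAt_source_mem_nhds (I := I) x] with z hz
    rw [(extChartAt I x).left_inv hz]
  rw [tderiv_comp I I' 𝓘(ℝ, E') x (contMDiffAt_extChartAt_of_mem I' hs).mdiff hf.mdiff] at h1
  ext v
  simp only [ContinuousAlternatingMap.compContinuousLinearMap_apply]
  congr 1
  ext i
  exact (congrArg (fun g : E →L[ℝ] E' => g (v i)) h1).symm

variable {I} in
lemma DiffForm.IsSmooth.d {k : ℕ} {Ω : DiffForm I M k} (hΩ : Ω.IsSmooth I) :
    (DiffForm.d I Ω).IsSmooth I := by
  intro x₀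
  refine ContDiffOn.congr (f := extDeriv (Ω.inChart I x₀)) ?_ fun y hy =>
    DiffForm.inChart_d hy ((DiffForm.isSmooth_iff I).1 hΩ _)
  intro y hy
  refine ContDiffAt.contDiffWithinAt ?_
  have h := ((hΩ x₀).contDiffAt ((isOpen_extChartAt_target x₀).mem_nhds hy)).fderiv_right
    (m := ∞) (by simp)
  exact (ContinuousAlternatingMap.alternatizeUncurryFinCLM ℝ E ℝ).contDiff.contDiffAt.comp y h

variable {I} in
lemma DiffForm.IsSmooth.d_d {k : ℕ} {Ω : DiffForm I M k} (hΩ : Ω.IsSmooth I) (x : M) :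
    DiffForm.d I (DiffForm.d I Ω) x = 0 := by
  change DiffForm.val I (DiffForm.d I (DiffForm.d I Ω)) x = 0
  have h : (DiffForm.d I Ω).inChart I x =ᶠ[𝓝 (extChartAt I x x)]
      extDeriv (Ω.inChart I x) := by
    filter_upwards [extChartAt_target_mem_nhds (I := I) x] with y hy
    exact DiffForm.inChart_d hy ((DiffForm.isSmooth_iff I).1 hΩ _)
  rw [DiffForm.val_d, h.extDeriv_eq, extDeriv_extDeriv_apply (r := ∞)
    ((hΩ x).contDiffAt (extChartAt_target_mem_nhds x))
    (by rw [minSmoothness_of_isRCLikeNormedField]; exact ENat.LEInfty.out)]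
  rfl

end FormCalculus

/-! ### Smooth dependence of derivatives on parameters -/

section ParametricDerivative

variable {E : Type*} [NormedAddCommGroup E] [NormedSpace ℝ E]
  {H : Type*} [TopologicalSpace H] (I : ModelWithCorners ℝ E H)
  {M : Type*} [TopologicalSpace M] [ChartedSpace H M] [IsManifold I ∞ M]
  {E' : Type*} [NormedAddCommGroup E'] [NormedSpace ℝ E']
  {H' : Type*} [TopologicalSpace H'] (I' : ModelWithCorners ℝ E' H')
  {M' : Type*} [TopologicalSpace M'] [ChartedSpace H' M'] [IsManifold I' ∞ M']
  {F : Type*} [NormedAddCommGroup F] [NormedSpace ℝ F]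
  {K : Type*} [TopologicalSpace K] {J : ModelWithCorners ℝ F K}
  {N : Type*} [TopologicalSpace N] [ChartedSpace K N] [IsManifold J ∞ N]

variable {I'} in
/-- The derivatives of a smooth family of maps at points with a common image depend smoothly on
the parameters. -/
lemma contMDiffAt_tderiv_of_eq {f : N → E → M'} {g : N → E} {x₀ : N} {c : M'}
    (hf : ContMDiffAt (J.prod 𝓘(ℝ, E)) I' ∞ (uncurry f) (x₀, g x₀))
    (hg : ContMDiffAt J 𝓘(ℝ, E) ∞ g x₀) (hc : ∀ x, f x (g x) = c) :
    ContMDiffAt J 𝓘(ℝ, E →L[ℝ] E') ∞ (fun x => tderiv 𝓘(ℝ, E) I' (f x) (g x)) x₀ := by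
  have : IsManifold I' 1 M' := .of_le (n := ∞) (by simp)
  have h := ContMDiffAt.mfderiv f g hf hg (m := ∞) (by simp)
  refine h.congr_of_eventuallyEq (Filter.Eventually.of_forall fun x => ?_)
  have hy : f x (g x) ∈ (chartAt H' (f x₀ (g x₀))).source := by
    rw [hc, hc]; exact mem_chart_source _ _
  have hx : g x ∈ (chartAt E (g x₀)).source := by rw [chartAt_self_eq]; exact mem_univ _
  refine Eq.trans ?_ (inTangentCoordinates_eq (I := 𝓘(ℝ, E)) (I' := I') g (fun x => f x (g x))
    (fun x => tderiv 𝓘(ℝ, E) I' (f x) (g x)) hx hy).symm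
  -- `ContMDiffAt.mfderiv` reads the derivatives in tangent coordinates at the image points. These
  -- all equal `c`, so the coordinate change in the target is the identity.
  have h1 : (tangentBundleCore I' M').coordChange (achart H' (f x (g x)))
      (achart H' (f x₀ (g x₀))) (f x (g x)) = ContinuousLinearMap.id ℝ E' := by
    ext v
    rw [hc, hc]
    exact tangentCoordChange_self (mem_extChartAt_source c)
  rw [h1, tangentBundleCore_coordChange_model_space]
  rfl

variable {I I'} in
lemma contMDiffAt_tderiv_const [I.Boundaryless] {f : N → M → M'} {b : M} {x₀ : N} {c : M'}
    (hf : ContMDiffAt (J.prod I) I' ∞ (uncurry f) (x₀, b)) (hc : ∀ x, f x b = c)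
    (hf' : ∀ x, MDifferentiableAt I I' (f x) b) :
    ContMDiffAt J 𝓘(ℝ, E →L[ℝ] E') ∞ (fun x => tderiv I I' (f x) b) x₀ := by
  have hb := extChartAt_to_inv (I := I) b
  have hs := contMDiffAt_extChartAt_symm_of_mem I (mem_extChartAt_target (I := I) b)
  have h : ContMDiffAt J 𝓘(ℝ, E →L[ℝ] E') ∞ (fun x => tderiv 𝓘(ℝ, E) I'
      (fun y => f x ((extChartAt I b).symm y)) (extChartAt I b b)) x₀ := by
    refine contMDiffAt_tderiv_of_eq (c := c) ?_ contMDiffAt_const (by simpa [hb] using hc)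
    have h1 : ContMDiffAt (J.prod 𝓘(ℝ, E)) (J.prod I) ∞
        (fun p : N × E => (p.1, (extChartAt I b).symm p.2)) (x₀, extChartAt I b b) :=
      contMDiffAt_fst.prodMk (ContMDiffAt.comp (x₀, extChartAt I b b) hs contMDiffAt_snd)
    refine ContMDiffAt.comp (x₀, extChartAt I b b) (g := uncurry f) ?_ h1
    simpa [hb] using hf
  refine h.congr_of_eventuallyEq (Filter.Eventually.of_forall fun x => ?_)
  change _ = tderiv 𝓘(ℝ, E) I' (fun y => f x ((extChartAt I b).symm y)) (extChartAt I b b)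
  rw [tderiv_comp 𝓘(ℝ, E) I I' _ (by rw [hb]; exact hf' x) hs.mdiff,
    tderiv_extChartAt_symm_self, hb]
  rfl

end ParametricDerivative

/-! ### The adjoint action, the Maurer–Cartan form and the bracket of a Lie group -/

section LieGroupCalculus

variable {E : Type*} [NormedAddCommGroup E] [NormedSpace ℝ E]
  {H : Type*} [TopologicalSpace H] (I : ModelWithCorners ℝ E H)
  {G : Type*} [TopologicalSpace G] [ChartedSpace H G] [Group G] [LieGroup I ∞ G]

/-- The adjoint action on the model space. -/
def adE (g : G) : E →L[ℝ] E := lieAd I g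

/-- The left trivialisation on the model space. -/
def mcE (g : G) : E →L[ℝ] E := maurerCartan I g

lemma contMDiff_conj (g : G) : ContMDiff I I ∞ (fun h : G => g * h * g⁻¹) :=
  (contMDiff_mul_left (I := I) (n := ∞) (a := g)).mul contMDiff_const

lemma mcE_eq (g : G) : mcE I g = tderiv I I (fun h : G => g⁻¹ * h) g := rfl

lemma adE_one : adE I (1 : G) = ContinuousLinearMap.id ℝ E := lieAd_one I

lemma adE_mul (g h : G) : adE I (g * h) = (adE I g).comp (adE I h) := lieAd_mul I g h

lemma adE_inv_adE (g : G) (v : E) : adE I g⁻¹ (adE I g v) = v := by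
  rw [← ContinuousLinearMap.comp_apply, ← adE_mul, inv_mul_cancel, adE_one]; rfl

lemma adE_adE_inv (g : G) (v : E) : adE I g (adE I g⁻¹ v) = v := by
  rw [← ContinuousLinearMap.comp_apply, ← adE_mul, mul_inv_cancel, adE_one]; rfl

lemma tderiv_mul_left_comp (a b g : G) :
    tderiv I I (fun h : G => (a * b) * h) g
      = (tderiv I I (fun h : G => a * h) (b * g)).comp (tderiv I I (fun h : G => b * h) g) := by
  rw [← tderiv_comp I I I (g := fun h : G => a * h) g
    ((contMDiff_mul_left (I := I) (n := ∞)).mdiff _)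
    ((contMDiff_mul_left (I := I) (n := ∞)).mdiff _)]
  simp only [mul_assoc]

/-- Left invariance of the Maurer–Cartan form, from `(a g)⁻¹ (a h) = g⁻¹ h`. -/
lemma mcE_mul_comp (a g : G) :
    (mcE I (a * g)).comp (tderiv I I (fun h : G => a * h) g) = mcE I g := by
  rw [mcE_eq, ← tderiv_mul_left_comp, mcE_eq]
  simp

lemma mcE_comp_tderiv_one (g : G) :
    (mcE I g).comp (tderiv I I (fun h : G => g * h) 1) = ContinuousLinearMap.id ℝ E := by
  have h := mcE_mul_comp I g 1
  rw [mul_one] at h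
  rw [h, mcE_eq]
  simp only [inv_one, one_mul]
  exact tderiv_id I 1

lemma tderiv_comp_mcE (g : G) :
    (tderiv I I (fun h : G => g * h) 1).comp (mcE I g) = ContinuousLinearMap.id ℝ E := by
  have h := tderiv_mul_left_comp I g g⁻¹ g
  rw [mul_inv_cancel, inv_mul_cancel] at h
  rw [mcE_eq, ← h]
  simp only [one_mul]
  exact tderiv_id I g

variable [I.Boundaryless]

/-- All conjugations fix the identity, so their derivatives there form a smooth family of
endomorphisms of one space. -/
lemma contMDiff_adE : ContMDiff I 𝓘(ℝ, E →L[ℝ] E) ∞ (fun g : G => adE I g) := by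
  intro g
  refine contMDiffAt_tderiv_const (f := fun g h : G => g * h * g⁻¹) (c := 1) ?_ (by simp)
    fun x => (contMDiff_conj I x).mdiff _
  have : ContMDiff (I.prod I) I ∞ (fun p : G × G => p.1 * p.2 * p.1⁻¹) :=
    (contMDiff_fst.mul contMDiff_snd).mul contMDiff_fst.inv
  exact this.contMDiffAt

/-- The coadjoint orbit map `g ↦ Ad^*_g ν`. -/
def orbE (ν : E →L[ℝ] ℝ) (g : G) : E →L[ℝ] ℝ := ν.comp (adE I g⁻¹)

lemma contMDiff_orbE (ν : E →L[ℝ] ℝ) :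
    ContMDiff I 𝓘(ℝ, E →L[ℝ] ℝ) ∞ (fun g : G => orbE I ν g) := by
  have h1 : ContMDiff I 𝓘(ℝ, E →L[ℝ] E) ∞ (fun g : G => adE I g⁻¹) :=
    (contMDiff_adE I).comp (contMDiff_inv I ∞)
  exact (ContinuousLinearMap.compL ℝ E E ℝ ν).contDiff.contMDiff.comp h1

/-! #### The group law in the chart at the identity -/

variable (G) in
/-- The group law, read in the preferred chart at the identity. -/
def mulChart (p : E × E) : E :=
  extChartAt I (1 : G) ((extChartAt I (1 : G)).symm p.1 * (extChartAt I (1 : G)).symm p.2)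

variable (G) in
/-- The coordinates of the identity in its preferred chart. -/
def oneChart : E := extChartAt I (1 : G) 1

lemma oneChart_mem : oneChart I G ∈ (extChartAt I (1 : G)).target := mem_extChartAt_target _

lemma symm_oneChart : (extChartAt I (1 : G)).symm (oneChart I G) = 1 := extChartAt_to_inv _

lemma target_mem_nhds_oneChart : (extChartAt I (1 : G)).target ∈ 𝓝 (oneChart I G) :=
  extChartAt_target_mem_nhds _

lemma contDiffAt_mulChart {y z : E} (hy : y ∈ (extChartAt I (1 : G)).target)
    (hz : z ∈ (extChartAt I (1 : G)).target)
    (hyz : (extChartAt I (1 : G)).symm y * (extChartAt I (1 : G)).symm z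
      ∈ (extChartAt I (1 : G)).source) :
    ContDiffAt ℝ ∞ (mulChart I G) (y, z) := by
  rw [← contMDiffAt_iff_contDiffAt]
  have h1 := ContMDiffAt.comp (y, z) (contMDiffAt_extChartAt_symm_of_mem I hy)
    (contDiff_fst (E := E) (F := E)).contMDiff.contMDiffAt
  have h2 := ContMDiffAt.comp (y, z) (contMDiffAt_extChartAt_symm_of_mem I hz)
    (contDiff_snd (E := E) (F := E)).contMDiff.contMDiffAt
  exact ContMDiffAt.comp (y, z) (contMDiffAt_extChartAt_of_mem I hyz) (h1.mul h2)

lemma contDiffAt_mulChart_left {y : E} (hy : y ∈ (extChartAt I (1 : G)).target) :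
    ContDiffAt ℝ ∞ (mulChart I G) (y, oneChart I G) :=
  contDiffAt_mulChart I hy (oneChart_mem I)
    (by rw [symm_oneChart, mul_one]; exact (extChartAt I (1 : G)).map_target hy)

lemma contDiffAt_mulChart_right {y : E} (hy : y ∈ (extChartAt I (1 : G)).target) :
    ContDiffAt ℝ ∞ (mulChart I G) (oneChart I G, y) :=
  contDiffAt_mulChart I (oneChart_mem I) hy
    (by rw [symm_oneChart, one_mul]; exact (extChartAt I (1 : G)).map_target hy)

/-- This exhibits the left-invariant fields as partial derivatives of the group law, so that their
derivatives at the identity are second derivatives of it. -/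
lemma fderiv_mulChart_left {y : E} (hy : y ∈ (extChartAt I (1 : G)).target) (ζ : E) :
    fderiv ℝ (mulChart I G) (y, oneChart I G) (0, ζ)
      = tderiv I 𝓘(ℝ, E) (extChartAt I (1 : G)) ((extChartAt I (1 : G)).symm y)
        (tderiv I I (fun h : G => (extChartAt I (1 : G)).symm y * h) 1 ζ) := by
  set g := (extChartAt I (1 : G)).symm y with hg
  have hgs : g ∈ (extChartAt I (1 : G)).source := (extChartAt I (1 : G)).map_target hy
  have h1 : fderiv ℝ (fun z => mulChart I G (y, z)) (oneChart I G) ζ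
      = fderiv ℝ (mulChart I G) (y, oneChart I G) (0, ζ) := by
    have h0 := HasFDerivAt.comp (f := fun z : E => (y, z)) (oneChart I G)
      ((contDiffAt_mulChart_left I hy).differentiableAt (by simp)).hasFDerivAt
      (hasFDerivAt_prodMk_right y (oneChart I G))
    exact congrArg (fun g : E →L[ℝ] E => g ζ) h0.fderiv
  have hL : ∀ h, MDifferentiableAt I I (fun h : G => g * h) h :=
    (contMDiff_mul_left (I := I) (n := ∞)).mdiff
  have hs := (contMDiffAt_extChartAt_symm_of_mem I (oneChart_mem (G := G) I)).mdiff
  have h2 : MDifferentiableAt 𝓘(ℝ, E) I (fun z => g * (extChartAt I (1 : G)).symm z)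
      (oneChart I G) := MDifferentiableAt.comp _ (hL _) hs
  rw [← h1, ← tderiv_eq_fderiv]
  have h3 : tderiv 𝓘(ℝ, E) 𝓘(ℝ, E) (fun z => mulChart I G (y, z)) (oneChart I G)
      = tderiv 𝓘(ℝ, E) 𝓘(ℝ, E)
        (fun z => extChartAt I (1 : G) (g * (extChartAt I (1 : G)).symm z)) (oneChart I G) := rfl
  rw [h3, tderiv_comp 𝓘(ℝ, E) I 𝓘(ℝ, E) _ (by
      rw [symm_oneChart, mul_one]; exact (contMDiffAt_extChartAt_of_mem I hgs).mdiff) h2,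
    tderiv_comp 𝓘(ℝ, E) I I _ (hL _) hs, symm_oneChart, mul_one, oneChart,
    tderiv_extChartAt_symm_self]
  rfl

lemma fderiv_mulChart_right {y : E} (hy : y ∈ (extChartAt I (1 : G)).target) (ζ : E) :
    fderiv ℝ (mulChart I G) (oneChart I G, y) (ζ, 0)
      = tderiv I 𝓘(ℝ, E) (extChartAt I (1 : G)) ((extChartAt I (1 : G)).symm y)
        (tderiv I I (fun h : G => h * (extChartAt I (1 : G)).symm y) 1 ζ) := by
  set g := (extChartAt I (1 : G)).symm y with hg
  have hgs : g ∈ (extChartAt I (1 : G)).source := (extChartAt I (1 : G)).map_target hy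
  have h1 : fderiv ℝ (fun z => mulChart I G (z, y)) (oneChart I G) ζ
      = fderiv ℝ (mulChart I G) (oneChart I G, y) (ζ, 0) := by
    have h0 := HasFDerivAt.comp (f := fun z : E => (z, y)) (oneChart I G)
      ((contDiffAt_mulChart_right I hy).differentiableAt (by simp)).hasFDerivAt
      (hasFDerivAt_prodMk_left (oneChart I G) y)
    exact congrArg (fun g : E →L[ℝ] E => g ζ) h0.fderiv
  have hR : ∀ h, MDifferentiableAt I I (fun h : G => h * g) h :=
    (contMDiff_mul_right (I := I) (n := ∞)).mdiff
  have hs := (contMDiffAt_extChartAt_symm_of_mem I (oneChart_mem (G := G) I)).mdiff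
  have h2 : MDifferentiableAt 𝓘(ℝ, E) I (fun z => (extChartAt I (1 : G)).symm z * g)
      (oneChart I G) := MDifferentiableAt.comp (g := fun h : G => h * g) _ (hR _) hs
  rw [← h1, ← tderiv_eq_fderiv]
  have h3 : tderiv 𝓘(ℝ, E) 𝓘(ℝ, E) (fun z => mulChart I G (z, y)) (oneChart I G)
      = tderiv 𝓘(ℝ, E) 𝓘(ℝ, E)
        (fun z => extChartAt I (1 : G) ((extChartAt I (1 : G)).symm z * g)) (oneChart I G) := rfl
  rw [h3, tderiv_comp 𝓘(ℝ, E) I 𝓘(ℝ, E) _ (by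
      rw [symm_oneChart, one_mul]; exact (contMDiffAt_extChartAt_of_mem I hgs).mdiff) h2,
    tderiv_comp 𝓘(ℝ, E) I I (g := fun h : G => h * g) _ (hR _) hs, symm_oneChart, one_mul, oneChart,
    tderiv_extChartAt_symm_self]
  rfl

/-- `D₂m(y, e) ζ = D₁m(e, y) (Ad_y ζ)`, because `g h = (g h g⁻¹) g`. -/
lemma fderiv_mulChart_left_eq_right {y : E} (hy : y ∈ (extChartAt I (1 : G)).target) (ζ : E) :
    fderiv ℝ (mulChart I G) (y, oneChart I G) (0, ζ)
      = fderiv ℝ (mulChart I G) (oneChart I G, y)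
        (adE I ((extChartAt I (1 : G)).symm y) ζ, 0) := by
  rw [fderiv_mulChart_left I hy, fderiv_mulChart_right I hy]
  set g := (extChartAt I (1 : G)).symm y
  congr 1
  have h := tderiv_comp I I I (g := fun h : G => h * g) (f := fun h : G => g * h * g⁻¹) 1
    ((contMDiff_mul_right (I := I) (n := ∞)).mdiff _) ((contMDiff_conj I g).mdiff _)
  simp only [inv_mul_cancel_right, mul_one, mul_inv_cancel] at h
  rw [h]
  rfl

variable (G) in
/-- The mixed second derivative of the group law at the identity, in the chart at the identity. -/
def mulHess (ξ ζ : E) : E :=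
  fderiv ℝ (fderiv ℝ (mulChart I G)) (oneChart I G, oneChart I G) (ξ, 0) (0, ζ)

lemma hasFDerivAt_fderiv_mulChart :
    HasFDerivAt (fderiv ℝ (mulChart I G))
      (fderiv ℝ (fderiv ℝ (mulChart I G)) (oneChart I G, oneChart I G))
      (oneChart I G, oneChart I G) :=
  (((contDiffAt_mulChart_left I (oneChart_mem I)).fderiv_right (m := ∞) (by simp)).differentiableAt
    (by simp)).hasFDerivAt

/-- The left invariant vector fields in the chart at the identity, and their derivatives. -/
lemma hasFDerivAt_leftField (ζ : E) :
    HasFDerivAt (fun y => fderiv ℝ (mulChart I G) (y, oneChart I G) (0, ζ))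
      (((fderiv ℝ (fderiv ℝ (mulChart I G)) (oneChart I G, oneChart I G)).comp
        (ContinuousLinearMap.inl ℝ E E)).flip (0, ζ)) (oneChart I G) := by
  have h := HasFDerivAt.comp (f := fun y : E => (y, oneChart I G)) (oneChart I G)
    (hasFDerivAt_fderiv_mulChart I) (hasFDerivAt_prodMk_left (oneChart I G) (oneChart I G))
  convert! h.clm_apply (hasFDerivAt_const ((0, ζ) : E × E) (oneChart I G)) using 1
  ext v
  simp

lemma fderiv_leftField (ξ ζ : E) :
    fderiv ℝ (fun y => fderiv ℝ (mulChart I G) (y, oneChart I G) (0, ζ)) (oneChart I G) ξ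
      = mulHess I G ξ ζ := by
  rw [(hasFDerivAt_leftField I ζ).fderiv]
  rfl

lemma leftField_one (ζ : E) :
    fderiv ℝ (mulChart I G) (oneChart I G, oneChart I G) (0, ζ) = ζ := by
  rw [fderiv_mulChart_left I (oneChart_mem I), symm_oneChart]
  simp only [one_mul]
  rw [tderiv_id, tderiv_extChartAt_self]
  rfl

lemma rightField_one (ζ : E) :
    fderiv ℝ (mulChart I G) (oneChart I G, oneChart I G) (ζ, 0) = ζ := by
  rw [fderiv_mulChart_right I (oneChart_mem I), symm_oneChart]
  simp only [mul_one]
  rw [tderiv_id, tderiv_extChartAt_self]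
  rfl

variable [FiniteDimensional ℝ E]

variable (G) in
/-- The Lie bracket of `𝔤`, on the model space. -/
def lieE (ξ ζ : E) : E :=
  Bracket.bracket (L := GroupLieAlgebra I G) (M := GroupLieAlgebra I G) ξ ζ

variable (G) in
/-- The left invariant vector fields in the chart at the identity. -/
def leftFieldChart (ζ y : E) : E :=
  VectorField.mpullbackWithin 𝓘(ℝ, E) I (extChartAt I (1 : G)).symm
    (mulInvariantVectorField (ζ : GroupLieAlgebra I G)) (range I) y

/-- The bracket of `𝔤` is defined through these pulled-back fields; near the identity they become
explicit. -/
lemma leftFieldChart_eq {y : E} (hy : y ∈ (extChartAt I (1 : G)).target) (ζ : E) :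
    leftFieldChart I G ζ y = fderiv ℝ (mulChart I G) (y, oneChart I G) (0, ζ) := by
  have h1 := isInvertible_mfderivWithin_extChartAt_symm (I := I) hy
  have h2 : (tderiv 𝓘(ℝ, E) I (extChartAt I (1 : G)).symm y)
      (fderiv ℝ (mulChart I G) (y, oneChart I G) (0, ζ))
      = tderiv I I (fun h : G => (extChartAt I (1 : G)).symm y * h) 1 ζ := by
    rw [fderiv_mulChart_left I hy]
    have h3 := tderiv_extChartAt_symm_comp I ((extChartAt I (1 : G)).map_target hy)
    rw [(extChartAt I (1 : G)).right_inv hy] at h3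
    exact congrArg (fun g : E →L[ℝ] E => g _) h3
  have h4 : (mfderivWithin 𝓘(ℝ, E) I (extChartAt I (1 : G)).symm (range I) y)
      (fderiv ℝ (mulChart I G) (y, oneChart I G) (0, ζ))
      = mulInvariantVectorField (ζ : GroupLieAlgebra I G) ((extChartAt I (1 : G)).symm y) := by
    rw [I.range_eq_univ, mfderivWithin_univ]
    exact h2
  rw [leftFieldChart, VectorField.mpullbackWithin_apply, ← h4]
  exact h1.inverse_apply_eq.2 rfl

/-- The Lie bracket in terms of the second derivative of the group law. -/
lemma lieE_eq_mulHess (ξ ζ : E) :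
    lieE I G ξ ζ = mulHess I G ξ ζ - mulHess I G ζ ξ := by
  have h1 : ∀ ζ : E, leftFieldChart I G ζ =ᶠ[𝓝 (oneChart I G)]
      fun y => fderiv ℝ (mulChart I G) (y, oneChart I G) (0, ζ) := fun ζ => by
    filter_upwards [target_mem_nhds_oneChart I] with y hy
    exact leftFieldChart_eq I hy ζ
  have h2 : VectorField.lieBracketWithin ℝ (leftFieldChart I G ξ) (leftFieldChart I G ζ)
      ((extChartAt I (1 : G)).symm ⁻¹' univ ∩ range I) (oneChart I G)
      = mulHess I G ξ ζ - mulHess I G ζ ξ := by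
    rw [I.range_eq_univ, preimage_univ, inter_univ, VectorField.lieBracketWithin_univ,
      (h1 ξ).lieBracket_vectorField_eq (h1 ζ), VectorField.lieBracket_eq]
    change fderiv ℝ _ _ (fderiv ℝ _ _ _) - fderiv ℝ _ _ (fderiv ℝ _ _ _) = _
    rw [leftField_one, leftField_one, fderiv_leftField, fderiv_leftField]
  -- This unfolds the manifold bracket of left-invariant fields at the identity into the bracket in
  -- the chart.
  have h3 : lieE I G ξ ζ = (tderiv I 𝓘(ℝ, E) (extChartAt I (1 : G)) 1).inverse
      (VectorField.lieBracketWithin ℝ (leftFieldChart I G ξ) (leftFieldChart I G ζ)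
      ((extChartAt I (1 : G)).symm ⁻¹' univ ∩ range I) (oneChart I G)) := rfl
  rw [h3, tderiv_extChartAt_self, h2, ContinuousLinearMap.inverse_id]
  rfl

/-- The derivative of the adjoint action at the identity is the bracket. -/
lemma tderiv_adE_one (ξ ζ : E) :
    tderiv I 𝓘(ℝ, E →L[ℝ] E) (fun g : G => adE I g) 1 ξ ζ = lieE I G ξ ζ := by
  have hs := contMDiffAt_extChartAt_symm_of_mem I (oneChart_mem (G := G) I)
  set D : E →L[ℝ] (E →L[ℝ] E) := tderiv I 𝓘(ℝ, E →L[ℝ] E) (fun g : G => adE I g) 1 with hD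
  have h1 : HasFDerivAt (fun y => adE I ((extChartAt I (1 : G)).symm y)) D (oneChart I G) := by
    have hc : ContDiffAt ℝ ∞ (fun y => adE I ((extChartAt I (1 : G)).symm y)) (oneChart I G) :=
      ((contMDiff_adE I).contMDiffAt.comp _ hs).contDiffAt
    have h2 := (hc.differentiableAt (by simp)).hasFDerivAt
    convert! h2 using 1
    rw [← tderiv_eq_fderiv, tderiv_comp 𝓘(ℝ, E) I 𝓘(ℝ, E →L[ℝ] E) (oneChart I G)
      (g := fun g : G => adE I g) ((contMDiff_adE I).mdiff _) hs.mdiff, symm_oneChart, oneChart,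
      tderiv_extChartAt_symm_self]
    rfl
  have h2 : HasFDerivAt (fun y => (adE I ((extChartAt I (1 : G)).symm y) ζ : E)) (D.flip ζ)
      (oneChart I G) := by
    convert! h1.clm_apply (hasFDerivAt_const ζ (oneChart I G)) using 1
    ext v
    simp
  -- The identity `D₂m(y, e) ζ = D₁m(e, y) (Ad_y ζ)` is differentiated in `y` at `e`. The right side
  -- contributes `D ξ ζ`, from `Ad_y`, and a second derivative of `m`.
  have h3 := HasFDerivAt.comp (f := fun y : E => (oneChart I G, y)) (oneChart I G)
    (hasFDerivAt_fderiv_mulChart I) (hasFDerivAt_prodMk_right (oneChart I G) (oneChart I G))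
  have h4 := h3.clm_apply (h2.prodMk (hasFDerivAt_const (0 : E) (oneChart I G)))
  have h5 : (fun y => fderiv ℝ (mulChart I G) (y, oneChart I G) (0, ζ)) =ᶠ[𝓝 (oneChart I G)]
      fun y => fderiv ℝ (mulChart I G) (oneChart I G, y)
        (adE I ((extChartAt I (1 : G)).symm y) ζ, 0) := by
    filter_upwards [target_mem_nhds_oneChart I] with y hy
    exact fderiv_mulChart_left_eq_right I hy ζ
  have h6 := congrArg (fun g : E →L[ℝ] E => g ξ)
    ((hasFDerivAt_leftField I ζ).congr_of_eventuallyEq h5.symm |>.unique h4)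
  -- Symmetry of the second derivative turns that last term into `mulHess I G ζ ξ`.
  have hsymm : IsSymmSndFDerivAt ℝ (mulChart I G) (oneChart I G, oneChart I G) :=
    (contDiffAt_mulChart_left I (oneChart_mem I)).isSymmSndFDerivAt
      (by rw [minSmoothness_of_isRCLikeNormedField]; exact ENat.LEInfty.out)
  have h7 : mulHess I G ξ ζ = D ξ ζ + mulHess I G ζ ξ := by
    have h8 : mulHess I G ξ ζ = fderiv ℝ (mulChart I G) (oneChart I G, oneChart I G) (D ξ ζ, 0)
      + fderiv ℝ (fderiv ℝ (mulChart I G)) (oneChart I G, oneChart I G) (0, ξ)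
        (adE I ((extChartAt I (1 : G)).symm (oneChart I G)) ζ, 0) := h6
    rw [rightField_one, symm_oneChart, adE_one, hsymm.eq] at h8
    exact h8
  rw [lieE_eq_mulHess, h7, add_sub_cancel_right]

end LieGroupCalculus

section InvariantForms

variable {E : Type*} [NormedAddCommGroup E] [NormedSpace ℝ E]
  {H : Type*} [TopologicalSpace H] (I : ModelWithCorners ℝ E H)
  {G : Type*} [TopologicalSpace G] [ChartedSpace H G] [Group G] [LieGroup I ∞ G]
  [I.Boundaryless] [FiniteDimensional ℝ E]

/-! ### Derivatives of the adjoint and coadjoint actions -/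

/-- The adjoint action is by Lie algebra automorphisms. -/
lemma adE_lieE (g : G) (ξ ζ : E) :
    adE I g (lieE I G ξ ζ) = lieE I G (adE I g ξ) (adE I g ζ) := by
  have hA := contMDiff_adE (G := G) I
  have h1 := tderiv_comp I I 𝓘(ℝ, E →L[ℝ] E) (g := fun h : G => adE I h)
    (f := fun h : G => g * h * g⁻¹) 1 (hA.mdiff _) ((contMDiff_conj I g).mdiff _)
  simp only [mul_one, mul_inv_cancel] at h1
  -- `T B = Ad_g ∘ B ∘ Ad_{g⁻¹}`. Differentiating `Ad_{g h g⁻¹} = T (Ad_h)` at `h = 1` gives the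
  -- claim, because the derivative of `Ad` is the bracket.
  let T : (E →L[ℝ] E) →L[ℝ] (E →L[ℝ] E) :=
    (ContinuousLinearMap.compL ℝ E E E (adE I g)).comp
      ((ContinuousLinearMap.compL ℝ E E E).flip (adE I g⁻¹))
  have h2 := tderiv_comp I 𝓘(ℝ, E →L[ℝ] E) 𝓘(ℝ, E →L[ℝ] E) (g := fun B => T B)
    (f := fun h : G => adE I h) 1
    (T.contDiff.contMDiff.mdiff _) (hA.mdiff _)
  have h3 : (fun h : G => adE I (g * h * g⁻¹)) = fun h : G => T (adE I h) := by
    funext h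
    rw [adE_mul, adE_mul]
    rfl
  rw [h3, h2, tderiv_eq_fderiv, T.fderiv] at h1
  have h4 := congrArg (fun L : E →L[ℝ] (E →L[ℝ] E) => L ξ (adE I g ζ)) h1
  have h5 : adE I g (tderiv I 𝓘(ℝ, E →L[ℝ] E) (fun h : G => adE I h) 1 ξ
      (adE I g⁻¹ (adE I g ζ)))
      = tderiv I 𝓘(ℝ, E →L[ℝ] E) (fun h : G => adE I h) 1 (adE I g ξ) (adE I g ζ) := h4
  rwa [adE_inv_adE, tderiv_adE_one, tderiv_adE_one] at h5

/-- The infinitesimal coadjoint action on the model space. -/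
def coadE (ξ : E) (μ : E →L[ℝ] ℝ) : E →L[ℝ] ℝ :=
  coadInf I (G := G) (ξ : GroupLieAlgebra I G) (μ : GroupLieAlgebra I G →L[ℝ] ℝ)

lemma coadE_apply (ξ ζ : E) (μ : E →L[ℝ] ℝ) :
    coadE I (G := G) ξ μ ζ = - μ (lieE I G ξ ζ) := rfl

variable (G) in
/-- The infinitesimal coadjoint action on `μ`, as a linear map. -/
def coadL (μ : E →L[ℝ] ℝ) : E →ₗ[ℝ] (E →L[ℝ] ℝ) where
  toFun ξ := coadE I (G := G) ξ μ
  map_add' ξ ζ := by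
    ext w
    simp only [coadE_apply, add_apply]
    have : lieE I G (ξ + ζ) w = lieE I G ξ w + lieE I G ζ w :=
      add_lie (L := GroupLieAlgebra I G) (M := GroupLieAlgebra I G) ξ ζ w
    rw [this, map_add, neg_add]
  map_smul' c ξ := by
    ext w
    simp only [coadE_apply, smul_apply, RingHom.id_apply]
    have : lieE I G (c • ξ) w = c • lieE I G ξ w :=
      smul_lie (L := GroupLieAlgebra I G) (M := GroupLieAlgebra I G) c ξ w
    rw [this, map_smul, smul_neg]

lemma coadL_apply (μ : E →L[ℝ] ℝ) (ξ : E) : coadL I G μ ξ = coadE I (G := G) ξ μ := rfl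

lemma mem_isotropyAlgebra_iff (ν : E →L[ℝ] ℝ) (ξ : GroupLieAlgebra I G) :
    ξ ∈ isotropyAlgebra I (G := G) ν ↔ coadL I G ν ξ = 0 := by
  constructor
  · intro h
    ext ζ
    exact neg_eq_zero.2 (h ζ)
  · intro h ζ
    have := congrArg (fun L : E →L[ℝ] ℝ => L ζ) h
    exact neg_eq_zero.1 this

/-- The coadjoint action of `g` as a continuous linear map. -/
def coAdL (g : G) : (E →L[ℝ] ℝ) →L[ℝ] (E →L[ℝ] ℝ) :=
  (ContinuousLinearMap.compL ℝ E E ℝ).flip (adE I g⁻¹)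

lemma coAdL_apply (g : G) (μ : E →L[ℝ] ℝ) : coAdL I g μ = μ.comp (adE I g⁻¹) := rfl

lemma coAdL_injective (g : G) : Injective (coAdL I g) := by
  intro μ μ' h
  ext v
  have := congrArg (fun L : E →L[ℝ] ℝ => L (adE I g v)) h
  simpa only [coAdL_apply, ContinuousLinearMap.comp_apply, adE_inv_adE] using this

lemma coAdL_coadE (g : G) (ξ : E) (μ : E →L[ℝ] ℝ) :
    coAdL I g (coadE I (G := G) ξ μ) = coadE I (G := G) (adE I g ξ) (coAdL I g μ) := by
  ext ζ
  rw [coAdL_apply, coAdL_apply, ContinuousLinearMap.comp_apply, coadE_apply, coadE_apply,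
    ContinuousLinearMap.comp_apply, adE_lieE, adE_inv_adE]

lemma orbE_mul (ν : E →L[ℝ] ℝ) (g h : G) : orbE I ν (g * h) = coAdL I g (orbE I ν h) := by
  unfold orbE
  rw [mul_inv_rev, adE_mul]
  rfl

lemma orbE_one (ν : E →L[ℝ] ℝ) : orbE I ν (1 : G) = ν := by
  unfold orbE
  rw [inv_one, adE_one]
  rfl

/-- The product `Ad^*_g ν ∘ Ad_g = ν` is constant; its product rule at `g = 1` gives the derivative
without differentiating inversion. -/
lemma tderiv_orbE_one (ν : E →L[ℝ] ℝ) (ξ : E) :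
    tderiv I 𝓘(ℝ, E →L[ℝ] ℝ) (fun g : G => orbE I ν g) 1 ξ = coadL I G ν ξ := by
  have hs := contMDiffAt_extChartAt_symm_of_mem I (oneChart_mem (G := G) I)
  have key : ∀ {F : Type _} [NormedAddCommGroup F] [NormedSpace ℝ F] (f : G → F)
      (_ : ContMDiff I 𝓘(ℝ, F) ∞ f),
      HasFDerivAt (fun y => f ((extChartAt I (1 : G)).symm y)) (tderiv I 𝓘(ℝ, F) f 1)
        (oneChart I G) := by
    intro F _ _ f hf
    have hc : ContDiffAt ℝ ∞ (fun y => f ((extChartAt I (1 : G)).symm y)) (oneChart I G) :=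
      (hf.contMDiffAt.comp _ hs).contDiffAt
    have h2 := (hc.differentiableAt (by simp)).hasFDerivAt
    convert! h2 using 1
    rw [← tderiv_eq_fderiv, tderiv_comp 𝓘(ℝ, E) I 𝓘(ℝ, F) (oneChart I G)
      (hf.mdiff _) hs.mdiff, symm_oneChart, oneChart, tderiv_extChartAt_symm_self]
    rfl
  have h1 := (key _ (contMDiff_orbE I ν)).clm_comp (key _ (contMDiff_adE I))
  have h2 : (fun y => (orbE I ν ((extChartAt I (1 : G)).symm y)).comp
      (adE I ((extChartAt I (1 : G)).symm y))) = fun _ => ν := by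
    funext y
    ext v
    simp only [orbE, ContinuousLinearMap.comp_apply, adE_inv_adE]
  rw [h2] at h1
  have h3 := h1.unique (hasFDerivAt_const ν (oneChart I G))
  ext ζ
  have h4 := congrArg (fun L : E →L[ℝ] (E →L[ℝ] ℝ) => L ξ ζ) h3
  have h5 : orbE I ν ((extChartAt I (1 : G)).symm (oneChart I G))
      (tderiv I 𝓘(ℝ, E →L[ℝ] E) (fun g : G => adE I g) 1 ξ ζ)
      + tderiv I 𝓘(ℝ, E →L[ℝ] ℝ) (fun g : G => orbE I ν g) 1 ξ
        (adE I ((extChartAt I (1 : G)).symm (oneChart I G)) ζ) = 0 := h4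
  rw [symm_oneChart, adE_one, tderiv_adE_one, orbE_one] at h5
  rw [coadL_apply, coadE_apply]
  exact eq_neg_of_add_eq_zero_right h5

/-- The derivative of the orbit map. -/
lemma tderiv_orbE (ν : E →L[ℝ] ℝ) (g : G) (v : E) :
    tderiv I 𝓘(ℝ, E →L[ℝ] ℝ) (fun h : G => orbE I ν h) g v
      = coAdL I g (coadL I G ν (mcE I g v)) := by
  have hL := (contMDiff_mul_left (I := I) (n := ∞) (a := g⁻¹)).mdiff g
  have hA := contMDiff_orbE (G := G) I ν
  -- Equivariance moves the computation from `g` to the identity.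
  have h1 : (fun h : G => orbE I ν h) = fun h : G => coAdL I g (orbE I ν (g⁻¹ * h)) := by
    funext h
    rw [← orbE_mul, mul_inv_cancel_left]
  have h2 := tderiv_comp I I 𝓘(ℝ, E →L[ℝ] ℝ) (g := fun h : G => orbE I ν h)
    (f := fun h : G => g⁻¹ * h) g (hA.mdiff _) hL
  have h3 := tderiv_comp I 𝓘(ℝ, E →L[ℝ] ℝ) 𝓘(ℝ, E →L[ℝ] ℝ) (g := fun μ => coAdL I g μ)
    (f := fun h : G => orbE I ν (g⁻¹ * h)) g ((coAdL I g).contDiff.contMDiff.mdiff _)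
    ((hA.comp contMDiff_mul_left).mdiff _)
  rw [h1, h3, h2, tderiv_eq_fderiv, (coAdL I g).fderiv, inv_mul_cancel, ← tderiv_orbE_one]
  rfl

lemma tderiv_orbE_eq_coadE (ν : E →L[ℝ] ℝ) (g : G) (v : E) :
    tderiv I 𝓘(ℝ, E →L[ℝ] ℝ) (fun h : G => orbE I ν h) g v
      = coadE I (G := G) (adE I g (mcE I g v)) (orbE I ν g) := by
  rw [tderiv_orbE, coadL_apply, coAdL_coadE]
  rfl

/-- Since `Ad^*_g` is injective, only the factor `coadL` can vanish. Together with
`kerAt_d_leftInvariantForm` this identifies the kernels of `dα_ν` and of the orbit map's derivative.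
-/
lemma tderiv_orbE_eq_zero_iff (ν : E →L[ℝ] ℝ) (g : G) (v : E) :
    tderiv I 𝓘(ℝ, E →L[ℝ] ℝ) (fun h : G => orbE I ν h) g v = 0
      ↔ (mcE I g v : GroupLieAlgebra I G) ∈ isotropyAlgebra I (G := G) ν := by
  rw [tderiv_orbE]
  refine Iff.trans ?_ (mem_isotropyAlgebra_iff I ν (mcE I g v)).symm
  constructor
  · intro h
    exact coAdL_injective I g (h.trans (map_zero _).symm)
  · intro h
    rw [h, map_zero]

/-! ### The left invariant `1`-form and its differential -/

/-- The left invariant `1`-form is left invariant. -/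
lemma pullback_mul_left_leftInvariantForm (ν : E →L[ℝ] ℝ) (a : G) :
    DiffForm.pullback I I (fun h : G => a * h) (leftInvariantForm I (G := G) ν) = leftInvariantForm I (G := G) ν := by
  funext g
  refine ContinuousAlternatingMap.ext fun v => ?_
  change ν (mcE I (a * g) (tderiv I I (fun h : G => a * h) g (v 0))) = ν (mcE I g (v 0))
  rw [← mcE_mul_comp I a g]
  rfl

variable (G) in
/-- The Maurer-Cartan form in the chart at the identity. -/
def mcChart (y : E) : E →L[ℝ] E :=
  (mcE I ((extChartAt I (1 : G)).symm y)).comp (tderiv 𝓘(ℝ, E) I (extChartAt I (1 : G)).symm y)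

lemma inChart_leftInvariantForm (ν : E →L[ℝ] ℝ) (y : E) (v : Fin 1 → E) :
    (leftInvariantForm I (G := G) ν).inChart I 1 y v = ν (mcChart I G y (v 0)) := by
  rw [DiffForm.inChart_apply]
  rfl

/-- The maps `z ↦ y⁻¹ z`, taken at `z = y`, all have the image `1`, so `contMDiffAt_tderiv_of_eq`
applies. -/
lemma contDiffAt_mcChart {y : E} (hy : y ∈ (extChartAt I (1 : G)).target) :
    ContDiffAt ℝ ∞ (mcChart I G) y := by
  have hs := contMDiffAt_extChartAt_symm_of_mem I hy
  have h : ContMDiffAt 𝓘(ℝ, E) 𝓘(ℝ, E →L[ℝ] E) ∞ (fun y => tderiv 𝓘(ℝ, E) I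
      (fun z => ((extChartAt I (1 : G)).symm y)⁻¹ * (extChartAt I (1 : G)).symm z) y) y := by
    refine contMDiffAt_tderiv_of_eq (g := fun y => y) (c := 1) ?_ contMDiffAt_id (by simp)
    exact (ContMDiffAt.comp (y, y) hs contMDiffAt_fst).inv.mul
      (ContMDiffAt.comp (y, y) hs contMDiffAt_snd)
  refine h.contDiffAt.congr_of_eventuallyEq ?_
  filter_upwards [(isOpen_extChartAt_target (1 : G)).mem_nhds hy] with z hz
  rw [tderiv_comp 𝓘(ℝ, E) I I (g := fun h : G => ((extChartAt I (1 : G)).symm z)⁻¹ * h) z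
    ((contMDiff_mul_left (I := I) (n := ∞)).mdiff _)
    (contMDiffAt_extChartAt_symm_of_mem I hz).mdiff]
  rfl

lemma mcChart_leftField {y : E} (hy : y ∈ (extChartAt I (1 : G)).target) (ζ : E) :
    mcChart I G y (fderiv ℝ (mulChart I G) (y, oneChart I G) (0, ζ)) = ζ := by
  rw [fderiv_mulChart_left I hy]
  have h3 := tderiv_extChartAt_symm_comp I ((extChartAt I (1 : G)).map_target hy)
  rw [(extChartAt I (1 : G)).right_inv hy] at h3
  set g := (extChartAt I (1 : G)).symm y with hg
  have h4 : mcChart I G y (tderiv I 𝓘(ℝ, E) (extChartAt I (1 : G)) g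
      (tderiv I I (fun h : G => g * h) 1 ζ))
      = mcE I g (((tderiv 𝓘(ℝ, E) I (extChartAt I (1 : G)).symm y).comp
        (tderiv I 𝓘(ℝ, E) (extChartAt I (1 : G)) g)) (tderiv I I (fun h : G => g * h) 1 ζ)) := rfl
  rw [h4, h3]
  exact congrArg (fun L : E →L[ℝ] E => L ζ) (mcE_comp_tderiv_one I g)

lemma mcChart_oneChart : mcChart I G (oneChart I G) = ContinuousLinearMap.id ℝ E := by
  ext ζ
  have h := mcChart_leftField I (oneChart_mem (G := G) I) ζ
  rwa [leftField_one] at h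

/-- The Maurer–Cartan form is constant on each left-invariant field; the product rule transfers the
derivative of the field to the form, with the opposite sign. -/
lemma fderiv_mcChart (ξ ζ : E) :
    fderiv ℝ (mcChart I G) (oneChart I G) ξ ζ = - mulHess I G ξ ζ := by
  have h1 := ((contDiffAt_mcChart I (oneChart_mem (G := G) I)).differentiableAt
    (by simp)).hasFDerivAt.clm_apply (hasFDerivAt_leftField I ζ)
  have h2 : (fun y => mcChart I G y (fderiv ℝ (mulChart I G) (y, oneChart I G) (0, ζ)))
      =ᶠ[𝓝 (oneChart I G)] fun _ => ζ := by
    filter_upwards [target_mem_nhds_oneChart I] with y hy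
    exact mcChart_leftField I hy ζ
  have h3 := congrArg (fun L : E →L[ℝ] E => L ξ)
    ((h1.congr_of_eventuallyEq h2.symm).unique (hasFDerivAt_const ζ (oneChart I G)))
  have h4 : mcChart I G (oneChart I G) (mulHess I G ξ ζ)
    + fderiv ℝ (mcChart I G) (oneChart I G) ξ
      (fderiv ℝ (mulChart I G) (oneChart I G, oneChart I G) (0, ζ)) = 0 := h3
  rw [leftField_one, mcChart_oneChart] at h4
  exact eq_neg_of_add_eq_zero_right h4

lemma smoothAt_leftInvariantForm_one (ν : E →L[ℝ] ℝ) :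
    DiffForm.SmoothAt I (leftInvariantForm I (G := G) ν) (1 : G) := by
  refine contDiffAt_alternating_of_apply fun v => ?_
  have h1 := contDiffAt_mcChart I (oneChart_mem (G := G) I)
  have h2 : ContDiffAt ℝ ∞ (fun y => ν (mcChart I G y (v 0))) (oneChart I G) :=
    ν.contDiff.contDiffAt.comp _ (h1.clm_apply contDiffAt_const)
  refine h2.congr_of_eventuallyEq (Filter.Eventually.of_forall fun y => ?_)
  exact inChart_leftInvariantForm (G := G) I ν y v

lemma isSmooth_leftInvariantForm (ν : E →L[ℝ] ℝ) :
    (leftInvariantForm I (G := G) ν).IsSmooth I := by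
  refine (DiffForm.isSmooth_iff I).2 fun g => ?_
  -- Invariance under translation by `g⁻¹` reduces smoothness at `g` to smoothness at the identity.
  rw [← pullback_mul_left_leftInvariantForm (G := G) I ν g⁻¹]
  refine DiffForm.SmoothAt.pullback ?_ contMDiff_mul_left.contMDiffAt
  rw [inv_mul_cancel]
  exact smoothAt_leftInvariantForm_one I ν

/-- The Maurer–Cartan equation at the identity: the exterior derivative antisymmetrises `-ν (mulHess
I G ξ ζ)`, and the antisymmetrised Hessian is the bracket. -/
lemma val_d_leftInvariantForm_one (ν : E →L[ℝ] ℝ) (ξ ζ : E) :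
    DiffForm.val I (DiffForm.d I (leftInvariantForm I (G := G) ν)) (1 : G) ![ξ, ζ]
      = - ν (lieE I G ξ ζ) := by
  have hsm : DifferentiableAt ℝ ((leftInvariantForm I (G := G) ν).inChart I 1) (oneChart I G) :=
    ContDiffAt.differentiableAt (smoothAt_leftInvariantForm_one (G := G) I ν) (by simp)
  have hd : ∀ ξ ζ : E, fderiv ℝ (fun y => (leftInvariantForm I (G := G) ν).inChart I 1 y ![ζ])
      (oneChart I G) ξ = - ν (mulHess I G ξ ζ) := by
    intro ξ ζ
    have h1 := ((contDiffAt_mcChart I (oneChart_mem (G := G) I)).differentiableAt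
      (by simp)).hasFDerivAt.clm_apply (hasFDerivAt_const ζ (oneChart I G))
    have h2 := ν.hasFDerivAt.comp (oneChart I G) h1
    have h3 : (fun y => (leftInvariantForm I (G := G) ν).inChart I 1 y ![ζ])
        = ν ∘ fun y => mcChart I G y ζ :=
      funext fun y => inChart_leftInvariantForm (G := G) I ν y ![ζ]
    rw [h3, h2.fderiv]
    simp [fderiv_mcChart]
  rw [DiffForm.val_d, tderiv_extChartAt_self]
  change extDeriv ((leftInvariantForm I (G := G) ν).inChart I 1) (oneChart I G) ![ξ, ζ] = _
  rw [extDeriv_apply hsm, Fin.sum_univ_two]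
  have e0 : (0 : Fin 2).removeNth ![ξ, ζ] = ![ζ] := by
    ext i; fin_cases i; rfl
  have e1 : (1 : Fin 2).removeNth ![ξ, ζ] = ![ξ] := by
    ext i; fin_cases i; rfl
  rw [e0, e1]
  simp only [Matrix.cons_val_zero, Matrix.cons_val_one]
  rw [hd, hd, lieE_eq_mulHess, map_sub]
  simp
  ring

/-- The differential of the left invariant `1`-form: `dα(v, w) = -⟨ν, [θ v, θ w]⟩`. -/
lemma val_d_leftInvariantForm (ν : E →L[ℝ] ℝ) (g : G) (v w : E) :
    DiffForm.val I (DiffForm.d I (leftInvariantForm I (G := G) ν)) g ![v, w]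
      = - ν (lieE I G (mcE I g v) (mcE I g w)) := by
  have h1 := DiffForm.d_pullback (x := g) (f := fun h : G => g⁻¹ * h)
    (Ω := leftInvariantForm I (G := G) ν) contMDiff_mul_left.contMDiffAt
    ((DiffForm.isSmooth_iff I).1 (isSmooth_leftInvariantForm (G := G) I ν) _)
  rw [pullback_mul_left_leftInvariantForm] at h1
  have h2 : DiffForm.val I (DiffForm.d I (leftInvariantForm I (G := G) ν)) g ![v, w]
      = DiffForm.val I (DiffForm.d I (leftInvariantForm I (G := G) ν)) (g⁻¹ * g)
        (mcE I g ∘ ![v, w]) := congrArg (fun L : E [⋀^Fin 2]→L[ℝ] ℝ => L ![v, w]) h1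
  have h3 : (mcE I g ∘ ![v, w]) = ![mcE I g v, mcE I g w] := by
    ext i; fin_cases i <;> rfl
  rw [h2, h3, inv_mul_cancel, val_d_leftInvariantForm_one]

lemma isPresymplectic_d_leftInvariantForm (ν : E →L[ℝ] ℝ) :
    DiffForm.IsPresymplectic I (DiffForm.d I (leftInvariantForm I (G := G) ν)) where
  smooth := (isSmooth_leftInvariantForm (G := G) I ν).d
  closed := (isSmooth_leftInvariantForm (G := G) I ν).d_d

lemma mcE_surjective (g : G) : Surjective (mcE I g) := fun ζ =>
  ⟨tderiv I I (fun h : G => g * h) 1 ζ,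
    congrArg (fun L : E →L[ℝ] E => L ζ) (mcE_comp_tderiv_one I g)⟩

lemma kerAt_d_leftInvariantForm (ν : E →L[ℝ] ℝ) (g : G) :
    DiffForm.kerAt I (DiffForm.d I (leftInvariantForm I (G := G) ν)) g
      = {v | maurerCartan I g v ∈ isotropyAlgebra I (G := G) ν} := by
  ext v
  constructor
  · intro h ζ
    obtain ⟨w, hw⟩ := mcE_surjective I g ζ
    have h1 := (val_d_leftInvariantForm (G := G) I ν g v w).symm.trans (h w)
    rw [hw] at h1
    exact neg_eq_zero.1 h1
  · intro h w
    refine (val_d_leftInvariantForm (G := G) I ν g v w).trans ?_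
    exact neg_eq_zero.2 (h (mcE I g w))

end InvariantForms

/-! ### Maps of constant rank -/

section ConstantRank

variable {E : Type*} [NormedAddCommGroup E] [NormedSpace ℝ E]
  {F : Type*} [NormedAddCommGroup F] [NormedSpace ℝ F]
  {R : Type*} [NormedAddCommGroup R] [NormedSpace ℝ R]

/-- Restricted to the range of `L`, the map `P` is a surjection between spaces of equal dimension,
hence injective. -/
lemma eq_zero_of_comp_surjective_of_finrank [FiniteDimensional ℝ E] [FiniteDimensional ℝ R]
    {L : E →ₗ[ℝ] F} {P : F →ₗ[ℝ] R} (hs : Surjective (P ∘ₗ L))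
    (hr : Module.finrank ℝ (LinearMap.range L) = Module.finrank ℝ R) {v : E} (hv : P (L v) = 0) :
    L v = 0 := by
  have h1 : Surjective (P.domRestrict (LinearMap.range L)) := fun u => by
    obtain ⟨w, hw⟩ := hs u
    exact ⟨⟨L w, w, rfl⟩, hw⟩
  have h2 := (LinearMap.injective_iff_surjective_of_finrank_eq_finrank hr).2 h1
  have h3 : (⟨L v, v, rfl⟩ : LinearMap.range L) = 0 := h2 (by rw [map_zero]; exact hv)
  exact congrArg Subtype.val h3

lemma exists_surjective_comp_of_finrank_range [FiniteDimensional ℝ E] [FiniteDimensional ℝ F]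
    [FiniteDimensional ℝ R] (L : E →ₗ[ℝ] F)
    (hr : Module.finrank ℝ (LinearMap.range L) = Module.finrank ℝ R) :
    ∃ P : F →L[ℝ] R, Surjective fun v => P (L v) := by
  obtain ⟨P, hP⟩ := LinearMap.exists_extend (LinearEquiv.ofFinrankEq _ _ hr).toLinearMap
  refine ⟨LinearMap.toContinuousLinearMap P, fun u => ?_⟩
  obtain ⟨⟨_, v, rfl⟩, hw⟩ := (LinearEquiv.ofFinrankEq _ _ hr).surjective u
  exact ⟨v, (congrArg (fun T : LinearMap.range L →ₗ[ℝ] R => T ⟨L v, v, rfl⟩) hP).trans hw⟩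

/-- A chart around `e`, with values in a product of balls, in which the map `a` depends only on
its components `P ∘ a`, and in which these components are the first coordinate. -/
structure FlatChart (a : E → F) (P : F →L[ℝ] R) (K : Submodule ℝ E) (e : E) (U : Set E) where
  /-- the chart -/
  chart : OpenPartialHomeomorph E (R × K)
  /-- the radius of the balls -/
  radius : ℝ
  radius_pos : 0 < radius
  source_subset : chart.source ⊆ U
  mem_source : e ∈ chart.source
  target_eq : chart.target = Metric.ball (P (a e)) radius ×ˢ Metric.ball 0 radius
  fst_apply : ∀ y, (chart y).1 = P (a y)
  apply_base : chart e = (P (a e), 0)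
  contDiffAt_symm : ∀ q ∈ chart.target, ContDiffAt ℝ ∞ chart.symm q
  eq_of_fst_eq : ∀ u z z', (u, z) ∈ chart.target → (u, z') ∈ chart.target →
    a (chart.symm (u, z)) = a (chart.symm (u, z'))
  -- This first-order normalisation along the kernel lets curves in the fibre of `a` be given
  -- prescribed velocities.
  fderiv_symm : ∀ w : K, fderiv ℝ chart.symm (P (a e), 0) (0, w) = w

variable [FiniteDimensional ℝ E] [FiniteDimensional ℝ R]

/-- A form of the constant rank theorem. -/
theorem nonempty_flatChart {a : E → F} {P : F →L[ℝ] R} {e : E} {U : Set E} (hU : IsOpen U)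
    (he : e ∈ U) (ha : ∀ y ∈ U, ContDiffAt ℝ ∞ a y)
    (hP : Surjective fun v => P (fderiv ℝ a e v))
    (hr : ∀ y ∈ U, Module.finrank ℝ (LinearMap.range (fderiv ℝ a y).toLinearMap)
      = Module.finrank ℝ R) :
    Nonempty (FlatChart a P (LinearMap.ker (fderiv ℝ a e).toLinearMap) e U) := by
  have : CompleteSpace E := FiniteDimensional.complete ℝ E
  have : CompleteSpace R := FiniteDimensional.complete ℝ R
  set K := LinearMap.ker (fderiv ℝ a e).toLinearMap with hK
  obtain ⟨Q, hQ⟩ := K.subtype.exists_leftInverse_of_injective K.ker_subtype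
  have hQ' : ∀ w : K, Q w = w := fun w => congrArg (fun T : K →ₗ[ℝ] K => T w) hQ
  let Qc : E →L[ℝ] K := LinearMap.toContinuousLinearMap Q
  -- `P ∘ a` provides as many coordinates as the rank; a linear projection onto the kernel supplies
  -- the remaining ones.
  let Φ : E → R × K := fun y => (P (a y), Qc (y - e))
  have hΦ : ∀ y ∈ U, ContDiffAt ℝ ∞ Φ y := fun y hy =>
    (P.contDiff.contDiffAt.comp y (ha y hy)).prodMk
      (Qc.contDiff.contDiffAt.comp y (contDiffAt_id.sub contDiffAt_const))
  have hΦd : ∀ y ∈ U, HasFDerivAt Φ ((P.comp (fderiv ℝ a y)).prod Qc) y := fun y hy => by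
    have h1 := P.hasFDerivAt.comp y ((ha y hy).differentiableAt (by simp)).hasFDerivAt
    have h2 := Qc.hasFDerivAt.comp y ((hasFDerivAt_id y).sub_const e)
    exact h1.prodMk h2
  have hinj : Injective ((P.comp (fderiv ℝ a e)).prod Qc).toLinearMap := by
    rw [← LinearMap.ker_eq_bot, LinearMap.ker_eq_bot']
    intro v hv
    have hv1 : P (fderiv ℝ a e v) = 0 := congrArg Prod.fst hv
    have hv2 : Q v = 0 := congrArg Prod.snd hv
    have hvK : fderiv ℝ a e v = 0 :=
      eq_zero_of_comp_surjective_of_finrank (L := (fderiv ℝ a e).toLinearMap)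
        (P := P.toLinearMap) hP (hr e he) hv1
    have h3 := hQ' ⟨v, hvK⟩
    exact congrArg Subtype.val (h3.symm.trans hv2)
  have hdim : Module.finrank ℝ E = Module.finrank ℝ (R × K) := by
    rw [Module.finrank_prod, ← hr e he]
    exact (LinearMap.finrank_range_add_finrank_ker _).symm
  let Φ' : E ≃L[ℝ] R × K :=
    (LinearEquiv.ofInjectiveOfFinrankEq _ hinj hdim).toContinuousLinearEquiv
  have hΦ' : (Φ' : E →L[ℝ] R × K) = (P.comp (fderiv ℝ a e)).prod Qc := rfl
  have hd0 : HasFDerivAt Φ (Φ' : E →L[ℝ] R × K) e := hΦd e he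
  let c0 := (hΦ e he).toOpenPartialHomeomorph Φ hd0 (by simp)
  have hc0 : ∀ y, c0 y = Φ y := fun _ => rfl
  have hc0e : e ∈ c0.source := ContDiffAt.mem_toOpenPartialHomeomorph_source _ _ _
  -- shrink the chart so that the derivative stays invertible
  have hnhds : ∀ᶠ y in 𝓝 e, y ∈ U ∧ 
      fderiv ℝ Φ y ∈ range ((↑) : (E ≃L[ℝ] R × K) → E →L[ℝ] R × K) := by
    refine Filter.Eventually.and (hU.mem_nhds he) ?_
    have h1 : ContinuousAt (fderiv ℝ Φ) e :=
      ((hΦ e he).fderiv_right (m := ∞) (by simp)).continuousAt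
    refine h1.eventually ?_
    rw [hd0.fderiv]
    exact ContinuousLinearEquiv.nhds Φ'
  obtain ⟨W, hW, hWo, heW⟩ := eventually_nhds_iff.1 hnhds
  let c1 := c0.restrOpen W hWo
  have hc1s : c1.source = c0.source ∩ W := c0.restrOpen_source W hWo
  have hc1e : e ∈ c1.source := by rw [hc1s]; exact ⟨hc0e, heW⟩
  have hΦe : Φ e = (P (a e), 0) := by simp [Φ]
  have hte : c1.target ∈ 𝓝 ((P (a e), 0) : R × K) := by
    rw [← hΦe]
    exact c1.open_target.mem_nhds (c1.map_source hc1e)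
  obtain ⟨ε, hε, hball⟩ := Metric.mem_nhds_iff.1 hte
  rw [← ball_prod_same] at hball
  -- The target becomes a product of balls, so each set of points with a given first coordinate is
  -- connected.
  let c := (c1.symm.restrOpen (Metric.ball (P (a e)) ε ×ˢ Metric.ball (0 : K) ε)
    (Metric.isOpen_ball.prod Metric.isOpen_ball)).symm
  have hct : c.target = Metric.ball (P (a e)) ε ×ˢ Metric.ball (0 : K) ε := by
    exact (c1.symm.restrOpen_source _ (Metric.isOpen_ball.prod Metric.isOpen_ball)).trans
      (inter_eq_self_of_subset_right hball)
  have hcc : ∀ y, c y = Φ y := fun _ => rfl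
  have hbt : ((P (a e), 0) : R × K) ∈ c.target := by
    rw [hct]; exact ⟨Metric.mem_ball_self hε, Metric.mem_ball_self hε⟩
  have hcs : c.source ⊆ c1.source := fun y hy => by
    have h1 := c.map_source hy
    rw [hct] at h1
    have h2 := c1.map_target (hball h1)
    have h3 : c1.symm (c y) = y := c.left_inv hy
    rwa [h3] at h2
  have hce : e ∈ c.source := by
    have h1 := c.map_target hbt
    have h2 : c.symm (P (a e), 0) = e := by
      rw [← hΦe]
      exact c1.left_inv hc1e
    rwa [h2] at h1
  have hcsW : ∀ y ∈ c.source, y ∈ U ∧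
      fderiv ℝ Φ y ∈ range ((↑) : (E ≃L[ℝ] R × K) → E →L[ℝ] R × K) := fun y hy => by
    have := hcs hy
    rw [hc1s] at this
    exact hW y this.2
  have hsymm : ∀ q ∈ c.target, ContDiffAt ℝ ∞ c.symm q := fun q hq => by
    obtain ⟨hyU, f', hf'⟩ := hcsW _ (c.map_target hq)
    refine c.contDiffAt_symm hq (f₀' := f') ?_ (hΦ _ hyU)
    rw [hf']
    exact ((hΦ _ hyU).differentiableAt (by simp)).hasFDerivAt
  have hsymmd : ∀ q ∈ c.target, ∀ w, fderiv ℝ Φ (c.symm q) (fderiv ℝ c.symm q w) = w := by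
    intro q hq w
    have hyU := (hcsW _ (c.map_target hq)).1
    have h1 := ((hΦ _ hyU).differentiableAt (by simp)).hasFDerivAt.comp q
      ((hsymm q hq).differentiableAt (by simp)).hasFDerivAt
    have h2 : Φ ∘ c.symm =ᶠ[𝓝 q] id := by
      filter_upwards [c.open_target.mem_nhds hq] with z hz using c.right_inv hz
    have h3 := (h1.congr_of_eventuallyEq h2.symm).unique (hasFDerivAt_id q)
    exact congrArg (fun T : R × K →L[ℝ] R × K => T w) h3
  have hsymme : c.symm (P (a e), 0) = e := by
    have := c.left_inv hce
    rwa [hcc, hΦe] at this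
  refine ⟨⟨c, ε, hε, fun y hy => (hcsW y hy).1, hce, hct, fun _ => rfl, hΦe, hsymm, ?_, ?_⟩⟩
  · intro u z z' hz hz'
    rw [hct] at hz hz'
    have hmem : ∀ x ∈ Metric.ball (0 : K) ε, (u, x) ∈ c.target := fun x hx => by
      rw [hct]; exact ⟨hz.1, hx⟩
    have hd : ∀ x ∈ Metric.ball (0 : K) ε, HasFDerivAt (fun x => a (c.symm (u, x)))
        (((fderiv ℝ a (c.symm (u, x))).comp (fderiv ℝ c.symm (u, x))).comp
          (ContinuousLinearMap.inr ℝ R K)) x := fun x hx => by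
      have hyU := (hcsW _ (c.map_target (hmem x hx))).1
      have h1 := ((ha _ hyU).differentiableAt (by simp)).hasFDerivAt.comp (u, x)
        ((hsymm _ (hmem x hx)).differentiableAt (by simp)).hasFDerivAt
      exact HasFDerivAt.comp (f := fun x : K => (u, x)) x h1 (hasFDerivAt_prodMk_right u x)
    -- Along such a set `P ∘ a` is constant. By the rank hypothesis `P` is injective on the range of
    -- `Da`, so the derivative of `a` itself vanishes.
    refine Metric.isOpen_ball.is_const_of_fderiv_eq_zero (𝕜 := ℝ)
      (f := fun x => a (c.symm (u, x))) (convex_ball (0 : K) ε).isPreconnected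
      (fun x hx => (hd x hx).differentiableAt.differentiableWithinAt) (fun x hx => ?_) hz.2 hz'.2
    rw [(hd x hx).fderiv]
    ext w
    have hy := hcsW _ (c.map_target (hmem x hx))
    obtain ⟨hyU, f', hf'⟩ := hy
    have h1 := hsymmd _ (hmem x hx) (0, w)
    rw [(hΦd _ hyU).fderiv] at h1
    rw [(hΦd _ hyU).fderiv] at hf'
    refine eq_zero_of_comp_surjective_of_finrank
      (L := (fderiv ℝ a (c.symm (u, x))).toLinearMap) (P := P.toLinearMap) (fun r => ?_)
      (hr _ hyU) (congrArg Prod.fst h1)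
    -- Surjectivity of `P ∘ Da` away from `e` follows from invertibility of `DΦ`, which the
    -- shrinking to `W` secured.
    obtain ⟨v, hv⟩ := f'.surjective (r, 0)
    refine ⟨v, ?_⟩
    have h2 : (f' : E →L[ℝ] R × K) v = (r, 0) := hv
    rw [hf'] at h2
    exact congrArg Prod.fst h2
  · intro w
    have h1 := hsymmd _ hbt (0, w)
    rw [hsymme, hd0.fderiv] at h1
    refine Φ'.injective (h1.trans ?_)
    change ((0 : R), w) = (P (fderiv ℝ a e w), Q w)
    rw [hQ' w, show fderiv ℝ a e w = 0 from w.2, map_zero]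

end ConstantRank

/-! ### Slices for the coadjoint action -/

section Slice

variable {E : Type*} [NormedAddCommGroup E] [NormedSpace ℝ E]
  {H : Type*} [TopologicalSpace H] (I : ModelWithCorners ℝ E H)
  {G : Type*} [TopologicalSpace G] [ChartedSpace H G] [Group G] [LieGroup I ∞ G]
  [I.Boundaryless] [FiniteDimensional ℝ E]

variable (G) in
/-- The dimension of the coadjoint orbit of `ν`. -/
abbrev orbitDim (ν : E →L[ℝ] ℝ) : ℕ :=
  Module.finrank ℝ (GroupLieAlgebra I G ⧸ (isotropyAlgebra I (G := G) ν).toSubmodule)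

lemma finrank_range_coadL (ν : E →L[ℝ] ℝ) :
    Module.finrank ℝ (LinearMap.range (coadL I G ν)) = orbitDim I G ν := by
  have h1 := Submodule.finrank_quotient_add_finrank (R := ℝ) (M := GroupLieAlgebra I G)
    (isotropyAlgebra I (G := G) ν).toSubmodule
  have h2 := (coadL I G ν).finrank_range_add_finrank_ker
  let S : Submodule ℝ E := LinearMap.ker (coadL I G ν)
  have h3 : (isotropyAlgebra I (G := G) ν).toSubmodule
      = (S : Submodule ℝ (GroupLieAlgebra I G)) := by
    ext ξ
    exact mem_isotropyAlgebra_iff I ν ξ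
  have h4 : Module.finrank ℝ (isotropyAlgebra I (G := G) ν).toSubmodule
      = Module.finrank ℝ (LinearMap.ker (coadL I G ν)) :=
    congrArg (fun S : Submodule ℝ (GroupLieAlgebra I G) => Module.finrank ℝ S) h3
  have h5 : Module.finrank ℝ (GroupLieAlgebra I G) = Module.finrank ℝ E := rfl
  unfold orbitDim
  omega

variable (G) in
/-- The coadjoint orbit map in the chart at the identity. -/
def orbChart (ν : E →L[ℝ] ℝ) (y : E) : E →L[ℝ] ℝ := orbE I ν ((extChartAt I (1 : G)).symm y)

lemma contDiffAt_orbChart (ν : E →L[ℝ] ℝ) {y : E} (hy : y ∈ (extChartAt I (1 : G)).target) :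
    ContDiffAt ℝ ∞ (orbChart I G ν) y :=
  ((contMDiff_orbE I ν).contMDiffAt.comp y (contMDiffAt_extChartAt_symm_of_mem I hy)).contDiffAt

lemma fderiv_orbChart (ν : E →L[ℝ] ℝ) {y : E} (hy : y ∈ (extChartAt I (1 : G)).target) (v : E) :
    fderiv ℝ (orbChart I G ν) y v = coAdL I ((extChartAt I (1 : G)).symm y)
      (coadL I G ν (mcE I ((extChartAt I (1 : G)).symm y)
        (tderiv 𝓘(ℝ, E) I (extChartAt I (1 : G)).symm y v))) := by
  rw [← tderiv_orbE, ← tderiv_eq_fderiv]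
  have h := tderiv_comp 𝓘(ℝ, E) I 𝓘(ℝ, E →L[ℝ] ℝ) (g := fun g : G => orbE I ν g)
    (f := (extChartAt I (1 : G)).symm) y ((contMDiff_orbE I ν).mdiff _)
    (contMDiffAt_extChartAt_symm_of_mem I hy).mdiff
  exact congrArg (fun L : E →L[ℝ] (E →L[ℝ] ℝ) => L v) h

lemma tderiv_extChartAt_symm_surjective {y : E} (hy : y ∈ (extChartAt I (1 : G)).target) :
    Surjective (tderiv 𝓘(ℝ, E) I (extChartAt I (1 : G)).symm y) := fun w => by
  have h := tderiv_extChartAt_symm_comp I ((extChartAt I (1 : G)).map_target hy)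
  rw [(extChartAt I (1 : G)).right_inv hy] at h
  exact ⟨_, congrArg (fun L : E →L[ℝ] E => L w) h⟩

/-- The constant rank hypothesis. By equivariance the range of the derivative at `g` is the image of
the range at the identity under the injective map `Ad^*_g`. -/
lemma finrank_range_fderiv_orbChart (ν : E →L[ℝ] ℝ) {y : E}
    (hy : y ∈ (extChartAt I (1 : G)).target) :
    Module.finrank ℝ (LinearMap.range (fderiv ℝ (orbChart I G ν) y).toLinearMap)
      = orbitDim I G ν := by
  set g := (extChartAt I (1 : G)).symm y with hg
  have h1 : LinearMap.range (fderiv ℝ (orbChart I G ν) y).toLinearMap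
      = (LinearMap.range (coadL I G ν)).map (coAdL I g).toLinearMap := by
    ext μ
    constructor
    · rintro ⟨v, rfl⟩
      exact ⟨_, ⟨_, rfl⟩, (fderiv_orbChart I ν hy v).symm⟩
    · rintro ⟨_, ⟨ξ, rfl⟩, rfl⟩
      obtain ⟨w, hw⟩ := mcE_surjective I g ξ
      obtain ⟨v, hv⟩ := tderiv_extChartAt_symm_surjective I hy w
      refine ⟨v, (fderiv_orbChart I ν hy v).trans ?_⟩
      rw [hv, ← hg, hw]
      rfl
  rw [h1, ← finrank_range_coadL]
  exact (Submodule.equivMapOfInjective _ (coAdL_injective I g) _).finrank_eq.symm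

lemma fderiv_orbChart_oneChart (ν : E →L[ℝ] ℝ) (ξ : E) :
    fderiv ℝ (orbChart I G ν) (oneChart I G) ξ = coadL I G ν ξ := by
  have h := fderiv_orbChart I ν (oneChart_mem (G := G) I) ξ
  rw [symm_oneChart, oneChart, tderiv_extChartAt_symm_self] at h
  have h1 : mcE I (1 : G) = ContinuousLinearMap.id ℝ E := by
    rw [mcE_eq]
    simp only [inv_one, one_mul]
    exact tderiv_id I 1
  rw [h1] at h
  refine h.trans ?_
  rw [coAdL_apply, inv_one, adE_one]
  rfl

variable (G) in
/-- The model space of the coadjoint orbit. -/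
abbrev OrbitModel (ν : E →L[ℝ] ℝ) : Type := EuclideanSpace ℝ (Fin (orbitDim I G ν))

variable (G) in
lemma exists_sliceProj (ν : E →L[ℝ] ℝ) :
    ∃ P : (E →L[ℝ] ℝ) →L[ℝ] OrbitModel I G ν, Nonempty (FlatChart (orbChart I G ν) P
      (LinearMap.ker (fderiv ℝ (orbChart I G ν) (oneChart I G)).toLinearMap) (oneChart I G)
      (extChartAt I (1 : G)).target) := by
  have hr : ∀ y ∈ (extChartAt I (1 : G)).target,
      Module.finrank ℝ (LinearMap.range (fderiv ℝ (orbChart I G ν) y).toLinearMap)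
        = Module.finrank ℝ (OrbitModel I G ν) := fun y hy => by
    rw [finrank_range_fderiv_orbChart I ν hy, finrank_euclideanSpace_fin]
  obtain ⟨P, hP⟩ := exists_surjective_comp_of_finrank_range _ (hr _ (oneChart_mem I))
  exact ⟨P, nonempty_flatChart (isOpen_extChartAt_target _) (oneChart_mem I)
    (fun y hy => contDiffAt_orbChart I ν hy) hP hr⟩

variable (G) in
/-- A linear map `𝔤^* → ℝ^k` that restricts to a local coordinate system of the orbit at `ν`. -/
def sliceProj (ν : E →L[ℝ] ℝ) : (E →L[ℝ] ℝ) →L[ℝ] OrbitModel I G ν :=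
  (exists_sliceProj I G ν).choose

variable (G) in
/-- The Lie algebra of the isotropy group, as the kernel of the derivative of the orbit map. -/
abbrev sliceKer (ν : E →L[ℝ] ℝ) : Submodule ℝ E :=
  LinearMap.ker (fderiv ℝ (orbChart I G ν) (oneChart I G)).toLinearMap

variable (G) in
/-- Coordinates of `G` near the identity adapted to the coadjoint orbit map. -/
def slice (ν : E →L[ℝ] ℝ) : FlatChart (orbChart I G ν) (sliceProj I G ν) (sliceKer I G ν)
    (oneChart I G) (extChartAt I (1 : G)).target :=
  (exists_sliceProj I G ν).choose_spec.some

variable (G) in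
/-- The open ball in which the slice coordinates along the orbit vary. -/
def sliceBall (ν : E →L[ℝ] ℝ) : Set (OrbitModel I G ν) :=
  Metric.ball (sliceProj I G ν ν) (slice I G ν).radius

variable (G) in
/-- The open ball in which the slice coordinates along the isotropy group vary. -/
def fiberBall (ν : E →L[ℝ] ℝ) : Set (sliceKer I G ν) := Metric.ball 0 (slice I G ν).radius

variable (G) in
/-- The inverse of the slice coordinates. -/
def sliceMap (ν : E →L[ℝ] ℝ) (q : OrbitModel I G ν × sliceKer I G ν) : G :=
  (extChartAt I (1 : G)).symm ((slice I G ν).chart.symm q)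

variable (G) in
/-- The domain of the slice coordinates. -/
def sliceNhd (ν : E →L[ℝ] ℝ) : Set G :=
  (extChartAt I (1 : G)).source ∩ extChartAt I (1 : G) ⁻¹' (slice I G ν).chart.source

lemma isOpen_sliceNhd (ν : E →L[ℝ] ℝ) : IsOpen (sliceNhd I G ν) :=
  isOpen_extChartAt_preimage' 1 (slice I G ν).chart.open_source

lemma one_mem_sliceNhd (ν : E →L[ℝ] ℝ) : (1 : G) ∈ sliceNhd I G ν :=
  ⟨mem_extChartAt_source _, (slice I G ν).mem_source⟩

lemma isOpen_sliceBall (ν : E →L[ℝ] ℝ) : IsOpen (sliceBall I G ν) := Metric.isOpen_ball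

lemma mem_sliceBall (ν : E →L[ℝ] ℝ) : sliceProj I G ν ν ∈ sliceBall I G ν :=
  Metric.mem_ball_self (slice I G ν).radius_pos

lemma zero_mem_fiberBall (ν : E →L[ℝ] ℝ) : 0 ∈ fiberBall I G ν :=
  Metric.mem_ball_self (slice I G ν).radius_pos

lemma orbChart_oneChart (ν : E →L[ℝ] ℝ) : orbChart I G ν (oneChart I G) = ν := by
  rw [orbChart, symm_oneChart, orbE_one]

lemma mem_slice_target {ν : E →L[ℝ] ℝ} {u : OrbitModel I G ν} {z : sliceKer I G ν}
    (hu : u ∈ sliceBall I G ν) (hz : z ∈ fiberBall I G ν) :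
    (u, z) ∈ (slice I G ν).chart.target := by
  rw [(slice I G ν).target_eq, orbChart_oneChart]
  exact ⟨hu, hz⟩

section

variable {ν : E →L[ℝ] ℝ} {u : OrbitModel I G ν} {z : sliceKer I G ν}
  (hu : u ∈ sliceBall I G ν) (hz : z ∈ fiberBall I G ν)

include hu hz

lemma slice_symm_mem_target :
    (slice I G ν).chart.symm (u, z) ∈ (extChartAt I (1 : G)).target :=
  (slice I G ν).source_subset ((slice I G ν).chart.map_target (mem_slice_target I hu hz))

lemma sliceMap_mem : sliceMap I G ν (u, z) ∈ sliceNhd I G ν := by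
  have h := slice_symm_mem_target I hu hz
  refine ⟨(extChartAt I (1 : G)).map_target h, ?_⟩
  rw [mem_preimage, sliceMap, (extChartAt I (1 : G)).right_inv h]
  exact (slice I G ν).chart.map_target (mem_slice_target I hu hz)

lemma contMDiffAt_sliceMap :
    ContMDiffAt 𝓘(ℝ, OrbitModel I G ν × sliceKer I G ν) I ∞ (sliceMap I G ν) (u, z) :=
  (contMDiffAt_extChartAt_symm_of_mem I (slice_symm_mem_target I hu hz)).comp (u, z)
    ((slice I G ν).contDiffAt_symm _ (mem_slice_target I hu hz)).contMDiffAt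

lemma sliceProj_orbE_sliceMap : sliceProj I G ν (orbE I ν (sliceMap I G ν (u, z))) = u := by
  have h := (slice I G ν).fst_apply ((slice I G ν).chart.symm (u, z))
  rw [(slice I G ν).chart.right_inv (mem_slice_target I hu hz)] at h
  exact h.symm

/-- With `sliceProj_orbE_sliceMap` this says that, inside the slice domain, the cosets of `G_ν` are
exactly the sets `u = const`. -/
lemma orbE_sliceMap_eq :
    orbE I ν (sliceMap I G ν (u, z)) = orbE I ν (sliceMap I G ν (u, 0)) :=
  (slice I G ν).eq_of_fst_eq u z 0 (mem_slice_target I hu hz)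
    (mem_slice_target I hu (zero_mem_fiberBall I ν))

end

lemma exists_sliceMap_eq {ν : E →L[ℝ] ℝ} {g : G} (hg : g ∈ sliceNhd I G ν) :
    ∃ u ∈ sliceBall I G ν, ∃ z ∈ fiberBall I G ν, sliceMap I G ν (u, z) = g := by
  have h := (slice I G ν).chart.map_source hg.2
  have h' := h
  rw [(slice I G ν).target_eq, orbChart_oneChart] at h'
  refine ⟨_, h'.1, _, h'.2, ?_⟩
  rw [sliceMap, Prod.mk.eta, (slice I G ν).chart.left_inv hg.2, (extChartAt I (1 : G)).left_inv hg.1]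

lemma sliceMap_base (ν : E →L[ℝ] ℝ) : sliceMap I G ν (sliceProj I G ν ν, 0) = 1 := by
  have h := (slice I G ν).apply_base
  rw [orbChart_oneChart] at h
  rw [sliceMap, ← h, (slice I G ν).chart.left_inv (slice I G ν).mem_source, symm_oneChart]

lemma tderiv_sliceMap_base (ν : E →L[ℝ] ℝ) (w : sliceKer I G ν) :
    tderiv 𝓘(ℝ, OrbitModel I G ν × sliceKer I G ν) I (sliceMap I G ν) (sliceProj I G ν ν, 0) (0, w)
      = w := by
  have hb := slice_symm_mem_target I (mem_sliceBall (G := G) I ν) (zero_mem_fiberBall I ν)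
  have h1 : (slice I G ν).chart.symm (sliceProj I G ν ν, 0) = oneChart I G := by
    have h := (slice I G ν).apply_base
    rw [orbChart_oneChart] at h
    rw [← h, (slice I G ν).chart.left_inv (slice I G ν).mem_source]
  have h2 := tderiv_comp 𝓘(ℝ, OrbitModel I G ν × sliceKer I G ν) 𝓘(ℝ, E) I
    (g := (extChartAt I (1 : G)).symm) (f := (slice I G ν).chart.symm) (sliceProj I G ν ν, 0)
    (contMDiffAt_extChartAt_symm_of_mem I hb).mdiff
    ((slice I G ν).contDiffAt_symm _ (mem_slice_target I (mem_sliceBall I ν)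
      (zero_mem_fiberBall I ν))).contMDiffAt.mdiff
  have h3 := (slice I G ν).fderiv_symm w
  rw [orbChart_oneChart] at h3
  have h4 : tderiv 𝓘(ℝ, E) I (extChartAt I (1 : G)).symm (oneChart I G)
    = ContinuousLinearMap.id ℝ E := tderiv_extChartAt_symm_self I 1
  rw [h1, h4, tderiv_eq_fderiv] at h2
  exact (congrArg (fun L : OrbitModel I G ν × sliceKer I G ν →L[ℝ] E => L (0, w)) h2).trans h3

lemma mem_sliceKer_iff (ν : E →L[ℝ] ℝ) (ξ : E) : ξ ∈ sliceKer I G ν ↔ coadL I G ν ξ = 0 := by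
  rw [← fderiv_orbChart_oneChart]
  rfl

/-- Near the identity, the isotropy group is parametrized by the second slice coordinate. -/
lemma orbE_sliceMap_fiber {ν : E →L[ℝ] ℝ} {z : sliceKer I G ν} (hz : z ∈ fiberBall I G ν) :
    orbE I ν (sliceMap I G ν (sliceProj I G ν ν, z)) = ν := by
  rw [orbE_sliceMap_eq I (mem_sliceBall I ν) hz, sliceMap_base, orbE_one]

/-- The first slice coordinate of `g` is the projection of `Ad^*_g ν`, so on the isotropy group it
takes its value at the identity. -/
lemma exists_sliceMap_fiber_eq {ν : E →L[ℝ] ℝ} {g : G} (hg : g ∈ sliceNhd I G ν)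
    (hν : orbE I ν g = ν) :
    ∃ z ∈ fiberBall I G ν, sliceMap I G ν (sliceProj I G ν ν, z) = g := by
  obtain ⟨u, hu, z, hz, h⟩ := exists_sliceMap_eq I hg
  have h1 := sliceProj_orbE_sliceMap I hu hz
  rw [h, hν] at h1
  exact ⟨z, hz, by rw [h1, h]⟩

end Slice

/-! ### The manifold `G / G_ν` -/

section OrbitSpace

variable {E : Type*} [NormedAddCommGroup E] [NormedSpace ℝ E]
  {H : Type*} [TopologicalSpace H] (I : ModelWithCorners ℝ E H)
  {G : Type*} [TopologicalSpace G] [ChartedSpace H G] [Group G] [LieGroup I ∞ G]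
  [I.Boundaryless] [FiniteDimensional ℝ E]

variable (G) in
/-- The isotropy group of a covector on the model space. -/
def isoE (ν : E →L[ℝ] ℝ) : Subgroup G := isotropyGroup I (G := G) ν

variable (G) in
/-- The space `G / G_ν`. -/
abbrev OrbitSpace (ν : E →L[ℝ] ℝ) : Type _ := G ⧸ isoE I G ν

lemma mem_isoE {ν : E →L[ℝ] ℝ} {g : G} : g ∈ isoE I G ν ↔ orbE I ν g = ν := Iff.rfl

variable (G) in
/-- The projection `G → G / G_ν`. -/
def orbitProj (ν : E →L[ℝ] ℝ) (g : G) : OrbitSpace I G ν := (g : G ⧸ isoE I G ν)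

variable (G) in
/-- The map `G / G_ν → 𝔤^*`. -/
def jE (ν : E →L[ℝ] ℝ) : OrbitSpace I G ν → (E →L[ℝ] ℝ) := orbitMap I (G := G) ν

lemma jE_proj (ν : E →L[ℝ] ℝ) (g : G) : jE I G ν (orbitProj I G ν g) = orbE I ν g := rfl

lemma smul_orbitProj (ν : E →L[ℝ] ℝ) (g h : G) :
    g • orbitProj I G ν h = orbitProj I G ν (g * h) := rfl

lemma orbitProj_surjective (ν : E →L[ℝ] ℝ) : Surjective (orbitProj I G ν) :=
  QuotientGroup.mk_surjective

lemma jE_smul (ν : E →L[ℝ] ℝ) (g : G) (x : OrbitSpace I G ν) :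
    jE I G ν (g • x) = coAdL I g (jE I G ν x) := by
  obtain ⟨h, rfl⟩ := orbitProj_surjective I ν x
  rw [smul_orbitProj, jE_proj, jE_proj, orbE_mul]

lemma orbitProj_eq_iff {ν : E →L[ℝ] ℝ} {g h : G} :
    orbitProj I G ν g = orbitProj I G ν h ↔ orbE I ν g = orbE I ν h := by
  unfold orbitProj
  rw [QuotientGroup.eq, mem_isoE]
  constructor
  · intro hm
    rw [← mul_inv_cancel_left g h, orbE_mul I ν g (g⁻¹ * h), hm]
    rfl
  · intro he
    rw [orbE_mul, ← he, ← orbE_mul, inv_mul_cancel, orbE_one]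

lemma jE_injective (ν : E →L[ℝ] ℝ) : Injective (jE I G ν) := by
  intro x y h
  obtain ⟨g, rfl⟩ := orbitProj_surjective I ν x
  obtain ⟨g', rfl⟩ := orbitProj_surjective I ν y
  exact (orbitProj_eq_iff I).2 h

lemma continuous_orbitProj (ν : E →L[ℝ] ℝ) : Continuous (orbitProj I G ν) :=
  QuotientGroup.continuous_mk

lemma isOpenMap_orbitProj (ν : E →L[ℝ] ℝ) : IsOpenMap (orbitProj I G ν) := by
  have : IsTopologicalGroup G := topologicalGroup_of_lieGroup I ∞
  exact QuotientGroup.isOpenMap_coe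

lemma continuous_jE (ν : E →L[ℝ] ℝ) : Continuous (jE I G ν) :=
  (QuotientGroup.isQuotientMap_mk (isoE I G ν)).continuous_iff.2 (contMDiff_orbE I ν).continuous

/-- Points are separated by the continuous injection into the normed space `𝔤^*`. -/
lemma t2Space_orbitSpace (ν : E →L[ℝ] ℝ) : T2Space (OrbitSpace I G ν) :=
  .of_injective_continuous (jE_injective I ν) (continuous_jE I ν)

/-- The slice through the identity, transverse to the isotropy group. -/
def sliceSection (ν : E →L[ℝ] ℝ) (u : OrbitModel I G ν) : G := sliceMap I G ν (u, 0)

lemma contMDiffAt_sliceSection {ν : E →L[ℝ] ℝ} {u : OrbitModel I G ν}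
    (hu : u ∈ sliceBall I G ν) :
    ContMDiffAt 𝓘(ℝ, OrbitModel I G ν) I ∞ (sliceSection I ν : OrbitModel I G ν → G) u :=
  (contMDiffAt_sliceMap I hu (zero_mem_fiberBall I ν)).comp u
    (contDiff_id.prodMk contDiff_const).contMDiff.contMDiffAt

lemma sliceProj_sliceSection {ν : E →L[ℝ] ℝ} {u : OrbitModel I G ν} (hu : u ∈ sliceBall I G ν) :
    sliceProj I G ν (orbE I ν (sliceSection I ν u : G)) = u :=
  sliceProj_orbE_sliceMap I hu (zero_mem_fiberBall I ν)

/-- The charts of `G / G_ν`. -/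
def orbitChart (ν : E →L[ℝ] ℝ) (h : G) :
    OpenPartialHomeomorph (OrbitSpace I G ν) (OrbitModel I G ν) where
  -- Translation by `h⁻¹` brings a neighbourhood of `h G_ν` to the base coset, where the first slice
  -- coordinate is available.
  toFun x := sliceProj I G ν (jE I G ν (h⁻¹ • x))
  invFun u := orbitProj I G ν (h * sliceSection I ν u)
  source := (fun x => h⁻¹ • x) ⁻¹' (orbitProj I G ν '' sliceNhd I G ν)
  target := sliceBall I G ν
  map_source' := by
    rintro x ⟨g, hg, hx⟩
    obtain ⟨u, hu, z, hz, rfl⟩ := exists_sliceMap_eq I hg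
    replace hx : h⁻¹ • x = orbitProj I G ν (sliceMap I G ν (u, z)) := hx.symm
    rw [hx, jE_proj, sliceProj_orbE_sliceMap I hu hz]
    exact hu
  map_target' := by
    intro u hu
    refine ⟨_, sliceMap_mem I hu (zero_mem_fiberBall I ν), ?_⟩
    change _ = h⁻¹ • orbitProj I G ν _
    rw [smul_orbitProj, inv_mul_cancel_left]
    rfl
  left_inv' := by
    rintro x ⟨g, hg, hx⟩
    obtain ⟨u, hu, z, hz, rfl⟩ := exists_sliceMap_eq I hg
    replace hx : h⁻¹ • x = orbitProj I G ν (sliceMap I G ν (u, z)) := hx.symm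
    -- Replacing `z` by `0` does not change the coset.
    rw [hx, jE_proj, sliceProj_orbE_sliceMap I hu hz, ← smul_orbitProj, sliceSection,
      (orbitProj_eq_iff I).2 (orbE_sliceMap_eq I hu hz).symm, ← hx, smul_inv_smul]
  right_inv' := by
    intro u hu
    rw [smul_orbitProj, inv_mul_cancel_left, jE_proj, sliceProj_sliceSection I hu]
  open_source := by
    have : IsTopologicalGroup G := topologicalGroup_of_lieGroup I ∞
    exact (isOpenMap_orbitProj I ν _ (isOpen_sliceNhd I ν)).preimage (continuous_const_smul _)
  open_target := isOpen_sliceBall I ν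
  continuousOn_toFun := by
    have : IsTopologicalGroup G := topologicalGroup_of_lieGroup I ∞
    exact ((sliceProj I G ν).continuous.comp
      ((continuous_jE I ν).comp (continuous_const_smul _))).continuousOn
  continuousOn_invFun := by
    have : IsTopologicalGroup G := topologicalGroup_of_lieGroup I ∞
    intro u hu
    refine ContinuousAt.continuousWithinAt ?_
    exact (continuous_orbitProj I ν).continuousAt.comp
      (continuousAt_const.mul (contMDiffAt_sliceSection I hu).continuousAt)

/-- In this form a chart is a continuous linear map after `jE`; questions about charts become
questions about `orbE`. -/
lemma orbitChart_apply (ν : E →L[ℝ] ℝ) (h : G) (x : OrbitSpace I G ν) :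
    orbitChart I ν h x = sliceProj I G ν (coAdL I h⁻¹ (jE I G ν x)) := by
  rw [← jE_smul]
  rfl

lemma mem_orbitChart_source (ν : E →L[ℝ] ℝ) (h : G) :
    orbitProj I G ν h ∈ (orbitChart I ν h).source := by
  refine ⟨1, one_mem_sliceNhd I ν, ?_⟩
  change _ = h⁻¹ • orbitProj I G ν h
  rw [smul_orbitProj, inv_mul_cancel]

/-- The manifold structure of `G / G_ν`. -/
instance orbitChartedSpace (ν : E →L[ℝ] ℝ) :
    ChartedSpace (OrbitModel I G ν) (OrbitSpace I G ν) where
  atlas := range (orbitChart I ν)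
  chartAt x := orbitChart I ν (surjInv (orbitProj_surjective I ν) x)
  mem_chart_source x := by
    have h := mem_orbitChart_source I ν (surjInv (orbitProj_surjective (G := G) I ν) x)
    rwa [surjInv_eq (orbitProj_surjective (G := G) I ν) x] at h
  chart_mem_atlas x := ⟨_, rfl⟩

lemma contDiffAt_sliceProj_orbE {ν : E →L[ℝ] ℝ} (h : G) {u : OrbitModel I G ν}
    (hu : u ∈ sliceBall I G ν) :
    ContDiffAt ℝ ∞ (fun u => orbE I ν (h * sliceSection I ν u)) u :=
  ((contMDiff_orbE I ν).contMDiffAt.comp u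
    (contMDiffAt_const.mul (contMDiffAt_sliceSection I hu))).contDiffAt

/-- A transition map is a linear map after `orbE` along a translated slice, so it is smooth on the
whole slice ball. -/
instance isManifold_orbitSpace (ν : E →L[ℝ] ℝ) :
    IsManifold 𝓘(ℝ, OrbitModel I G ν) ∞ (OrbitSpace I G ν) := by
  refine isManifold_of_contDiffOn _ _ _ ?_
  rintro _ _ ⟨h, rfl⟩ ⟨h', rfl⟩
  intro u hu
  have hu' : u ∈ sliceBall I G ν := hu.1.1
  refine ContDiffAt.contDiffWithinAt ?_
  have h1 : ContDiffAt ℝ ∞ (fun u : OrbitModel I G ν =>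
      sliceProj I G ν (coAdL I h'⁻¹ (orbE I ν (h * sliceSection I ν u)))) u :=
    ((sliceProj I G ν).comp (coAdL I h'⁻¹)).contDiff.contDiffAt.comp u
      (contDiffAt_sliceProj_orbE I h hu')
  refine h1.congr_of_eventuallyEq (Filter.Eventually.of_forall fun w => ?_)
  exact orbitChart_apply I ν h' ((orbitChart I ν h).symm w)

lemma contMDiffAt_orbitChart {ν : E →L[ℝ] ℝ} (h : G) {x : OrbitSpace I G ν}
    (hx : x ∈ (orbitChart I ν h).source) :
    ContMDiffAt 𝓘(ℝ, OrbitModel I G ν) 𝓘(ℝ, OrbitModel I G ν) ∞ (orbitChart I ν h) x :=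
  contMDiffAt_of_mem_maximalAtlas
    (IsManifold.subset_maximalAtlas (show orbitChart I ν h ∈ atlas _ _ from ⟨h, rfl⟩)) hx

lemma contMDiffAt_orbitChart_symm {ν : E →L[ℝ] ℝ} (h : G) {u : OrbitModel I G ν}
    (hu : u ∈ sliceBall I G ν) :
    ContMDiffAt 𝓘(ℝ, OrbitModel I G ν) 𝓘(ℝ, OrbitModel I G ν) ∞ (orbitChart I ν h).symm u :=
  contMDiffAt_symm_of_mem_maximalAtlas
    (IsManifold.subset_maximalAtlas (show orbitChart I ν h ∈ atlas _ _ from ⟨h, rfl⟩)) hu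

/-- The projection `G → G / G_ν` is smooth. -/
lemma contMDiff_orbitProj (ν : E →L[ℝ] ℝ) :
    ContMDiff I 𝓘(ℝ, OrbitModel I G ν) ∞ (orbitProj I G ν) := by
  intro g
  have hs := mem_orbitChart_source I ν g
  have h1 : ContMDiffAt I 𝓘(ℝ, OrbitModel I G ν) ∞
      (fun h : G => sliceProj I G ν (coAdL I g⁻¹ (orbE I ν h))) g :=
    ((sliceProj I G ν).comp (coAdL I g⁻¹)).contDiff.contMDiff.contMDiffAt.comp g
      (contMDiff_orbE I ν).contMDiffAt
  have h2 : ∀ h : G, sliceProj I G ν (coAdL I g⁻¹ (orbE I ν h))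
      = orbitChart I ν g (orbitProj I G ν h) := fun h => by
    rw [orbitChart_apply, jE_proj]
  have h3 : sliceProj I G ν (coAdL I g⁻¹ (orbE I ν g)) ∈ sliceBall I G ν := by
    rw [h2]
    exact (orbitChart I ν g).map_source hs
  -- Near `g` the projection is an inverse chart after a linear map of `orbE`.
  refine ((contMDiffAt_orbitChart_symm I g h3).comp g h1).congr_of_eventuallyEq ?_
  filter_upwards [(continuous_orbitProj I ν).continuousAt.eventually
    ((orbitChart I ν g).open_source.mem_nhds hs)] with h hh
  rw [comp_apply, h2, (orbitChart I ν g).left_inv hh]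

/-- A local section of the projection `G → G / G_ν` through `g`. -/
def orbitSection (ν : E →L[ℝ] ℝ) (g : G) (x : OrbitSpace I G ν) : G :=
  g * sliceSection I ν (orbitChart I ν g x)

lemma orbitSection_proj (ν : E →L[ℝ] ℝ) (g : G) :
    orbitSection I ν g (orbitProj I G ν g) = g := by
  rw [orbitSection, orbitChart_apply, jE_proj, ← orbE_mul, inv_mul_cancel, orbE_one,
    sliceSection, sliceMap_base, mul_one]

lemma orbitProj_orbitSection {ν : E →L[ℝ] ℝ} (g : G) {x : OrbitSpace I G ν}
    (hx : x ∈ (orbitChart I ν g).source) : orbitProj I G ν (orbitSection I ν g x) = x :=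
  (orbitChart I ν g).left_inv hx

lemma contMDiffAt_orbitSection {ν : E →L[ℝ] ℝ} (g : G) {x : OrbitSpace I G ν}
    (hx : x ∈ (orbitChart I ν g).source) :
    ContMDiffAt 𝓘(ℝ, OrbitModel I G ν) I ∞ (orbitSection I ν g) x :=
  contMDiffAt_const.mul ((contMDiffAt_sliceSection I ((orbitChart I ν g).map_source hx)).comp x
    (contMDiffAt_orbitChart I g hx))

lemma tderiv_orbitProj_comp_section (ν : E →L[ℝ] ℝ) (g : G) :
    (tderiv I 𝓘(ℝ, OrbitModel I G ν) (orbitProj I G ν) g).comp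
      (tderiv 𝓘(ℝ, OrbitModel I G ν) I (orbitSection I ν g) (orbitProj I G ν g))
      = ContinuousLinearMap.id ℝ _ := by
  have hs := mem_orbitChart_source I ν g
  have h := tderiv_comp 𝓘(ℝ, OrbitModel I G ν) I 𝓘(ℝ, OrbitModel I G ν) (g := orbitProj I G ν)
    (f := orbitSection I ν g) (orbitProj I G ν g) ((contMDiff_orbitProj I ν).mdiff _)
    (contMDiffAt_orbitSection I g hs).mdiff
  rw [orbitSection_proj] at h
  rw [← h, ← tderiv_id 𝓘(ℝ, OrbitModel I G ν) (orbitProj I G ν g)]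
  refine Filter.EventuallyEq.tderiv_eq ?_
  filter_upwards [(orbitChart I ν g).open_source.mem_nhds hs] with x hx
  exact orbitProj_orbitSection I g hx

lemma tderiv_orbitProj_surjective (ν : E →L[ℝ] ℝ) (g : G) :
    Surjective (tderiv I 𝓘(ℝ, OrbitModel I G ν) (orbitProj I G ν) g) := fun w =>
  ⟨_, congrArg (fun L : OrbitModel I G ν →L[ℝ] OrbitModel I G ν => L w)
    (tderiv_orbitProj_comp_section I ν g)⟩

/-- Locally this map is `orbE` after a smooth section of the projection. -/
lemma contMDiff_jE (ν : E →L[ℝ] ℝ) :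
    ContMDiff 𝓘(ℝ, OrbitModel I G ν) 𝓘(ℝ, E →L[ℝ] ℝ) ∞ (jE I G ν) := by
  intro x
  obtain ⟨g, rfl⟩ := orbitProj_surjective I ν x
  have hs := mem_orbitChart_source I ν g
  refine ((contMDiff_orbE I ν).contMDiffAt.comp (orbitProj I G ν g)
    (contMDiffAt_orbitSection I g hs)).congr_of_eventuallyEq ?_
  filter_upwards [(orbitChart I ν g).open_source.mem_nhds hs] with y hy
  rw [comp_apply, ← jE_proj, orbitProj_orbitSection I g hy]

lemma tderiv_jE_proj (ν : E →L[ℝ] ℝ) (g : G) (v : E) :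
    tderiv 𝓘(ℝ, OrbitModel I G ν) 𝓘(ℝ, E →L[ℝ] ℝ) (jE I G ν) (orbitProj I G ν g)
      (tderiv I 𝓘(ℝ, OrbitModel I G ν) (orbitProj I G ν) g v)
      = coadE I (G := G) (adE I g (mcE I g v)) (orbE I ν g) := by
  rw [← tderiv_orbE_eq_coadE]
  exact (congrArg (fun L : E →L[ℝ] (E →L[ℝ] ℝ) => L v)
    (tderiv_comp I 𝓘(ℝ, OrbitModel I G ν) 𝓘(ℝ, E →L[ℝ] ℝ) g
      ((contMDiff_jE I ν).mdiff _) ((contMDiff_orbitProj I ν).mdiff _))).symm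

/-- The map `G / G_ν → 𝔤^*` is an immersion. -/
lemma tderiv_jE_injective (ν : E →L[ℝ] ℝ) (x : OrbitSpace I G ν) :
    Injective (tderiv 𝓘(ℝ, OrbitModel I G ν) 𝓘(ℝ, E →L[ℝ] ℝ) (jE I G ν) x) := by
  obtain ⟨g, rfl⟩ := orbitProj_surjective I ν x
  have hs := mem_orbitChart_source I ν g
  have hb := (orbitChart I ν g).map_source hs
  -- The derivative of the chart factors through that of `jE`; as a chart is invertible, the
  -- derivative of `jE` has a left inverse.
  have h1 : tderiv 𝓘(ℝ, OrbitModel I G ν) 𝓘(ℝ, OrbitModel I G ν) (orbitChart I ν g)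
      (orbitProj I G ν g) = ((sliceProj I G ν).comp (coAdL I g⁻¹)).comp
        (tderiv 𝓘(ℝ, OrbitModel I G ν) 𝓘(ℝ, E →L[ℝ] ℝ) (jE I G ν) (orbitProj I G ν g)) := by
    have h := tderiv_comp 𝓘(ℝ, OrbitModel I G ν) 𝓘(ℝ, E →L[ℝ] ℝ) 𝓘(ℝ, OrbitModel I G ν)
      (g := fun μ => ((sliceProj I G ν).comp (coAdL I g⁻¹)) μ) (f := jE I G ν)
      (orbitProj I G ν g) ((ContinuousLinearMap.contDiff _).contMDiff.mdiff _)
      ((contMDiff_jE I ν).mdiff _)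
    rw [tderiv_eq_fderiv, ContinuousLinearMap.fderiv] at h
    rw [← h]
    congr 1
    funext y
    exact orbitChart_apply I ν g y
  have h2 := tderiv_comp 𝓘(ℝ, OrbitModel I G ν) 𝓘(ℝ, OrbitModel I G ν) 𝓘(ℝ, OrbitModel I G ν)
    (g := (orbitChart I ν g).symm) (f := orbitChart I ν g) (orbitProj I G ν g)
    (contMDiffAt_orbitChart_symm I g hb).mdiff (contMDiffAt_orbitChart I g hs).mdiff
  have h3 : tderiv 𝓘(ℝ, OrbitModel I G ν) 𝓘(ℝ, OrbitModel I G ν)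
      (fun y => (orbitChart I ν g).symm (orbitChart I ν g y)) (orbitProj I G ν g)
      = ContinuousLinearMap.id ℝ _ := by
    rw [← tderiv_id 𝓘(ℝ, OrbitModel I G ν) (orbitProj I G ν g)]
    refine Filter.EventuallyEq.tderiv_eq ?_
    filter_upwards [(orbitChart I ν g).open_source.mem_nhds hs] with y hy
    exact (orbitChart I ν g).left_inv hy
  rw [h3, h1] at h2
  intro v w hvw
  have h4 : ∀ v, v = tderiv 𝓘(ℝ, OrbitModel I G ν) 𝓘(ℝ, OrbitModel I G ν) (orbitChart I ν g).symm
      (orbitChart I ν g (orbitProj I G ν g)) (((sliceProj I G ν).comp (coAdL I g⁻¹))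
        (tderiv 𝓘(ℝ, OrbitModel I G ν) 𝓘(ℝ, E →L[ℝ] ℝ) (jE I G ν) (orbitProj I G ν g) v)) :=
    fun v => congrArg (fun L : OrbitModel I G ν →L[ℝ] OrbitModel I G ν => L v) h2
  rw [h4 v, h4 w, hvw]

lemma range_tderiv_jE (ν : E →L[ℝ] ℝ) (x : OrbitSpace I G ν) :
    range (tderiv 𝓘(ℝ, OrbitModel I G ν) 𝓘(ℝ, E →L[ℝ] ℝ) (jE I G ν) x)
      = range fun ξ : E => coadE I (G := G) ξ (jE I G ν x) := by
  obtain ⟨g, rfl⟩ := orbitProj_surjective I ν x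
  ext μ
  constructor
  · rintro ⟨v, rfl⟩
    obtain ⟨w, rfl⟩ := tderiv_orbitProj_surjective I ν g v
    exact ⟨_, (tderiv_jE_proj I ν g w).symm⟩
  · rintro ⟨ξ, rfl⟩
    obtain ⟨w, hw⟩ := mcE_surjective I g (adE I g⁻¹ ξ)
    refine ⟨_, (tderiv_jE_proj I ν g w).trans ?_⟩
    rw [hw, adE_adE_inv]
    rfl

end OrbitSpace

/-! ### The symplectic form on `G / G_ν` -/

section OrbitForm

variable {E : Type*} [NormedAddCommGroup E] [NormedSpace ℝ E]
  {H : Type*} [TopologicalSpace H] (I : ModelWithCorners ℝ E H)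
  {G : Type*} [TopologicalSpace G] [ChartedSpace H G] [Group G] [LieGroup I ∞ G]
  [I.Boundaryless] [FiniteDimensional ℝ E]

lemma alternating_two_ext {F : Type*} [NormedAddCommGroup F] [NormedSpace ℝ F]
    {η η' : F [⋀^Fin 2]→L[ℝ] ℝ} (h : ∀ v w, η ![v, w] = η' ![v, w]) : η = η' := by
  ext v
  rw [show v = ![v 0, v 1] by ext i; fin_cases i <;> rfl]
  exact h _ _

lemma alternating_comp_two {F F' : Type*} [NormedAddCommGroup F] [NormedSpace ℝ F]
    [NormedAddCommGroup F'] [NormedSpace ℝ F'] (η : F' [⋀^Fin 2]→L[ℝ] ℝ) (A : F →L[ℝ] F')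
    (v w : F) : η.compContinuousLinearMap A ![v, w] = η ![A v, A w] := by
  change η (A ∘ ![v, w]) = _
  congr 1
  ext i
  fin_cases i <;> rfl

lemma alternating_comp_surjective_injective {k : ℕ} {F F' : Type*} [NormedAddCommGroup F]
    [NormedSpace ℝ F] [NormedAddCommGroup F'] [NormedSpace ℝ F'] {η η' : F' [⋀^Fin k]→L[ℝ] ℝ}
    {A : F →L[ℝ] F'} (hA : Surjective A)
    (h : η.compContinuousLinearMap A = η'.compContinuousLinearMap A) : η = η' := by
  ext v
  choose w hw using fun i => hA (v i)
  have h1 : v = A ∘ w := funext fun i => (hw i).symm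
  rw [h1]
  exact congrArg (fun ζ : F [⋀^Fin k]→L[ℝ] ℝ => ζ w) h

variable (G) in
/-- The Kirillov–Kostant–Souriau form on covectors on the model space. -/
def kksE (μ a b : E →L[ℝ] ℝ) : ℝ := kksForm I (G := G) μ a b

variable (G) in
lemma kksE_coadE (μ : E →L[ℝ] ℝ) (ξ ζ : E) :
    kksE I G μ (coadE I (G := G) ξ μ) (coadE I (G := G) ζ μ) = - μ (lieE I G ξ ζ) :=
  kksForm_coadInf I (G := G) μ ξ ζ

variable (G) in
/-- The exterior derivative of the left-invariant form with value `ν` at the identity. -/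
def dLeft (ν : E →L[ℝ] ℝ) : DiffForm I G 2 := DiffForm.d I (leftInvariantForm I (G := G) ν)

lemma smoothAt_dLeft (ν : E →L[ℝ] ℝ) (g : G) : DiffForm.SmoothAt I (dLeft I G ν) g :=
  (DiffForm.isSmooth_iff I).1 (isSmooth_leftInvariantForm I ν).d g

/-- The central identity: `dα_ν` is the Kirillov–Kostant–Souriau form pulled back under the orbit
map. It holds because `Ad_g` preserves brackets. -/
lemma val_dLeft (ν : E →L[ℝ] ℝ) (g : G) (v w : E) : DiffForm.val I (dLeft I G ν) g ![v, w]
    = kksE I G (orbE I ν g) (tderiv I 𝓘(ℝ, E →L[ℝ] ℝ) (orbE I ν) g v)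
      (tderiv I 𝓘(ℝ, E →L[ℝ] ℝ) (orbE I ν) g w) := by
  rw [tderiv_orbE_eq_coadE, tderiv_orbE_eq_coadE, kksE_coadE, ← adE_lieE]
  refine (val_d_leftInvariantForm I ν g v w).trans ?_
  congr 1
  change _ = ν (adE I g⁻¹ _)
  rw [adE_inv_adE]

/-- The right side does not involve `g`: all local sections pull `dα_ν` back to the same form, so
the pointwise choice of section in `orbitForm` is harmless. -/
lemma val_pullback_orbitSection (ν : E →L[ℝ] ℝ) (g : G) {x : OrbitSpace I G ν}
    (hx : x ∈ (orbitChart I ν g).source) (v w : OrbitModel I G ν) :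
    DiffForm.val 𝓘(ℝ, OrbitModel I G ν)
      (DiffForm.pullback 𝓘(ℝ, OrbitModel I G ν) I (orbitSection I ν g) (dLeft I G ν)) x ![v, w]
    = kksE I G (jE I G ν x)
      (tderiv 𝓘(ℝ, OrbitModel I G ν) 𝓘(ℝ, E →L[ℝ] ℝ) (jE I G ν) x v)
      (tderiv 𝓘(ℝ, OrbitModel I G ν) 𝓘(ℝ, E →L[ℝ] ℝ) (jE I G ν) x w) := by
  rw [DiffForm.val_pullback, alternating_comp_two, val_dLeft]
  have h := tderiv_comp 𝓘(ℝ, OrbitModel I G ν) I 𝓘(ℝ, E →L[ℝ] ℝ) x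
    ((contMDiff_orbE I ν).mdiff _) (contMDiffAt_orbitSection I g hx).mdiff
  have h1 : (fun y => orbE I ν (orbitSection I ν g y)) =ᶠ[𝓝 x] jE I G ν := by
    filter_upwards [(orbitChart I ν g).open_source.mem_nhds hx] with y hy
    rw [← jE_proj, orbitProj_orbitSection I g hy]
  rw [h1.tderiv_eq] at h
  rw [h, ← h1.eq_of_nhds]
  rfl

variable (G) in
/-- The form on `G / G_ν` to which `dα_ν` projects. -/
def orbitForm (ν : E →L[ℝ] ℝ) : DiffForm 𝓘(ℝ, OrbitModel I G ν) (OrbitSpace I G ν) 2 :=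
  fun x => DiffForm.pullback 𝓘(ℝ, OrbitModel I G ν) I
    (orbitSection I ν (surjInv (orbitProj_surjective (G := G) I ν) x)) (dLeft I G ν) x

lemma val_orbitForm (ν : E →L[ℝ] ℝ) (x : OrbitSpace I G ν) (v w : OrbitModel I G ν) :
    DiffForm.val 𝓘(ℝ, OrbitModel I G ν) (orbitForm I G ν) x ![v, w]
    = kksE I G (jE I G ν x)
      (tderiv 𝓘(ℝ, OrbitModel I G ν) 𝓘(ℝ, E →L[ℝ] ℝ) (jE I G ν) x v)
      (tderiv 𝓘(ℝ, OrbitModel I G ν) 𝓘(ℝ, E →L[ℝ] ℝ) (jE I G ν) x w) := by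
  have h := mem_orbitChart_source I ν (surjInv (orbitProj_surjective (G := G) I ν) x)
  rw [surjInv_eq (orbitProj_surjective (G := G) I ν) x] at h
  rw [← val_pullback_orbitSection I ν _ h v w]
  rfl

lemma pullback_orbitForm (ν : E →L[ℝ] ℝ) :
    DiffForm.pullback I 𝓘(ℝ, OrbitModel I G ν) (orbitProj I G ν) (orbitForm I G ν)
      = dLeft I G ν := by
  funext g
  refine alternating_two_ext (F := E) fun v w => ?_
  change DiffForm.val I (DiffForm.pullback I 𝓘(ℝ, OrbitModel I G ν) (orbitProj I G ν)
    (orbitForm I G ν)) g ![v, w] = DiffForm.val I (dLeft I G ν) g ![v, w]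
  rw [DiffForm.val_pullback, alternating_comp_two, val_orbitForm, val_dLeft, tderiv_jE_proj,
    tderiv_jE_proj, tderiv_orbE_eq_coadE, tderiv_orbE_eq_coadE, jE_proj]

/-- A form on `G / G_ν` is determined by its pullback to `G`. -/
lemma pullback_orbitProj_injective (ν : E →L[ℝ] ℝ) {k : ℕ}
    {σ σ' : DiffForm 𝓘(ℝ, OrbitModel I G ν) (OrbitSpace I G ν) k}
    {g : G} (h : DiffForm.pullback I 𝓘(ℝ, OrbitModel I G ν) (orbitProj I G ν) σ g
      = DiffForm.pullback I 𝓘(ℝ, OrbitModel I G ν) (orbitProj I G ν) σ' g) :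
    σ (orbitProj I G ν g) = σ' (orbitProj I G ν g) :=
  alternating_comp_surjective_injective (F := E) (F' := OrbitModel I G ν)
    (tderiv_orbitProj_surjective I ν g) h

lemma isSmooth_orbitForm (ν : E →L[ℝ] ℝ) :
    (orbitForm I G ν).IsSmooth 𝓘(ℝ, OrbitModel I G ν) := by
  refine (DiffForm.isSmooth_iff _).2 fun x => ?_
  obtain ⟨g, rfl⟩ := orbitProj_surjective I ν x
  have hs := mem_orbitChart_source I ν g
  -- Near `π g` the form agrees with its pullback description by the single section through `g`.
  refine ((smoothAt_dLeft I ν _).pullback (contMDiffAt_orbitSection I g hs)).congr ?_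
  filter_upwards [(orbitChart I ν g).open_source.mem_nhds hs] with y hy
  exact alternating_two_ext (F := OrbitModel I G ν) fun v w =>
    (val_pullback_orbitSection I ν g hy v w).trans (val_orbitForm I ν y v w).symm

/-- Closedness can be tested after pullback to `G`, where it is `d(dα_ν) = 0`. A vector in the
kernel lifts to `ker dα_ν`, which is killed by the derivative of the orbit map; since `jE` is an
immersion the vector is zero. -/
lemma isSymplectic_orbitForm (ν : E →L[ℝ] ℝ) :
    DiffForm.IsSymplectic 𝓘(ℝ, OrbitModel I G ν) (orbitForm I G ν) := by
  refine ⟨⟨isSmooth_orbitForm I ν, fun x => ?_⟩, fun x v hv => ?_⟩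
  · obtain ⟨g, rfl⟩ := orbitProj_surjective I ν x
    refine pullback_orbitProj_injective I ν (σ' := fun _ => 0) ?_
    rw [← DiffForm.d_pullback (contMDiff_orbitProj I ν g)
      ((DiffForm.isSmooth_iff _).1 (isSmooth_orbitForm I ν) _), pullback_orbitForm]
    exact (isSmooth_leftInvariantForm I ν).d_d g
  · obtain ⟨g, rfl⟩ := orbitProj_surjective I ν x
    obtain ⟨a, rfl⟩ := tderiv_orbitProj_surjective I ν g v
    have h1 : a ∈ DiffForm.kerAt I (dLeft I G ν) g := by
      intro (b : E)
      change DiffForm.val I (dLeft I G ν) g ![a, b] = 0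
      rw [← pullback_orbitForm, DiffForm.val_pullback, alternating_comp_two]
      exact hv _
    have h2 : tderiv I 𝓘(ℝ, E →L[ℝ] ℝ) (orbE I ν) g a = 0 := by
      refine (tderiv_orbE_eq_zero_iff I ν g a).2 ?_
      have h3 := kerAt_d_leftInvariantForm I ν g
      change DiffForm.kerAt I (dLeft I G ν) g = _ at h3
      rw [h3] at h1
      exact h1
    refine tderiv_jE_injective I ν (orbitProj I G ν g) ?_
    rw [tderiv_jE_proj, ← tderiv_orbE_eq_coadE, h2]
    exact (map_zero (tderiv 𝓘(ℝ, OrbitModel I G ν) 𝓘(ℝ, E →L[ℝ] ℝ) (jE I G ν) _)).symm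

end OrbitForm

/-! ### Curves with prescribed velocity -/

section Curves

lemma exists_small_curve {F : Type*} [NormedAddCommGroup F] [NormedSpace ℝ F] (v : F) {r : ℝ}
    (hr : 0 < r) : ∃ a : ℝ → F, ContDiff ℝ ∞ a ∧ a 0 = 0 ∧ fderiv ℝ a 0 1 = v ∧
      ∀ t, a t ∈ Metric.ball (0 : F) r := by
  have hv : 0 < ‖v‖ + 1 := by positivity
  set ε := r / (‖v‖ + 1) with hε
  have hε0 : 0 < ε := div_pos hr hv
  -- The curve must be defined for all real times yet stay in the ball. The sine bounds it by `ε ‖v‖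
  -- < r`, and the factor `ε⁻¹` restores the velocity `v`.
  refine ⟨fun t => (ε * Real.sin (ε⁻¹ * t)) • v, ?_, by simp, ?_, fun t => ?_⟩
  · exact (contDiff_const.mul (Real.contDiff_sin.comp (contDiff_const.mul contDiff_id))).smul
      contDiff_const
  · have h1 : HasDerivAt (fun t : ℝ => ε⁻¹ * t) ε⁻¹ 0 := by
      simpa using (hasDerivAt_id (0 : ℝ)).const_mul ε⁻¹
    have h2 : HasDerivAt (fun t : ℝ => (ε * Real.sin (ε⁻¹ * t)) • v)
        ((ε * (Real.cos (ε⁻¹ * 0) * ε⁻¹)) • v) 0 := (h1.sin.const_mul ε).smul_const v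
    rw [mul_zero, Real.cos_zero, one_mul, mul_inv_cancel₀ hε0.ne', one_smul] at h2
    rw [h2.hasFDerivAt.fderiv]
    simp
  · rw [mem_ball_zero_iff, norm_smul, Real.norm_eq_abs, abs_mul, abs_of_pos hε0]
    calc ε * |Real.sin (ε⁻¹ * t)| * ‖v‖ ≤ ε * 1 * ‖v‖ := by
          gcongr
          exact Real.abs_sin_le_one _
      _ < ε * (‖v‖ + 1) := by nlinarith
      _ = r := div_mul_cancel₀ r hv.ne'

variable {E : Type*} [NormedAddCommGroup E] [NormedSpace ℝ E]
  {H : Type*} [TopologicalSpace H] (I : ModelWithCorners ℝ E H)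
  {M : Type*} [TopologicalSpace M] [ChartedSpace H M]

lemma mem_tangentVectorsTo_of_curve {S : Set M} {x : M} {v : E} {γ : ℝ → M}
    (hγ : ContMDiff 𝓘(ℝ, ℝ) I ∞ γ) (hS : ∀ t, γ t ∈ S) (h0 : γ 0 = x)
    (hv : tderiv 𝓘(ℝ, ℝ) I γ 0 1 = v) : v ∈ tangentVectorsTo I S x := by
  subst h0 hv
  exact ⟨γ, hγ, hS, rfl⟩

lemma exists_curve_of_mem_tangentVectorsTo {S : Set M} {x : M} {v : E}
    (h : v ∈ tangentVectorsTo I S x) : ∃ γ : ℝ → M, ContMDiff 𝓘(ℝ, ℝ) I ∞ γ ∧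
      (∀ t, γ t ∈ S) ∧ γ 0 = x ∧ tderiv 𝓘(ℝ, ℝ) I γ 0 1 = v := by
  obtain ⟨γ, hγ, hS, h⟩ := h
  exact ⟨γ, hγ, hS, congrArg (fun p : TangentBundle I M => p.proj) h,
    congrArg (fun p : TangentBundle I M => (p.snd : E)) h⟩

lemma exists_curve_through [I.Boundaryless] [IsManifold I ∞ M] (x : M) (v : E) :
    ∃ γ : ℝ → M, ContMDiff 𝓘(ℝ, ℝ) I ∞ γ ∧ γ 0 = x ∧ tderiv 𝓘(ℝ, ℝ) I γ 0 1 = v := by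
  obtain ⟨r, hr, hb⟩ := Metric.isOpen_iff.1 (isOpen_extChartAt_target (I := I) x)
    _ (mem_extChartAt_target x)
  obtain ⟨a, ha, ha0, hav, har⟩ := exists_small_curve v hr
  have hmem : ∀ t, extChartAt I x x + a t ∈ (extChartAt I x).target := fun t => hb (by
    rw [mem_ball_iff_norm, add_sub_cancel_left]
    exact mem_ball_zero_iff.1 (har t))
  have ha' : ContDiff ℝ ∞ fun t => extChartAt I x x + a t := contDiff_const.add ha
  refine ⟨fun t => (extChartAt I x).symm (extChartAt I x x + a t), fun t =>
    (contMDiffAt_extChartAt_symm_of_mem I (hmem t)).comp t ha'.contMDiff.contMDiffAt, ?_, ?_⟩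
  · simp [ha0]
  · rw [tderiv_comp 𝓘(ℝ, ℝ) 𝓘(ℝ, E) I (g := (extChartAt I x).symm) 0
      (contMDiffAt_extChartAt_symm_of_mem I (hmem 0)).mdiff (ha'.contMDiff.mdiff 0), ha0,
      add_zero, tderiv_extChartAt_symm_self, tderiv_eq_fderiv]
    change fderiv ℝ (fun t => extChartAt I x x + a t) 0 1 = v
    rw [fderiv_const_add, hav]

end Curves

/-! ### Smooth curves in the isotropy group and its cosets -/

section IsotropyCurves

variable {E : Type*} [NormedAddCommGroup E] [NormedSpace ℝ E]
  {H : Type*} [TopologicalSpace H] (I : ModelWithCorners ℝ E H)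
  {G : Type*} [TopologicalSpace G] [ChartedSpace H G] [Group G] [LieGroup I ∞ G]
  [I.Boundaryless] [FiniteDimensional ℝ E]

lemma contMDiff_sliceMap_curve {ν : E →L[ℝ] ℝ} {a : ℝ → sliceKer I G ν} (ha : ContDiff ℝ ∞ a)
    (hb : ∀ t, a t ∈ fiberBall I G ν) :
    ContMDiff 𝓘(ℝ, ℝ) I ∞ fun t => (sliceMap I G ν (sliceProj I G ν ν, a t) : G) := fun t =>
  (contMDiffAt_sliceMap I (mem_sliceBall I ν) (hb t)).comp (g := sliceMap I G ν) t
    (contDiff_const.prodMk ha).contMDiff.contMDiffAt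

/-- `𝔤_ν` is the Lie algebra of `G_ν`. -/
lemma mem_tangentVectorsTo_isoE_iff (ν : E →L[ℝ] ℝ) (ξ : E) :
    ξ ∈ tangentVectorsTo I (isoE I G ν : Set G) 1 ↔ coadL I G ν ξ = 0 := by
  constructor
  · intro h
    obtain ⟨γ, hγ, hS, h0, hv⟩ := exists_curve_of_mem_tangentVectorsTo I h
    have h1 := tderiv_comp 𝓘(ℝ, ℝ) I 𝓘(ℝ, E →L[ℝ] ℝ) (g := orbE I ν) (f := γ) 0
      ((contMDiff_orbE I ν).mdiff _) (hγ.mdiff 0)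
    have h2 : (fun t => orbE I ν (γ t)) = fun _ => ν := funext fun t => hS t
    rw [h2, tderiv_const, h0] at h1
    rw [← tderiv_orbE_one, ← hv]
    exact (congrArg (fun L : ℝ →L[ℝ] (E →L[ℝ] ℝ) => L 1) h1).symm
  · intro h
    -- A curve in the fibre ball with velocity `ξ` is carried by the slice coordinates into `G_ν`,
    -- with the same velocity at the identity.
    obtain ⟨a, ha, ha0, hav, har⟩ := exists_small_curve
      (⟨ξ, (mem_sliceKer_iff I ν ξ).2 h⟩ : sliceKer I G ν) (slice I G ν).radius_pos
    refine mem_tangentVectorsTo_of_curve I (contMDiff_sliceMap_curve I ha har)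
      (fun t => orbE_sliceMap_fiber I (har t)) (by rw [ha0, sliceMap_base]) ?_
    have hp : ContDiff ℝ ∞ fun t => (sliceProj I G ν ν, a t) := contDiff_const.prodMk ha
    rw [tderiv_comp 𝓘(ℝ, ℝ) 𝓘(ℝ, OrbitModel I G ν × sliceKer I G ν) I (g := sliceMap I G ν) 0
      (contMDiffAt_sliceMap I (mem_sliceBall I ν) (har 0)).mdiff (hp.contMDiff.mdiff 0), ha0,
      tderiv_eq_fderiv]
    have h1 : fderiv ℝ (fun t => (sliceProj I G ν ν, a t)) 0 1 = (0, fderiv ℝ a 0 1) := by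
      rw [DifferentiableAt.fderiv_prodMk (by fun_prop)
        (ha.differentiable (by simp) 0)]
      simp
    rw [ContinuousLinearMap.comp_apply, h1, hav, tderiv_sliceMap_base]

/-- Points of `G_ν` near the identity are joined to the identity by smooth arcs in `G_ν`. -/
lemma exists_arc_in_isoE {ν : E →L[ℝ] ℝ} {g : G} (hg : g ∈ sliceNhd I G ν)
    (hν : orbE I ν g = ν) : ∃ γ : ℝ → G, ContMDiff 𝓘(ℝ, ℝ) I ∞ γ ∧ γ 0 = 1 ∧ γ 1 = g ∧
      ∀ t, orbE I ν (γ t) = ν := by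
  obtain ⟨z, hz, rfl⟩ := exists_sliceMap_fiber_eq I hg hν
  -- The segment from `0` to `z` is reparametrized so that it stays in the ball for all real times.
  have hb : ∀ t, Real.smoothTransition t • z ∈ fiberBall I G ν := fun t => by
    have hz' := mem_ball_zero_iff.1 hz
    refine mem_ball_zero_iff.2 (lt_of_le_of_lt ?_ hz')
    rw [norm_smul, Real.norm_of_nonneg (Real.smoothTransition.nonneg t)]
    exact mul_le_of_le_one_left (norm_nonneg z) (Real.smoothTransition.le_one t)
  have hs : ContDiff ℝ ∞ fun t => Real.smoothTransition t • z :=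
    Real.smoothTransition.contDiff.smul contDiff_const
  refine ⟨_, contMDiff_sliceMap_curve I hs hb, ?_, ?_, fun t => orbE_sliceMap_fiber I (hb t)⟩
  · rw [Real.smoothTransition.zero, zero_smul, sliceMap_base]
  · rw [Real.smoothTransition.one, one_smul]

/-- In the coset `x G_ν`, points near `x` are joined to `x` by smooth arcs in the coset. -/
lemma eventually_exists_arc (ν : E →L[ℝ] ℝ) (x : G) :
    ∀ᶠ y in 𝓝 x, orbE I ν y = orbE I ν x → ∃ γ : ℝ → G, ContMDiff 𝓘(ℝ, ℝ) I ∞ γ ∧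
      γ 0 = x ∧ γ 1 = y ∧ ∀ t, orbE I ν (γ t) = orbE I ν x := by
  have : IsTopologicalGroup G := topologicalGroup_of_lieGroup I ∞
  have h1 : ∀ᶠ y in 𝓝 x, x⁻¹ * y ∈ sliceNhd I G ν :=
    (continuous_const_mul x⁻¹).continuousAt.eventually ((isOpen_sliceNhd I ν).mem_nhds (by
      beta_reduce
      rw [inv_mul_cancel]
      exact one_mem_sliceNhd I ν))
  filter_upwards [h1] with y hy hν
  obtain ⟨γ, hγ, h0, h1, hγν⟩ := exists_arc_in_isoE I hy (by
    rw [orbE_mul, hν, ← orbE_mul, inv_mul_cancel, orbE_one])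
  refine ⟨fun t => x * γ t, contMDiff_mul_left.comp hγ, ?_, ?_, fun t => ?_⟩
  · beta_reduce
    rw [h0, mul_one]
  · beta_reduce
    rw [h1, mul_inv_cancel_left]
  · rw [orbE_mul, hγν]
    rfl

end IsotropyCurves

/-! ### The tangent bundle -/

section TangentBundle

variable {E : Type*} [NormedAddCommGroup E] [NormedSpace ℝ E]
  {H : Type*} [TopologicalSpace H] (I : ModelWithCorners ℝ E H)
  {M : Type*} [TopologicalSpace M] [ChartedSpace H M] [IsManifold I 1 M] [IsManifold I ∞ M]

variable (M) in
/-- The projection of the tangent bundle. -/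
def tangentProj (p : TangentBundle I M) : M := p.proj

lemma contMDiff_tangentProj : ContMDiff I.tangent I ∞ (tangentProj I M) :=
  Bundle.contMDiff_proj (TangentSpace I : M → Type _)

lemma contMDiff_tangent_zero :
    ContMDiff I I.tangent ∞ (fun x : M => (⟨x, 0⟩ : TangentBundle I M)) :=
  Bundle.contMDiff_zeroSection ℝ (TangentSpace I : M → Type _)

lemma contMDiff_fibre_curve (x : M) {a : ℝ → E} (ha : ContDiff ℝ ∞ a) :
    ContMDiff 𝓘(ℝ, ℝ) I.tangent ∞ (fun t => (⟨x, a t⟩ : TangentBundle I M)) := by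
  intro t
  refine Bundle.contMDiffAt_totalSpace.2 ⟨contMDiffAt_const, ?_⟩
  let e := trivializationAt E (TangentSpace I : M → Type _) x
  let A : E →L[ℝ] E := e.continuousLinearMapAt ℝ x
  have h : (fun t => (e ⟨x, a t⟩).2) = fun t => A (a t) := funext fun t =>
    (congrFun (e.coe_linearMapAt_of_mem (R := ℝ) (FiberBundle.mem_baseSet_trivializationAt' x))
      (a t)).symm
  change ContMDiffAt _ _ _ (fun t => (e ⟨x, a t⟩).2) t
  rw [h]
  exact (A.contDiff.comp ha).contMDiff.contMDiffAt

/-- Freezing the fibre coordinate of `p` in a trivialization gives a local section through `p`. -/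
lemma tderiv_tangentProj_surjective (p : TangentBundle I M) :
    Surjective (tderiv I.tangent I (tangentProj I M) p) := by
  let e := trivializationAt E (TangentSpace I : M → Type _) p.proj
  have hp : p.proj ∈ e.baseSet := FiberBundle.mem_baseSet_trivializationAt' p.proj
  let s : M → TangentBundle I M := fun x => e.toOpenPartialHomeomorph.symm (x, (e p).2)
  have hs : ContMDiffAt I I.tangent ∞ s p.proj := by
    have h1 : ContMDiffAt (I.prod 𝓘(ℝ, E)) I.tangent ∞ e.toOpenPartialHomeomorph.symm
        (p.proj, (e p).2) := (e.contMDiffOn_symm (IB := I) (n := ∞)).contMDiffAt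
      (e.open_target.mem_nhds (e.mem_target.2 hp))
    exact h1.comp p.proj (contMDiffAt_id.prodMk contMDiffAt_const)
  have hsp : s p.proj = p := e.symm_apply_mk_proj (e.mem_source.2 hp)
  have h1 := tderiv_comp I I.tangent I (g := tangentProj I M) (f := s) p.proj
    ((contMDiff_tangentProj I).mdiff _) hs.mdiff
  have h2 : (fun x => tangentProj I M (s x)) =ᶠ[𝓝 p.proj] fun x => x := by
    filter_upwards [e.open_baseSet.mem_nhds hp] with x hx
    exact e.proj_symm_apply (e.mem_target.2 hx)
  rw [h2.tderiv_eq, tderiv_id, hsp] at h1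
  exact fun w => ⟨_, (congrArg (fun L : E →L[ℝ] E => L w) h1).symm⟩

end TangentBundle

/-! ### The Lagrangian system -/

section Lagrangian

variable {E : Type*} [NormedAddCommGroup E] [NormedSpace ℝ E]
  {H : Type*} [TopologicalSpace H] (I : ModelWithCorners ℝ E H)
  {G : Type*} [TopologicalSpace G] [ChartedSpace H G] [Group G] [LieGroup I ∞ G]
  [I.Boundaryless] [FiniteDimensional ℝ E]

/-- On each fibre the Lagrangian is affine, with linear part `α_ν`. -/
lemma fiberDeriv_firstOrderLagrangian (ν : E →L[ℝ] ℝ) (V : G → ℝ) (p : TangentBundle I G) :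
    fiberDeriv I (firstOrderLagrangian I (G := G) ν V) p
      = leftInvariantCovector I (G := G) ν p.proj := by
  let A : E →L[ℝ] ℝ := ν.comp (mcE I p.proj)
  have h : ∀ x : E, fderiv ℝ (fun v : E => A v - V p.proj) x = A := fun x => by
    rw [fderiv_sub_const, ContinuousLinearMap.fderiv]
  exact h p.snd

lemma cartanOneForm_firstOrderLagrangian (ν : E →L[ℝ] ℝ) (V : G → ℝ) :
    cartanOneForm I (firstOrderLagrangian I (G := G) ν V)
      = DiffForm.pullback I.tangent I (tangentProj I G) (leftInvariantForm I (G := G) ν) := by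
  funext p
  unfold cartanOneForm
  simp only [fiberDeriv_firstOrderLagrangian]
  rfl

lemma lagrangianEnergy_firstOrderLagrangian (ν : E →L[ℝ] ℝ) (V : G → ℝ) :
    lagrangianEnergy I (firstOrderLagrangian I (G := G) ν V) = V ∘ tangentProj I G := by
  funext p
  unfold lagrangianEnergy
  rw [fiberDeriv_firstOrderLagrangian]
  exact sub_sub_cancel _ _

lemma cartanTwoForm_firstOrderLagrangian (ν : E →L[ℝ] ℝ) (V : G → ℝ) :
    cartanTwoForm I (firstOrderLagrangian I (G := G) ν V)
      = - DiffForm.pullback I.tangent I (tangentProj I G) (dLeft I G ν) := by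
  unfold cartanTwoForm
  rw [cartanOneForm_firstOrderLagrangian]
  congr 1
  funext p
  exact DiffForm.d_pullback (contMDiff_tangentProj I p)
    ((DiffForm.isSmooth_iff I).1 (isSmooth_leftInvariantForm I ν) _)

lemma val_cartanTwoForm (ν : E →L[ℝ] ℝ) (V : G → ℝ) (p : TangentBundle I G) (v w : E × E) :
    DiffForm.val I.tangent (cartanTwoForm I (firstOrderLagrangian I (G := G) ν V)) p ![v, w]
      = - DiffForm.val I (dLeft I G ν) p.proj ![tderiv I.tangent I (tangentProj I G) p v,
        tderiv I.tangent I (tangentProj I G) p w] := by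
  rw [cartanTwoForm_firstOrderLagrangian, ← tangentProj, ← alternating_comp_two]
  rfl

lemma mem_kerAt_dLeft_iff (ν : E →L[ℝ] ℝ) (g : G) (v : E) :
    (∀ w : E, DiffForm.val I (dLeft I G ν) g ![v, w] = 0)
      ↔ tderiv I 𝓘(ℝ, E →L[ℝ] ℝ) (orbE I ν) g v = 0 := by
  refine Iff.trans ?_ (tderiv_orbE_eq_zero_iff I ν g v).symm
  exact iff_of_eq (congrArg (fun S : Set E => v ∈ S) (kerAt_d_leftInvariantForm I ν g))

/-- Since `τ` is a submersion, testing against vectors of `TG` is testing `dα_ν` against all vectors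
of `G`. -/
lemma mem_kerAt_cartanTwoForm_iff (ν : E →L[ℝ] ℝ) (V : G → ℝ) (p : TangentBundle I G) (v : E × E) :
    v ∈ DiffForm.kerAt I.tangent (cartanTwoForm I (firstOrderLagrangian I (G := G) ν V)) p
      ↔ tderiv I 𝓘(ℝ, E →L[ℝ] ℝ) (orbE I ν) p.proj
        (tderiv I.tangent I (tangentProj I G) p v) = 0 := by
  rw [← mem_kerAt_dLeft_iff]
  constructor
  · intro h w
    obtain ⟨w', rfl⟩ := tderiv_tangentProj_surjective I p w
    rw [← neg_eq_zero, ← val_cartanTwoForm I ν V p v w']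
    exact h w'
  · intro h (w : E × E)
    have h1 := val_cartanTwoForm I ν V p v w
    rw [h, neg_zero] at h1
    exact h1

lemma tderiv_neg_apply {V : G → ℝ} (hV : ContMDiff I 𝓘(ℝ, ℝ) ∞ V) (g : G) (u : E) :
    tderiv I 𝓘(ℝ, ℝ) (fun g => - V g) g u = - tderiv I 𝓘(ℝ, ℝ) V g u := by
  have h := tderiv_comp I 𝓘(ℝ, ℝ) 𝓘(ℝ, ℝ) (g := fun r : ℝ => -r) (f := V) g
    (contDiff_neg.contMDiff.mdiff _) (hV.mdiff _)
  rw [h, tderiv_eq_fderiv, ContinuousLinearMap.comp_apply, fderiv_fun_neg, fderiv_fun_id]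
  rfl

lemma solvesHamiltonAt_cartanTwoForm_iff (ν : E →L[ℝ] ℝ) {V : G → ℝ}
    (hV : ContMDiff I 𝓘(ℝ, ℝ) ∞ V) (p : TangentBundle I G) (w : E × E) :
    SolvesHamiltonAt I.tangent (cartanTwoForm I (firstOrderLagrangian I (G := G) ν V))
        (lagrangianEnergy I (firstOrderLagrangian I (G := G) ν V)) p w
      ↔ ∀ u : E, DiffForm.val I (dLeft I G ν) p.proj
        ![tderiv I.tangent I (tangentProj I G) p w, u] = - tderiv I 𝓘(ℝ, ℝ) V p.proj u := by
  have hE := tderiv_comp I.tangent I 𝓘(ℝ, ℝ) (g := V) (f := tangentProj I G) p (hV.mdiff _)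
    ((contMDiff_tangentProj I).mdiff _)
  have hS : SolvesHamiltonAt I.tangent (cartanTwoForm I (firstOrderLagrangian I (G := G) ν V))
        (lagrangianEnergy I (firstOrderLagrangian I (G := G) ν V)) p w
      ↔ ∀ w' : E × E, DiffForm.val I.tangent
        (cartanTwoForm I (firstOrderLagrangian I (G := G) ν V)) p ![w, w']
        = tderiv I 𝓘(ℝ, ℝ) V p.proj (tderiv I.tangent I (tangentProj I G) p w') := by
    rw [lagrangianEnergy_firstOrderLagrangian]
    exact forall_congr' fun w' => iff_of_eq (congrArg (_ = ·)
      (congrArg (fun L : E × E →L[ℝ] ℝ => L w') hE))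
  rw [hS]
  constructor
  · intro h u
    obtain ⟨w', rfl⟩ := tderiv_tangentProj_surjective I p u
    rw [← h w', val_cartanTwoForm, neg_neg]
  · intro h w'
    rw [val_cartanTwoForm, h, neg_neg]

end Lagrangian

/-! ### The constraint algorithm -/

section ConstraintAlgorithm

variable {E : Type*} [NormedAddCommGroup E] [NormedSpace ℝ E]
  {H : Type*} [TopologicalSpace H] (I : ModelWithCorners ℝ E H)
  {G : Type*} [TopologicalSpace G] [ChartedSpace H G] [Group G] [LieGroup I ∞ G]
  [I.Boundaryless] [FiniteDimensional ℝ E]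

/-- The derivative of a `G_ν`-invariant function vanishes on the kernel of `dα_ν`. -/
lemma tderiv_eq_zero_of_invariant (ν : E →L[ℝ] ℝ) {V : G → ℝ} (hV : ContMDiff I 𝓘(ℝ, ℝ) ∞ V)
    (hVinv : ∀ g : G, ∀ h ∈ isoE I G ν, V (g * h) = V g) {g : G} {u : E}
    (hu : tderiv I 𝓘(ℝ, E →L[ℝ] ℝ) (orbE I ν) g u = 0) : tderiv I 𝓘(ℝ, ℝ) V g u = 0 := by
  have h1 : coadL I G ν (mcE I g u) = 0 :=
    (mem_isotropyAlgebra_iff I ν _).1 ((tderiv_orbE_eq_zero_iff I ν g u).1 hu)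
  -- The left trivialisation of `u` is the velocity of a curve `γ` in `G_ν`; `V` is constant along
  -- `g γ`, whose velocity is `u`.
  obtain ⟨γ, hγ, hS, h0, hv⟩ := exists_curve_of_mem_tangentVectorsTo I
    ((mem_tangentVectorsTo_isoE_iff I ν _).2 h1)
  have hm : ContMDiff I I ∞ fun x : G => g * x := contMDiff_mul_left
  have h2 := tderiv_comp 𝓘(ℝ, ℝ) I 𝓘(ℝ, ℝ) (g := V) (f := fun t => g * γ t) 0 (hV.mdiff _)
    ((hm.comp hγ).mdiff 0)
  have h3 := tderiv_comp 𝓘(ℝ, ℝ) I I (g := fun x : G => g * x) (f := γ) 0 (hm.mdiff _)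
    (hγ.mdiff 0)
  have h4 : (fun t => V (g * γ t)) = fun _ => V g := funext fun t => hVinv g _ (hS t)
  rw [h4, tderiv_const, h3, h0, mul_one] at h2
  have h5 := congrArg (fun L : ℝ →L[ℝ] ℝ => L 1) h2
  have h6 : tderiv I I (fun x : G => g * x) 1 (mcE I g u) = u :=
    congrArg (fun L : E →L[ℝ] E => L u) (tderiv_comp_mcE I g)
  rw [← h6, ← hv]
  exact h5.symm

/-- The range of the transpose of `B` is the annihilator of `ker B`, and by skewness the transpose
is `-B`; hence the witness `-v`. -/
lemma exists_apply_eq_of_ker_le {F : Type*} [AddCommGroup F] [Module ℝ F] [FiniteDimensional ℝ F]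
    (B : F →ₗ[ℝ] F →ₗ[ℝ] ℝ) (hB : ∀ v w, B v w = - B w v) (f : F →ₗ[ℝ] ℝ)
    (hf : ∀ v, B v = 0 → f v = 0) : ∃ v, B v = f := by
  have h1 : f ∈ LinearMap.range (LinearMap.dualMap B) := by
    rw [LinearMap.range_dualMap_eq_dualAnnihilator_ker]
    exact (Submodule.mem_dualAnnihilator f).2 fun v hv => hf v hv
  obtain ⟨Φ, hΦ⟩ := h1
  obtain ⟨v, rfl⟩ := (Module.evalEquiv ℝ F).surjective Φ
  refine ⟨-v, ?_⟩
  ext w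
  rw [← hΦ, map_neg, LinearMap.neg_apply, hB, neg_neg]
  rfl

lemma alternating_two_swap {F : Type*} [NormedAddCommGroup F] [NormedSpace ℝ F]
    (η : F [⋀^Fin 2]→L[ℝ] ℝ) (v w : F) : η ![v, w] = - η ![w, v] := by
  have h := η.toAlternatingMap.map_swap ![v, w] (show (0 : Fin 2) ≠ 1 by decide)
  have h2 : ![v, w] ∘ Equiv.swap (0 : Fin 2) 1 = ![w, v] := by
    ext i
    fin_cases i <;> rfl
  rw [h2] at h
  exact (neg_eq_iff_eq_neg.2 h).symm

/-- An alternating `2`-form as a bilinear form. -/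
def alternatingToBilin {F : Type*} [NormedAddCommGroup F] [NormedSpace ℝ F]
    (η : F [⋀^Fin 2]→L[ℝ] ℝ) : F →ₗ[ℝ] F →ₗ[ℝ] ℝ :=
  LinearMap.mk₂ ℝ (fun v w => η ![v, w])
    (fun v v' w => η.toAlternatingMap.map_vecCons_add ![w] v v')
    (fun c v w => η.toAlternatingMap.map_vecCons_smul ![w] c v)
    (fun v w w' => by
      rw [alternating_two_swap η v, alternating_two_swap η v w, alternating_two_swap η v w',
        ← neg_add]
      exact congrArg Neg.neg (η.toAlternatingMap.map_vecCons_add ![v] w w'))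
    (fun c v w => by
      rw [alternating_two_swap η v, alternating_two_swap η v w, smul_neg]
      exact congrArg Neg.neg (η.toAlternatingMap.map_vecCons_smul ![v] c w))

/-- The Hamilton equation for an invariant function has a solution at every point. -/
lemma exists_solution (ν : E →L[ℝ] ℝ) {V : G → ℝ} (hV : ContMDiff I 𝓘(ℝ, ℝ) ∞ V)
    (hVinv : ∀ g : G, ∀ h ∈ isoE I G ν, V (g * h) = V g) (g : G) :
    ∃ v : E, ∀ u : E, DiffForm.val I (dLeft I G ν) g ![v, u] = - tderiv I 𝓘(ℝ, ℝ) V g u := by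
  let B : E →ₗ[ℝ] E →ₗ[ℝ] ℝ := alternatingToBilin (DiffForm.val I (dLeft I G ν) g)
  have hB : ∀ v w, B v w = - B w v :=
    alternating_two_swap (DiffForm.val I (dLeft I G ν) g)
  obtain ⟨v, hv⟩ := exists_apply_eq_of_ker_le B hB (-(tderiv I 𝓘(ℝ, ℝ) V g).toLinearMap)
    fun v hv => by
      have h1 := (mem_kerAt_dLeft_iff I ν g v).1 fun w => congrArg (fun L : E →ₗ[ℝ] ℝ => L w) hv
      rw [LinearMap.neg_apply, neg_eq_zero]
      exact tderiv_eq_zero_of_invariant I ν hV hVinv h1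
  exact ⟨v, fun u => congrArg (fun L : E →ₗ[ℝ] ℝ => L u) hv⟩

lemma constraintSet_firstOrderLagrangian (ν : E →L[ℝ] ℝ) {V : G → ℝ}
    (hV : ContMDiff I 𝓘(ℝ, ℝ) ∞ V) (hVinv : ∀ g : G, ∀ h ∈ isoE I G ν, V (g * h) = V g) (n : ℕ) :
    constraintSet I.tangent (cartanTwoForm I (firstOrderLagrangian I (G := G) ν V))
      (lagrangianEnergy I (firstOrderLagrangian I (G := G) ν V)) n = univ := by
  induction n with
  | zero => rfl
  | succ n ih =>
    refine eq_univ_of_forall fun p => ?_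
    obtain ⟨v, hv⟩ := exists_solution I ν hV hVinv p.proj
    obtain ⟨w, rfl⟩ := tderiv_tangentProj_surjective I p v
    -- While the constraint set is all of `TG`, tangency only asks for some curve with velocity `w`.
    obtain ⟨γ, hγ, h0, hw⟩ := exists_curve_through I.tangent p w
    refine ⟨by rw [ih]; trivial, w, ?_, (solvesHamiltonAt_cartanTwoForm_iff I ν hV p w).2 hv⟩
    rw [ih]
    exact mem_tangentVectorsTo_of_curve I.tangent hγ (fun _ => trivial) h0 hw

end ConstraintAlgorithm

/-! ### The leaves of the characteristic distribution -/

section Leaves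

variable {E : Type*} [NormedAddCommGroup E] [NormedSpace ℝ E]
  {H : Type*} [TopologicalSpace H] (I : ModelWithCorners ℝ E H)
  {G : Type*} [TopologicalSpace G] [ChartedSpace H G] [Group G] [LieGroup I ∞ G]
  [I.Boundaryless] [FiniteDimensional ℝ E]

/-- A curve in `TG` is tangent to the characteristic distribution if and only if the coadjoint
orbit map is constant along its projection. -/
lemma velocity_mem_kerAt_iff (ν : E →L[ℝ] ℝ) (V : G → ℝ) {γ : ℝ → TangentBundle I G}
    (hγ : ContMDiff 𝓘(ℝ, ℝ) I.tangent ∞ γ) :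
    (∀ t, mfderiv 𝓘(ℝ, ℝ) I.tangent γ t (1 : ℝ) ∈
      DiffForm.kerAt I.tangent (cartanTwoForm I (firstOrderLagrangian I (G := G) ν V)) (γ t))
      ↔ ∀ t, orbE I ν (γ t).proj = orbE I ν (γ 0).proj := by
  have hγ' : ContMDiff 𝓘(ℝ, ℝ) I ∞ fun t => (γ t).proj := (contMDiff_tangentProj I).comp hγ
  have hf : ContDiff ℝ ∞ fun t => orbE I ν (γ t).proj := ((contMDiff_orbE I ν).comp hγ').contDiff
  -- The kernel of `ω_L` is where the orbit map after `τ` has zero derivative, so tangency is the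
  -- vanishing of the derivative of `orbE` along the projected curve.
  have h1 : ∀ t, mfderiv 𝓘(ℝ, ℝ) I.tangent γ t (1 : ℝ) ∈
      DiffForm.kerAt I.tangent (cartanTwoForm I (firstOrderLagrangian I (G := G) ν V)) (γ t)
      ↔ deriv (fun t => orbE I ν (γ t).proj) t = 0 := fun t => by
    refine (mem_kerAt_cartanTwoForm_iff I ν V (γ t)
      (tderiv 𝓘(ℝ, ℝ) I.tangent γ t 1)).trans (iff_of_eq (congrArg (· = 0) ?_))
    have h2 := tderiv_comp 𝓘(ℝ, ℝ) I 𝓘(ℝ, E →L[ℝ] ℝ) (g := orbE I ν)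
      (f := fun t => (γ t).proj) t ((contMDiff_orbE I ν).mdiff _) (hγ'.mdiff t)
    have h3 := tderiv_comp 𝓘(ℝ, ℝ) I.tangent I (g := tangentProj I G) (f := γ) t
      ((contMDiff_tangentProj I).mdiff _) (hγ.mdiff t)
    rw [tderiv_eq_fderiv] at h2
    rw [← fderiv_apply_one_eq_deriv, h2]
    exact congrArg (fun v : E => tderiv I 𝓘(ℝ, E →L[ℝ] ℝ) (orbE I ν) (γ t).proj v)
      (congrArg (fun L : ℝ →L[ℝ] E => L 1) h3).symm
  simp only [h1]
  constructor
  · exact fun h t => is_const_of_deriv_eq_zero (hf.differentiable (by simp)) h t 0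
  · intro h t
    rw [show (fun t => orbE I ν (γ t).proj) = fun _ => orbE I ν (γ 0).proj from funext h,
      deriv_const]

variable (G) in
/-- The leaf relation of the first-order Lagrangian. -/
def LeafRel (ν : E →L[ℝ] ℝ) (V : G → ℝ) : TangentBundle I G → TangentBundle I G → Prop :=
  SameCharacteristicLeaf I.tangent (cartanTwoForm I (firstOrderLagrangian I (G := G) ν V))

lemma LeafRel.of_curve (ν : E →L[ℝ] ℝ) (V : G → ℝ) {γ : ℝ → TangentBundle I G}
    (hγ : ContMDiff 𝓘(ℝ, ℝ) I.tangent ∞ γ)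
    (h : ∀ t, orbE I ν (γ t).proj = orbE I ν (γ 0).proj) : LeafRel I G ν V (γ 0) (γ 1) :=
  Relation.ReflTransGen.single ⟨γ, hγ, rfl, rfl, (velocity_mem_kerAt_iff I ν V hγ).2 h⟩

lemma LeafRel.of_fibre (ν : E →L[ℝ] ℝ) (V : G → ℝ) (x : G) (v w : E) :
    LeafRel I G ν V ⟨x, v⟩ ⟨x, w⟩ := by
  have ha : ContDiff ℝ ∞ fun t : ℝ => v + t • (w - v) :=
    contDiff_const.add (contDiff_id.smul contDiff_const)
  have h := LeafRel.of_curve I ν V (contMDiff_fibre_curve I x ha) fun t => rfl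
  simpa using h

/-- The coset `x G_ν`, as a fibre of the coadjoint orbit map. -/
def orbitFibre (ν : E →L[ℝ] ℝ) (x : G) : Set G := {y | orbE I ν y = orbE I ν x}

/-- Each arc projects to a connected subset of a single coset, so no arc leaves the component. -/
lemma LeafRel.mem_connectedComponentIn {ν : E →L[ℝ] ℝ} {V : G → ℝ} {p q : TangentBundle I G}
    (h : LeafRel I G ν V p q) : q.proj ∈ connectedComponentIn (orbitFibre I ν p.proj) p.proj := by
  induction h with
  | refl => exact _root_.mem_connectedComponentIn rfl
  | tail _ hs ih =>
    obtain ⟨γ, hγ, rfl, rfl, hk⟩ := hs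
    have hc := (velocity_mem_kerAt_iff I ν V hγ).1 hk
    rw [connectedComponentIn_eq ih]
    have h0 : orbE I ν (γ 0).proj = orbE I ν p.proj := connectedComponentIn_subset (orbitFibre I ν p.proj) _ ih
    have hγ' : Continuous fun t => (γ t).proj := ((contMDiff_tangentProj I).comp hγ).continuous
    exact (isPreconnected_range hγ').subset_connectedComponentIn ⟨0, rfl⟩
      (range_subset_iff.2 fun t => (hc t).trans h0) ⟨1, rfl⟩

lemma LeafRel.of_mem_connectedComponentIn (ν : E →L[ℝ] ℝ) (V : G → ℝ) {p q : TangentBundle I G}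
    (h : q.proj ∈ connectedComponentIn (orbitFibre I ν p.proj) p.proj) : LeafRel I G ν V p q := by
  have hp : p.proj ∈ connectedComponentIn (orbitFibre I ν p.proj) p.proj :=
    _root_.mem_connectedComponentIn rfl
  have key : LeafRel I G ν V ⟨p.proj, 0⟩ ⟨q.proj, 0⟩ := by
    -- On a preconnected set, a transitive relation holding in both directions between each point
    -- and its neighbours holds throughout. Short arcs in the coset, lifted by the zero section,
    -- give the local relation.
    refine isPreconnected_connectedComponentIn.induction₂'
      (fun x y => LeafRel I G ν V ⟨x, 0⟩ ⟨y, 0⟩) (fun x hx => ?_)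
      (fun x y z _ _ _ h1 h2 => h1.trans h2) hp h
    have hx' : orbE I ν x = orbE I ν p.proj := connectedComponentIn_subset (orbitFibre I ν p.proj) _ hx
    filter_upwards [self_mem_nhdsWithin, nhdsWithin_le_nhds (eventually_exists_arc I ν x)]
      with y hy hxy
    have hy' : orbE I ν y = orbE I ν p.proj := 
      connectedComponentIn_subset (orbitFibre I ν p.proj) _ hy
    obtain ⟨γ, hγ, rfl, rfl, hc⟩ := hxy (hy'.trans hx'.symm)
    refine ⟨LeafRel.of_curve I ν V ((contMDiff_tangent_zero I).comp hγ) hc, ?_⟩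
    -- The reversed arc gives the other direction.
    have hr : ContDiff ℝ ∞ fun t : ℝ => 1 - t := contDiff_const.sub contDiff_id
    have h1 := LeafRel.of_curve I ν V
      ((contMDiff_tangent_zero I).comp (hγ.comp hr.contMDiff)) fun t =>
        (hc (1 - t)).trans (hc (1 - 0)).symm
    simp only [comp_apply] at h1
    rwa [sub_zero, sub_self] at h1
  exact ((LeafRel.of_fibre I ν V p.proj p.snd 0).trans key).trans
    (LeafRel.of_fibre I ν V q.proj 0 q.snd)

lemma leafRel_iff (ν : E →L[ℝ] ℝ) (V : G → ℝ) (p q : TangentBundle I G) :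
    LeafRel I G ν V p q ↔ q.proj ∈ connectedComponentIn (orbitFibre I ν p.proj) p.proj :=
  ⟨LeafRel.mem_connectedComponentIn I, LeafRel.of_mem_connectedComponentIn I ν V⟩

lemma isPreconnected_orbitFibre {ν : E →L[ℝ] ℝ} (h : IsConnected (isoE I G ν : Set G)) (x : G) :
    IsPreconnected (orbitFibre I ν x) := by
  have : IsTopologicalGroup G := topologicalGroup_of_lieGroup I ∞
  have h1 : orbitFibre I ν x = (fun y => x * y) '' (isoE I G ν : Set G) := by
    ext y
    constructor
    · intro (hy : orbE I ν y = orbE I ν x)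
      refine ⟨x⁻¹ * y, ?_, mul_inv_cancel_left x y⟩
      change orbE I ν (x⁻¹ * y) = ν
      rw [orbE_mul, hy, ← orbE_mul, inv_mul_cancel, orbE_one]
    · rintro ⟨z, hz, rfl⟩
      change orbE I ν (x * z) = orbE I ν x
      rw [orbE_mul, (mem_isoE I).1 hz]
      rfl
  rw [h1]
  exact h.isPreconnected.image _ (continuous_const_mul x).continuousOn

lemma preimage_orbitProj (ν : E →L[ℝ] ℝ) (x : G) :
    orbitProj I G ν ⁻¹' {orbitProj I G ν x} = orbitFibre I ν x := by
  ext y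
  exact orbitProj_eq_iff I

lemma leafRel_iff_of_isConnected {ν : E →L[ℝ] ℝ} (h : IsConnected (isoE I G ν : Set G))
    (V : G → ℝ) (p q : TangentBundle I G) :
    LeafRel I G ν V p q ↔ orbitProj I G ν p.proj = orbitProj I G ν q.proj := by
  rw [leafRel_iff, (isPreconnected_orbitFibre I h p.proj).connectedComponentIn rfl,
    ← preimage_orbitProj]
  exact eq_comm

lemma leafRel_iff_preimage (ν : E →L[ℝ] ℝ) (V : G → ℝ) (p q : TangentBundle I G) :
    LeafRel I G ν V p q ↔ q.proj ∈
      connectedComponentIn (orbitProj I G ν ⁻¹' {orbitProj I G ν p.proj}) p.proj := by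
  rw [preimage_orbitProj, leafRel_iff]

end Leaves

end

/-! ### The main theorem -/

theorem mainTheorem2 {E : Type*} [NormedAddCommGroup E] [NormedSpace ℝ E] [FiniteDimensional ℝ E]
    {H : Type*} [TopologicalSpace H] (I : ModelWithCorners ℝ E H) [I.Boundaryless]
    {G : Type*} [TopologicalSpace G] [T2Space G] [ChartedSpace H G] [Group G] [LieGroup I ∞ G]
    (ν : GroupLieAlgebra I G →L[ℝ] ℝ) (V : G → ℝ) (hV : ContMDiff I 𝓘(ℝ, ℝ) ∞ V)
    (hVinv : ∀ g : G, ∀ h ∈ isotropyGroup I ν, V (g * h) = V g) :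
    -- the data on `G` and `TG`
    let dα : DiffForm I G 2 := DiffForm.d I (leftInvariantForm I ν)
    let τ : TangentBundle I G → G := fun p => p.proj
    let dτ := fun p : TangentBundle I G => mfderiv I.tangent I τ p
    let L : TangentBundle I G → ℝ := firstOrderLagrangian I ν V
    let ΩL : DiffForm I.tangent (TangentBundle I G) 2 := cartanTwoForm I L
    let EL : TangentBundle I G → ℝ := lagrangianEnergy I L
    let π : G → G ⧸ isotropyGroup I ν := fun g => (g : G ⧸ isotropyGroup I ν)
    let k : ℕ := Module.finrank ℝ (GroupLieAlgebra I G ⧸ (isotropyAlgebra I ν).toSubmodule)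
    -- `dα_ν` is presymplectic, its kernel is the left translate of `𝔤_ν`,
    -- and `𝔤_ν` is the Lie algebra of the isotropy group `G_ν`
    DiffForm.IsPresymplectic I dα ∧
    (∀ g : G, DiffForm.kerAt I dα g = {v | maurerCartan I g v ∈ isotropyAlgebra I ν}) ∧
    tangentVectorsTo I (isotropyGroup I ν : Set G) 1
      = (isotropyAlgebra I ν : Set (GroupLieAlgebra I G)) ∧
    -- the Lagrangian system: Cartan forms, energy, characteristic distribution
    cartanOneForm I L = DiffForm.pullback I.tangent I τ (leftInvariantForm I ν) ∧
    ΩL = - DiffForm.pullback I.tangent I τ dα ∧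
    EL = V ∘ τ ∧
    (∀ p : TangentBundle I G, DiffForm.kerAt I.tangent ΩL p
      = {w | maurerCartan I p.proj (dτ p w) ∈ isotropyAlgebra I ν}) ∧
    -- the constraint algorithm stops at the first step, with final constraint set `TG`
    (∀ n : ℕ, constraintSet I.tangent ΩL EL n = univ) ∧
    -- the dynamical equation on `TG` is the equation `i_Γ dα_ν = - dV` on `G`
    (∀ (p : TangentBundle I G) (w : TangentSpace I.tangent p),
      SolvesHamiltonAt I.tangent ΩL EL p w
        ↔ SolvesHamiltonAt I dα (fun g => - V g) p.proj (dτ p w)) ∧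
    -- the leaves of `ker Ω_L` are the preimages of the connected components of the cosets `g G_ν`;
    -- if `G_ν` is connected they are the fibres of `TG → G / G_ν`
    (∀ p q : TangentBundle I G, SameCharacteristicLeaf I.tangent ΩL p q
      ↔ q.proj ∈ connectedComponentIn (π ⁻¹' {π p.proj}) p.proj) ∧
    (IsConnected (isotropyGroup I ν : Set G) → ∀ p q : TangentBundle I G,
      SameCharacteristicLeaf I.tangent ΩL p q ↔ π (τ p) = π (τ q)) ∧
    -- `G / G_ν` is a smooth manifold
    T2Space (G ⧸ isotropyGroup I ν) ∧
    ∃ _ : ChartedSpace (EuclideanSpace ℝ (Fin k)) (G ⧸ isotropyGroup I ν),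
      IsManifold (𝓡 k) ∞ (G ⧸ isotropyGroup I ν) ∧
      -- the projection of `G` onto it is a surjective submersion
      ContMDiff I (𝓡 k) ∞ π ∧
      (∀ g : G, Surjective (mfderiv I (𝓡 k) π g)) ∧
      -- `g G_ν ↦ Ad^*_g ν` is a `G`-equivariant injective immersion into `𝔤^*` with image `O_ν`
      -- (`𝔤` is, as a vector space, the model space `E` of `G`)
      (let j : G ⧸ isotropyGroup I ν → (E →L[ℝ] ℝ) := orbitMap I ν
       (∀ (g : G) (x : G ⧸ isotropyGroup I ν), j (g • x) = coAd I g (j x)) ∧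
       Injective j ∧
       range j = coadjointOrbit I ν ∧
       ContMDiff (𝓡 k) 𝓘(ℝ, E →L[ℝ] ℝ) ∞ j ∧
       (∀ x, Injective (mfderiv (𝓡 k) 𝓘(ℝ, E →L[ℝ] ℝ) j x)) ∧
       (∀ x, range (mfderiv (𝓡 k) 𝓘(ℝ, E →L[ℝ] ℝ) j x)
          = range fun ξ : GroupLieAlgebra I G => coadInf I ξ (orbitMap I ν x)) ∧
       -- `dα_ν` projects to exactly one form `σ` on `G / G_ν`; it is symplectic, and it is the
       -- Kirillov–Kostant–Souriau form of `O_ν`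
       ∃ σ : DiffForm (𝓡 k) (G ⧸ isotropyGroup I ν) 2,
        (∀ σ' : DiffForm (𝓡 k) (G ⧸ isotropyGroup I ν) 2,
          DiffForm.pullback I (𝓡 k) π σ' = dα ↔ σ' = σ) ∧
        DiffForm.IsSymplectic (𝓡 k) σ ∧
        ∀ (x : G ⧸ isotropyGroup I ν) (v w : TangentSpace (𝓡 k) x),
          σ x ![v, w] = kksForm I (orbitMap I ν x)
            (mfderiv (𝓡 k) 𝓘(ℝ, E →L[ℝ] ℝ) j x v)
            (mfderiv (𝓡 k) 𝓘(ℝ, E →L[ℝ] ℝ) j x w)) := by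
  refine ⟨isPresymplectic_d_leftInvariantForm I ν, kerAt_d_leftInvariantForm I ν, ?_,
    cartanOneForm_firstOrderLagrangian I ν V, cartanTwoForm_firstOrderLagrangian I ν V,
    lagrangianEnergy_firstOrderLagrangian I ν V, fun p => ?_,
    constraintSet_firstOrderLagrangian I ν hV hVinv, fun p w => ?_, fun p q => ?_,
    fun hc p q => ?_, t2Space_orbitSpace I ν, orbitChartedSpace I ν, isManifold_orbitSpace I ν,
    contMDiff_orbitProj I ν, tderiv_orbitProj_surjective I ν, jE_smul I ν, jE_injective I ν, ?_,
    contMDiff_jE I ν, tderiv_jE_injective I ν, range_tderiv_jE I ν, orbitForm I G ν,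
    fun σ' => ⟨fun h => ?_, ?_⟩, isSymplectic_orbitForm I ν, val_orbitForm I ν⟩
  · ext ξ
    exact (mem_tangentVectorsTo_isoE_iff I ν ξ).trans (mem_isotropyAlgebra_iff I ν ξ).symm
  · ext w
    exact (mem_kerAt_cartanTwoForm_iff I ν V p w).trans (tderiv_orbE_eq_zero_iff I ν p.proj _)
  · refine (solvesHamiltonAt_cartanTwoForm_iff I ν hV p w).trans (forall_congr' fun u => ?_)
    rw [← tderiv_neg_apply I hV]
    rfl
  · exact leafRel_iff_preimage I ν V p q
  · exact leafRel_iff_of_isConnected I hc V p q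
  · exact (orbitProj_surjective (G := G) I ν).range_comp (jE I G ν) |>.symm
  · funext x
    obtain ⟨g, rfl⟩ := orbitProj_surjective (G := G) I ν x
    -- Uniqueness of `σ`: the derivative of `π` is onto, so pullback loses nothing.
    exact pullback_orbitProj_injective I ν
      (congrFun (h.trans (pullback_orbitForm I ν).symm) g)
  · rintro rfl
    exact pullback_orbitForm I ν
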